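/- Let $d$ be a natural number, let $\mathbb{F}_d^*$ be the unital free semigroup on $d$ generators, with empty word $\varnothing$ and length function $|\cdot|$, and let $\{\xi_w : w\in\mathbb{F}_d^*\}$ be the canonical orthonormal basis of the Fock space $H=\ell^2(\mathbb{F}_d^*)$. For $u\in\mathbb{F}_d^*$ let $L_u\in B(H)$ be the isometry with $L_u\xi_w=\xi_{uw}$, and let $\mathcal{L}_d\subseteq B(H)$ be the unital algebra generated by the $L_u$, closed in the weak operator topology (WOT). For weak*-closed subspaces $\mathcal{A}\subseteq B(H_1)$, $\mathcal{B}\subseteq B(H_2)$ the normal tensor product $\mathcal{A}\,\overline{\otimes}\,\mathcal{B}$ is the weak*-closed linear span of the operators $a\otimes b$ ($a\in\mathcal{A}$, $b\in\mathcal{B}$) in $B(H_1\otimes H_2)$. A Hopf dual algebra is a weak*-closed unital algebra $\mathcal{A}$ of Hilbert space operators with a unital, weak*-continuous, completely contractive homomorphism $\Delta_{\mathcal{A}}:\mathcal{A}\to\mathcal{A}\,\overline{\otimes}\,\mathcal{A}$ (the comultiplication) that is coassociative: $(\mathrm{id}\otimes\Delta_{\mathcal{A}})\Delta_{\mathcal{A}}=(\Delta_{\mathcal{A}}\otimes\mathrm{id})\Delta_{\mathcal{A}}$,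 where $\mathrm{id}\otimes\Delta_{\mathcal A}$ and $\Delta_{\mathcal A}\otimes\mathrm{id}$ denote the weak*-continuous extensions to $\mathcal{A}\,\overline{\otimes}\,\mathcal{A}$. Let $\Delta:\mathcal{L}_d\to\mathcal{L}_d\,\overline{\otimes}\,\mathcal{L}_d$ be the comultiplication of $\mathcal{L}_d$ determined by $\Delta(L_w)=L_w\otimes L_w$ for $w\in\mathbb{F}_d^*$. Let $\mathcal{J}$ be a WOT-closed two-sided ideal of $\mathcal{L}_d$. It is called a Hopf ideal if it is a coideal, i.e. $\Delta(\mathcal{J})\subseteq\overline{\mathcal{J}\otimes\mathcal{L}_d+\mathcal{L}_d\otimes\mathcal{J}}^{\,w^*}$, and homogeneous if it is generated, as a WOT-closed two-sided ideal, by a set of homogeneous polynomials, i.e. of elements of $\bigcup_{n\ge0}\operatorname{span}\{L_w : |w|=n\}$. Put $\mathcal{N}_{\mathcal{J}}=(\mathcal{J}\xi_\varnothing)^\perp$, let $\pi_{\mathcal{J}}(A)=P_{\mathcal{N}_{\mathcal{J}}}A|_{\mathcal{N}_{\mathcal{J}}}$ be the compression map, and let $\mathcal{L}_{\mathcal{J}}=\pi_{\mathcal{J}}(\mathcal{L}_d)\subseteq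 B(\mathcal{N}_{\mathcal{J}})$ be the compression algebra. Let $\pi_{\mathcal{J}}\otimes\pi_{\mathcal{J}}$ denote the compression of operators from $H\otimes H$ to $\mathcal{N}_{\mathcal{J}}\otimes\mathcal{N}_{\mathcal{J}}$. (i) If $\mathcal{J}$ is a Hopf ideal, then $\mathcal{L}_{\mathcal{J}}$ is a Hopf dual algebra with a comultiplication $\Delta_{\mathcal{J}}$ that satisfies $\Delta_{\mathcal{J}}(\pi_{\mathcal{J}}(A))=(\pi_{\mathcal{J}}\otimes\pi_{\mathcal{J}})(\Delta(A))$ for all $A\in\mathcal{L}_d$; in particular $\Delta_{\mathcal{J}}(\pi_{\mathcal{J}}(L_w))=\pi_{\mathcal{J}}(L_w)\otimes\pi_{\mathcal{J}}(L_w)$ for all $w\in\mathbb{F}_d^*$. (ii) Conversely, if $\mathcal{J}$ is homogeneous and $\mathcal{L}_{\mathcal{J}}$ is a Hopf dual algebra with the canonical comultiplication, i.e. with a comultiplication $\Delta_{\mathcal{J}}$ such that $\Delta_{\mathcal{J}}(\pi_{\mathcal{J}}(L_w))=\pi_{\mathcal{J}}(L_w)\otimes\pi_{\mathcal{J}}(L_w)$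 for all $w\in\mathbb{F}_d^*$, then $\mathcal{J}$ is a Hopf ideal. -/

import Mathlib

open scoped TensorProduct InnerProductSpace Topology

namespace HopfDual

noncomputable section

/-! ### Hilbert space tensor products and the weak* topology of `B(H)` -/

section General

variable {H K H' K' : Type*}
  [NormedAddCommGroup H] [InnerProductSpace ℂ H]
  [NormedAddCommGroup K] [InnerProductSpace ℂ K]
  [NormedAddCommGroup H'] [InnerProductSpace ℂ H']
  [NormedAddCommGroup K'] [InnerProductSpace ℂ K']

/-- The Hilbert space tensor product: completion of the algebraic tensor product with
`⟪x ⊗ y, x' ⊗ y'⟫ = ⟪x, x'⟫ ⟪y, y'⟫`. -/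
abbrev HTensor (H K : Type*) [NormedAddCommGroup H] [InnerProductSpace ℂ H]
    [NormedAddCommGroup K] [InnerProductSpace ℂ K] : Type _ :=
  UniformSpace.Completion (H ⊗[ℂ] K)

/-- The elementary tensor `x ⊗ y` in the Hilbert space tensor product. -/
def vtmul (x : H) (y : K) : HTensor H K := ((x ⊗ₜ[ℂ] y : H ⊗[ℂ] K) : HTensor H K)

/-- The operator `A ⊗ B`, with `(A ⊗ B) (x ⊗ y) = A x ⊗ B y`. -/
def otmul (A : H →L[ℂ] H') (B : K →L[ℂ] K') : HTensor H K →L[ℂ] HTensor H' K' :=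
  (TensorProduct.mapL A B).completion

theorem completion_add {E F : Type*} [NormedAddCommGroup E] [NormedSpace ℂ E]
    [NormedAddCommGroup F] [NormedSpace ℂ F] (f g : E →L[ℂ] F) :
    (f + g).completion = f.completion + g.completion := by
  ext z
  induction z using UniformSpace.Completion.induction_on with
  | hp => exact isClosed_eq (ContinuousLinearMap.continuous _) (ContinuousLinearMap.continuous _)
  | ih a =>
    rw [add_apply]
    simp only [ContinuousLinearMap.completion_apply_coe, add_apply,
      UniformSpace.Completion.coe_add]

theorem completion_smul {E F : Type*} [NormedAddCommGroup E] [NormedSpace ℂ E]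
    [NormedAddCommGroup F] [NormedSpace ℂ F] (c : ℂ) (f : E →L[ℂ] F) :
    (c • f).completion = c • f.completion := by
  ext z
  induction z using UniformSpace.Completion.induction_on with
  | hp => exact isClosed_eq (ContinuousLinearMap.continuous _) (ContinuousLinearMap.continuous _)
  | ih a =>
    rw [smul_apply]
    simp only [ContinuousLinearMap.completion_apply_coe, smul_apply,
      UniformSpace.Completion.coe_smul]

theorem otmul_vtmul (A : H →L[ℂ] H') (B : K →L[ℂ] K') (x : H) (y : K) :
    otmul A B (vtmul x y) = vtmul (A x) (B y) := by
  simp [otmul, vtmul]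

theorem inner_vtmul (x x' : H) (y y' : K) :
    inner ℂ (vtmul x y) (vtmul x' y') = inner ℂ x x' * inner ℂ y y' := by
  simp [vtmul]

theorem summable_ultraweak (x y : lp (fun _ : ℕ => H) 2) (T : H →L[ℂ] H) :
    Summable fun n => inner ℂ (y n) (T (x n)) := by
  have hx : Summable fun n => ‖x n‖ ^ (2 : ℝ) := by
    simpa using (lp.memℓp x).summable (by norm_num)
  have hy : Summable fun n => ‖y n‖ ^ (2 : ℝ) := by
    simpa using (lp.memℓp y).summable (by norm_num)
  refine Summable.of_norm_bounded ((hx.add hy).mul_left ‖T‖) fun n => ?_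
  have h1 : ‖inner ℂ (y n) (T (x n))‖ ≤ ‖y n‖ * (‖T‖ * ‖x n‖) :=
    (norm_inner_le_norm _ _).trans
      (mul_le_mul_of_nonneg_left (T.le_opNorm _) (norm_nonneg _))
  have h2 : ‖y n‖ * ‖x n‖ ≤ ‖x n‖ ^ 2 + ‖y n‖ ^ 2 := by
    nlinarith [sq_nonneg (‖x n‖ - ‖y n‖), sq_nonneg ‖x n‖, sq_nonneg ‖y n‖]
  calc _ ≤ ‖y n‖ * (‖T‖ * ‖x n‖) := h1
    _ = ‖T‖ * (‖y n‖ * ‖x n‖) := by ring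
    _ ≤ ‖T‖ * (‖x n‖ ^ 2 + ‖y n‖ ^ 2) := mul_le_mul_of_nonneg_left h2 (norm_nonneg _)
    _ = _ := by norm_num

/-- The normal functionals `T ↦ ∑ₙ ⟪T xₙ, yₙ⟫` (inner product linear in `T xₙ`), for
square-summable sequences `x`, `y` in `H`, jointly as one linear map. -/
def ultraweakPairing (H : Type*) [NormedAddCommGroup H] [InnerProductSpace ℂ H] :
    (H →L[ℂ] H) →ₗ[ℂ] (lp (fun _ : ℕ => H) 2 × lp (fun _ : ℕ => H) 2 → ℂ) where
  toFun T p := ∑' n, inner ℂ (p.2 n) (T (p.1 n))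
  map_add' S T := by
    funext p
    simp only [add_apply, inner_add_right, Pi.add_apply]
    exact (summable_ultraweak p.1 p.2 S).tsum_add (summable_ultraweak p.1 p.2 T)
  map_smul' c T := by
    funext p
    simp only [smul_apply, inner_smul_right, Pi.smul_apply, smul_eq_mul,
      RingHom.id_apply]
    exact tsum_mul_left

/-- The weak* (ultraweak) topology of `B(H)`: the topology of pointwise convergence on the
predual, i.e. on the functionals `T ↦ ∑ₙ ⟪T xₙ, yₙ⟫` with `∑ ‖xₙ‖² < ∞`, `∑ ‖yₙ‖² < ∞`. -/
@[reducible]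
def ultraweak (H : Type*) [NormedAddCommGroup H] [InnerProductSpace ℂ H] :
    TopologicalSpace (H →L[ℂ] H) :=
  TopologicalSpace.induced (ultraweakPairing H) Pi.topologicalSpace

/-- The weak* closure of a linear subspace of `B(H)`. -/
def ultraweakClosure (S : Submodule ℂ (H →L[ℂ] H)) : Submodule ℂ (H →L[ℂ] H) :=
  letI : TopologicalSpace (H →L[ℂ] H) := ultraweak H
  haveI : ContinuousAdd (H →L[ℂ] H) := continuousAdd_induced (ultraweakPairing H)
  haveI : ContinuousSMul ℂ (H →L[ℂ] H) := continuousSMul_induced (ultraweakPairing H)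
  S.topologicalClosure

theorem le_ultraweakClosure (S : Submodule ℂ (H →L[ℂ] H)) : S ≤ ultraweakClosure S :=
  fun _ h => @subset_closure _ (ultraweak H) _ _ h

/-- `S` is closed in the weak* topology. -/
def IsWeakStarClosed (S : Set (H →L[ℂ] H)) : Prop :=
  IsClosed[ultraweak H] S

/-- `S` is closed in the weak operator topology. -/
def IsWOTClosed (S : Set (H →L[ℂ] H)) : Prop :=
  IsClosed {T : H →WOT[ℂ] H | T.toCLM ∈ S}

/-- Weak*-to-weak* continuity of a map from a subspace of `B(H)` to `B(K)`; the subspace has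
the relative weak* topology. -/
def IsWeakStarContinuous {𝒮 : Type*} [SetLike 𝒮 (H →L[ℂ] H)] {S : 𝒮}
    (φ : S → (K →L[ℂ] K)) : Prop :=
  @Continuous _ _ (TopologicalSpace.induced Subtype.val (ultraweak H)) (ultraweak K) φ

/-- The operator on `Hⁿ` (the `ℓ²`-direct sum) given by an `n × n` matrix of operators. -/
def opMatrix {n : ℕ} (a : Fin n → Fin n → (H →L[ℂ] H)) :
    PiLp 2 (fun _ : Fin n => H) →L[ℂ] PiLp 2 (fun _ : Fin n => H) :=
  (PiLp.continuousLinearEquiv 2 ℂ (fun _ : Fin n => H)).symm.toContinuousLinearMap ∘L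
    ContinuousLinearMap.pi fun i => ∑ j, a i j ∘L PiLp.proj 2 (fun _ : Fin n => H) j

/-- All matrix amplifications of `φ` are contractive. -/
def IsCompletelyContractive {𝒮 : Type*} [SetLike 𝒮 (H →L[ℂ] H)] {S : 𝒮}
    (φ : S → (K →L[ℂ] K)) : Prop :=
  ∀ (n : ℕ) (a : Fin n → Fin n → S),
    ‖opMatrix fun i j => φ (a i j)‖ ≤ ‖opMatrix fun i j => (a i j : H →L[ℂ] H)‖

/-- The normal tensor product of two subspaces of `B(H)`, `B(K)`: the weak* closed span of
the operators `a ⊗ b` in `B(H ⊗ K)`. -/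
def normalTensor (A : Submodule ℂ (H →L[ℂ] H)) (B : Submodule ℂ (K →L[ℂ] K)) :
    Submodule ℂ (HTensor H K →L[ℂ] HTensor H K) :=
  ultraweakClosure (Submodule.span ℂ {T | ∃ a ∈ A, ∃ b ∈ B, T = otmul a b})

theorem otmul_mem_normalTensor {A : Submodule ℂ (H →L[ℂ] H)} {B : Submodule ℂ (K →L[ℂ] K)}
    {a : H →L[ℂ] H} {b : K →L[ℂ] K} (ha : a ∈ A) (hb : b ∈ B) :
    otmul a b ∈ normalTensor A B :=
  le_ultraweakClosure _ (Submodule.subset_span ⟨a, ha, b, hb, rfl⟩)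

/-! ### Hopf dual algebras -/

/-- `(id ⊗ Δ) ∘ Δ = (Δ ⊗ id) ∘ Δ`. Here `Φ = id ⊗ Δ` and `Ψ = Δ ⊗ id` are the weak* continuous
extensions to the normal tensor product of the maps given on elementary tensors (they are
unique, by weak* density). The two sides act on `H ⊗ (H ⊗ H)` and `(H ⊗ H) ⊗ H`; they are equal
under the canonical identification of these spaces, which is expressed by equality of the
matrix coefficients at elementary tensors. -/
def IsCoassociative (A : Subalgebra ℂ (H →L[ℂ] H))
    (Δ : A →ₐ[ℂ] (HTensor H H →L[ℂ] HTensor H H))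
    (hΔ : ∀ a, Δ a ∈ normalTensor (Subalgebra.toSubmodule A) (Subalgebra.toSubmodule A)) :
    Prop :=
  ∃ (Φ : normalTensor (Subalgebra.toSubmodule A) (Subalgebra.toSubmodule A) →ₗ[ℂ]
        (HTensor H (HTensor H H) →L[ℂ] HTensor H (HTensor H H)))
    (Ψ : normalTensor (Subalgebra.toSubmodule A) (Subalgebra.toSubmodule A) →ₗ[ℂ]
        (HTensor (HTensor H H) H →L[ℂ] HTensor (HTensor H H) H)),
    IsWeakStarContinuous Φ ∧ IsWeakStarContinuous Ψ ∧
    (∀ a b : A, Φ ⟨otmul a b, otmul_mem_normalTensor a.2 b.2⟩ = otmul (a : H →L[ℂ] H) (Δ b)) ∧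
    (∀ a b : A, Ψ ⟨otmul a b, otmul_mem_normalTensor a.2 b.2⟩ = otmul (Δ a) (b : H →L[ℂ] H)) ∧
    ∀ (a : A) (x₁ x₂ x₃ y₁ y₂ y₃ : H),
      inner ℂ (vtmul y₁ (vtmul y₂ y₃)) (Φ ⟨Δ a, hΔ a⟩ (vtmul x₁ (vtmul x₂ x₃))) =
      inner ℂ (vtmul (vtmul y₁ y₂) y₃) (Ψ ⟨Δ a, hΔ a⟩ (vtmul (vtmul x₁ x₂) x₃))

/-- `(A, Δ)` is a Hopf dual algebra: `A` is a dual operator algebra, i.e. a weak* closed unital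
subalgebra of `B(H)`, and `Δ : A → A ⊗̄ A` is a unital weak* continuous completely contractive
coassociative homomorphism. -/
structure IsHopfDualAlgebra (A : Subalgebra ℂ (H →L[ℂ] H))
    (Δ : A →ₐ[ℂ] (HTensor H H →L[ℂ] HTensor H H)) : Prop where
  isWeakStarClosed : IsWeakStarClosed (A : Set (H →L[ℂ] H))
  map_mem : ∀ a, Δ a ∈ normalTensor (Subalgebra.toSubmodule A) (Subalgebra.toSubmodule A)
  weakStarContinuous : IsWeakStarContinuous Δ
  completelyContractive : IsCompletelyContractive Δ
  coassociative : IsCoassociative A Δ map_mem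

/-- `J` is a coideal of `(A, Δ)`: a weak* closed subspace of `A` such that `Δ(J)` lies in the
weak* closure of `J ⊗ A + A ⊗ J`. -/
structure IsCoideal (A : Subalgebra ℂ (H →L[ℂ] H))
    (Δ : A →ₗ[ℂ] (HTensor H H →L[ℂ] HTensor H H)) (J : Submodule ℂ (H →L[ℂ] H)) : Prop where
  le : J ≤ Subalgebra.toSubmodule A
  isWeakStarClosed : IsWeakStarClosed (J : Set (H →L[ℂ] H))
  map_mem : ∀ a : A, (a : H →L[ℂ] H) ∈ J → Δ a ∈ ultraweakClosure
    (Submodule.span ℂ {T | ∃ b ∈ J, ∃ c ∈ A, T = otmul b c} ⊔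
      Submodule.span ℂ {T | ∃ c ∈ A, ∃ b ∈ J, T = otmul c b})

end General

/-! ### The noncommutative analytic Toeplitz algebra -/

/-- `ℓ²(ι)`. -/
abbrev L2 (ι : Type*) : Type _ := lp (fun _ : ι => ℂ) 2

open Classical in
/-- The canonical basis vectors of `ℓ²(ι)`. -/
def basisVec {ι : Type*} (i : ι) : L2 ι := lp.single 2 i 1

open Classical in
theorem orthonormal_basisVec (ι : Type*) : Orthonormal ℂ (basisVec : ι → L2 ι) := by
  rw [orthonormal_iff_ite]
  intro i j
  rw [basisVec, lp.inner_single_left]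
  simp [basisVec, lp.single_apply, Pi.single_apply]

theorem basisVec_total (ι : Type*) :
    (Submodule.span ℂ (Set.range (basisVec : ι → L2 ι))).topologicalClosure = ⊤ := by
  classical
  rw [eq_top_iff]
  intro f _
  have h := lp.hasSum_single (p := 2) (by norm_num) f
  refine mem_closure_of_tendsto h (Filter.Eventually.of_forall fun s => ?_)
  refine Submodule.sum_mem _ fun i _ => ?_
  have : lp.single (E := fun _ : ι => ℂ) 2 i (f i) = f i • basisVec i := by
    rw [basisVec, ← lp.single_smul]; simp
  rw [this]
  exact Submodule.smul_mem _ _ (Submodule.subset_span ⟨i, rfl⟩)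

/-- The isometry `ℓ²(ι) → E` that maps the canonical basis to the orthonormal family `v`. -/
def ofOrthonormal {ι E : Type*} [NormedAddCommGroup E] [InnerProductSpace ℂ E] [CompleteSpace E]
    {v : ι → E} (hv : Orthonormal ℂ v) : L2 ι →ₗᵢ[ℂ] E :=
  hv.orthogonalFamily.linearIsometry

theorem ofOrthonormal_basisVec {ι E : Type*} [NormedAddCommGroup E] [InnerProductSpace ℂ E]
    [CompleteSpace E] {v : ι → E} (hv : Orthonormal ℂ v) (i : ι) :
    ofOrthonormal hv (basisVec i) = v i := by
  classical
  rw [ofOrthonormal, basisVec]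
  erw [hv.orthogonalFamily.linearIsometry_apply_single]
  simp

theorem orthonormal_vtmul (ι κ : Type*) : Orthonormal ℂ
    (fun p : ι × κ => vtmul (basisVec p.1 : L2 ι) (basisVec p.2 : L2 κ)) := by
  classical
  have hι := orthonormal_iff_ite.1 (orthonormal_basisVec ι)
  have hκ := orthonormal_iff_ite.1 (orthonormal_basisVec κ)
  rw [orthonormal_iff_ite]
  rintro ⟨i, k⟩ ⟨i', k'⟩
  rw [inner_vtmul, hι, hκ]
  by_cases h1 : i = i' <;> by_cases h2 : k = k' <;> simp [h1, h2]

theorem vtmul_total (ι κ : Type*) :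
    (Submodule.span ℂ (Set.range (fun p : ι × κ =>
      vtmul (basisVec p.1 : L2 ι) (basisVec p.2 : L2 κ)))).topologicalClosure = ⊤ := by
  set M := (Submodule.span ℂ (Set.range (fun p : ι × κ =>
      vtmul (basisVec p.1 : L2 ι) (basisVec p.2 : L2 κ)))).topologicalClosure with hM
  have hMc : IsClosed (M : Set (HTensor (L2 ι) (L2 κ))) := Submodule.isClosed_topologicalClosure _
  let τ : L2 ι →L[ℂ] L2 κ →L[ℂ] HTensor (L2 ι) (L2 κ) :=
    (ContinuousLinearMap.compL ℂ (L2 κ) (L2 ι ⊗[ℂ] L2 κ) (HTensor (L2 ι) (L2 κ))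
      UniformSpace.Completion.toComplL) ∘L TensorProduct.mkL ℂ (L2 ι) (L2 κ)
  have hτ : ∀ x y, τ x y = vtmul x y := fun _ _ => rfl
  have h1 : ∀ (i : ι) (y : L2 κ), vtmul (basisVec i) y ∈ M := by
    intro i y
    have hle : (Submodule.span ℂ (Set.range (basisVec : κ → L2 κ))).topologicalClosure ≤
        M.comap (τ (basisVec i)).toLinearMap := by
      refine Submodule.topologicalClosure_minimal _ ?_ (hMc.preimage (τ (basisVec i)).continuous)
      rw [Submodule.span_le]
      rintro _ ⟨k, rfl⟩
      exact Submodule.le_topologicalClosure _ (Submodule.subset_span ⟨(i, k), rfl⟩)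
    rw [basisVec_total] at hle
    exact hle (Submodule.mem_top (x := y))
  have h2 : ∀ (x : L2 ι) (y : L2 κ), vtmul x y ∈ M := by
    intro x y
    have hle : (Submodule.span ℂ (Set.range (basisVec : ι → L2 ι))).topologicalClosure ≤
        M.comap (τ.flip y).toLinearMap := by
      refine Submodule.topologicalClosure_minimal _ ?_ (hMc.preimage (τ.flip y).continuous)
      rw [Submodule.span_le]
      rintro _ ⟨i, rfl⟩
      exact h1 i y
    rw [basisVec_total] at hle
    exact hle (Submodule.mem_top (x := x))
  rw [eq_top_iff]
  intro z hz
  clear hz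
  induction z using UniformSpace.Completion.induction_on with
  | hp => exact hMc
  | ih a =>
    induction a using TensorProduct.induction_on with
    | zero => exact M.zero_mem
    | tmul x y => exact h2 x y
    | add a b ha hb =>
      rw [UniformSpace.Completion.coe_add]
      exact M.add_mem ha hb

variable (d : ℕ)

/-- The unital free semigroup `𝔽_d^*` on `d` generators. -/
abbrev Words : Type := FreeMonoid (Fin d)

/-- The Fock space `ℓ²(𝔽_d^*)`. -/
abbrev Fock : Type := L2 (Words d)

variable {d}

theorem orthonormal_shift (u : Words d) :
    Orthonormal ℂ fun w : Words d => (basisVec (u * w) : Fock d) :=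
  (orthonormal_basisVec _).comp _ (mul_right_injective u)

/-- The left regular representation: `L_u ξ_w = ξ_{uw}`. -/
def leftShift (u : Words d) : Fock d →L[ℂ] Fock d :=
  (ofOrthonormal (orthonormal_shift u)).toContinuousLinearMap

theorem leftShift_basisVec (u w : Words d) :
    leftShift u (basisVec w) = basisVec (u * w) :=
  ofOrthonormal_basisVec (orthonormal_shift u) w

variable (d)

/-- `𝓛_d`: the unital WOT-closed algebra generated by the left regular representation. -/
def toeplitz : Subalgebra ℂ (Fock d →L[ℂ] Fock d) :=
  sInf {A | IsWOTClosed (A : Set (Fock d →L[ℂ] Fock d)) ∧ ∀ w : Words d, leftShift w ∈ A}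

theorem leftShift_mem (w : Words d) : leftShift w ∈ toeplitz d :=
  Algebra.mem_sInf.2 fun _ h => h.2 w

/-! The comultiplication of `𝓛_d` is given by an explicit formula. With `G` the free group on
`d` generators, `ξ_u ⊗ ξ_v ↦ ξ_u ⊗ δ_{u⁻¹v}` defines an isometry
`X : ℓ²(𝔽_d^*) ⊗ ℓ²(𝔽_d^*) → ℓ²(𝔽_d^*) ⊗ ℓ²(G)`, and `Δ(A) = X^* (A ⊗ I) X`. This is weak*
continuous and `Δ(L_w) = L_w ⊗ L_w` (see `comul_leftShift`), which determines it. -/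

variable {d}

/-- The embedding of the free semigroup in the free group. -/
def toGroup : Words d →* FreeGroup (Fin d) := FreeMonoid.lift FreeGroup.of

theorem toGroup_injective : Function.Injective (toGroup : Words d → FreeGroup (Fin d)) := by
  have hw : ∀ w : Words d, toGroup w = FreeGroup.mk (w.toList.map fun i => (i, true)) := by
    intro w
    induction w using FreeMonoid.inductionOn' with
    | one => rfl
    | of_mul i w ih =>
      rw [map_mul, ih]
      rfl
  have hr : ∀ l : List (Fin d), FreeGroup.IsReduced (l.map fun i => (i, true)) := by
    intro l
    unfold FreeGroup.IsReduced
    rw [List.isChain_map]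
    induction l with
    | nil => exact List.IsChain.nil
    | cons a l ih => exact List.isChain_cons.2 ⟨fun _ _ _ => rfl, ih⟩
  intro u v h
  rw [hw, hw] at h
  have h' := congrArg FreeGroup.toWord h
  rw [FreeGroup.toWord_mk, FreeGroup.toWord_mk, (hr _).reduce_eq, (hr _).reduce_eq] at h'
  have hinj : Function.Injective fun i : Fin d => (i, true) := fun a b hab => by simpa using hab
  exact FreeMonoid.toList.injective (List.map_injective_iff.2 hinj h')

theorem twist_injective : Function.Injective
    (fun p : Words d × Words d => (p.1, (toGroup p.1)⁻¹ * toGroup p.2)) := by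
  rintro ⟨u, v⟩ ⟨u', v'⟩ h
  simp only [Prod.mk.injEq] at h
  obtain ⟨rfl, h⟩ := h
  rw [toGroup_injective (mul_left_cancel h)]

variable (d)

/-- The orthonormal basis `ξ_u ⊗ ξ_v` of the tensor square of the Fock space. -/
def tensorBasis : HilbertBasis (Words d × Words d) ℂ (HTensor (Fock d) (Fock d)) :=
  HilbertBasis.mk (orthonormal_vtmul (Words d) (Words d)) (vtmul_total _ _).ge

/-- The isometry `X`, with `X (ξ_u ⊗ ξ_v) = ξ_u ⊗ δ_{u⁻¹v}`. -/
def twist : HTensor (Fock d) (Fock d) →L[ℂ] HTensor (Fock d) (L2 (FreeGroup (Fin d))) :=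
  ((ofOrthonormal ((orthonormal_vtmul (Words d) (FreeGroup (Fin d))).comp _
    twist_injective)).comp (tensorBasis d).repr.toLinearIsometry).toContinuousLinearMap

theorem twist_isometry : Isometry (twist d) :=
  LinearIsometry.isometry _

theorem twist_vtmul (u v : Words d) :
    twist d (vtmul (basisVec u) (basisVec v)) =
      vtmul (basisVec u) (basisVec ((toGroup u)⁻¹ * toGroup v)) := by
  classical
  have h1 : (tensorBasis d).repr (vtmul (basisVec u) (basisVec v)) = basisVec (u, v) := by
    have h2 : tensorBasis d (u, v) = vtmul (basisVec u) (basisVec v) := by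
      simp [tensorBasis]
    rw [← h2, HilbertBasis.repr_self, basisVec]
    congr!
  change ofOrthonormal ((orthonormal_vtmul (Words d) (FreeGroup (Fin d))).comp _
    twist_injective) ((tensorBasis d).repr (vtmul (basisVec u) (basisVec v))) = _
  rw [h1]
  exact ofOrthonormal_basisVec _ (u, v)

/-- `A ↦ X^* (A ⊗ I) X`. -/
def comulAux : (Fock d →L[ℂ] Fock d) →ₗ[ℂ]
    (HTensor (Fock d) (Fock d) →L[ℂ] HTensor (Fock d) (Fock d)) where
  toFun A := (ContinuousLinearMap.adjoint (twist d)) ∘L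
    otmul A (ContinuousLinearMap.id ℂ (L2 (FreeGroup (Fin d)))) ∘L twist d
  map_add' A B := by
    have h : otmul (A + B) (ContinuousLinearMap.id ℂ (L2 (FreeGroup (Fin d)))) =
        otmul A (ContinuousLinearMap.id ℂ _) + otmul B (ContinuousLinearMap.id ℂ _) := by
      rw [otmul, TensorProduct.mapL_add_left]
      exact completion_add _ _
    rw [h, ContinuousLinearMap.add_comp, ContinuousLinearMap.comp_add]
  map_smul' c A := by
    have h : otmul (c • A) (ContinuousLinearMap.id ℂ (L2 (FreeGroup (Fin d)))) =
        c • otmul A (ContinuousLinearMap.id ℂ _) := by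
      rw [otmul, TensorProduct.mapL_smul_left]
      exact completion_smul _ _
    rw [h, ContinuousLinearMap.smul_comp, ContinuousLinearMap.comp_smul]
    rfl

/-- The comultiplication `Δ` of `𝓛_d`, with `Δ(L_w) = L_w ⊗ L_w`. -/
def comul : toeplitz d →ₗ[ℂ] (HTensor (Fock d) (Fock d) →L[ℂ] HTensor (Fock d) (Fock d)) :=
  comulAux d ∘ₗ (toeplitz d).val.toLinearMap

theorem comul_leftShift (w : Words d) :
    comul d ⟨leftShift w, leftShift_mem d w⟩ = otmul (leftShift w) (leftShift w) := by
  refine ContinuousLinearMap.ext_on (s := Set.range fun p : Words d × Words d =>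
    vtmul (basisVec p.1 : Fock d) (basisVec p.2 : Fock d)) ?_ ?_
  · exact Submodule.dense_iff_topologicalClosure_eq_top.2 (vtmul_total _ _)
  · rintro _ ⟨⟨u, v⟩, rfl⟩
    have hX : ContinuousLinearMap.adjoint (twist d) ∘L twist d = 1 :=
      (ContinuousLinearMap.isometry_iff_adjoint_comp_self _).1 (twist_isometry d)
    change ContinuousLinearMap.adjoint (twist d)
      (otmul (leftShift w) (ContinuousLinearMap.id ℂ (L2 (FreeGroup (Fin d))))
        (twist d (vtmul (basisVec u) (basisVec v)))) = _
    rw [twist_vtmul, otmul_vtmul, otmul_vtmul]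
    simp only [leftShift_basisVec, ContinuousLinearMap.id_apply]
    have h : (toGroup u)⁻¹ * toGroup v = (toGroup (w * u))⁻¹ * toGroup (w * v) := by
      simp only [map_mul]; group
    rw [h, ← twist_vtmul]
    exact DFunLike.congr_fun hX _

/-! ### Ideals of `𝓛_d` and the compression algebras -/

/-- A WOT-closed two-sided ideal of `𝓛_d`. -/
structure ClosedIdeal where
  carrier : Submodule ℂ (Fock d →L[ℂ] Fock d)
  le : carrier ≤ Subalgebra.toSubmodule (toeplitz d)
  mul_mem_left : ∀ A ∈ toeplitz d, ∀ B ∈ carrier, A * B ∈ carrier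
  mul_mem_right : ∀ A ∈ toeplitz d, ∀ B ∈ carrier, B * A ∈ carrier
  isWOTClosed : IsWOTClosed (carrier : Set (Fock d →L[ℂ] Fock d))

variable {d}

/-- A homogeneous polynomial of degree `n` in the generators: an element of
`span {L_w : |w| = n}`. -/
def IsHomogeneousPoly (n : ℕ) (A : Fock d →L[ℂ] Fock d) : Prop :=
  A ∈ Submodule.span ℂ {T | ∃ w : Words d, w.length = n ∧ T = leftShift w}

namespace ClosedIdeal

variable (J : ClosedIdeal d)

/-- `J` is homogeneous: it is the WOT-closed two-sided ideal generated by a set of homogeneous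
polynomials. -/
def IsHomogeneous : Prop :=
  ∃ S : Set (Fock d →L[ℂ] Fock d), (∀ A ∈ S, ∃ n, IsHomogeneousPoly n A) ∧
    S ⊆ J.carrier ∧ ∀ I : ClosedIdeal d, S ⊆ I.carrier → J.carrier ≤ I.carrier

/-- `J` is a Hopf ideal: an ideal that is also a coideal of `(𝓛_d, Δ)`. -/
def IsHopfIdeal : Prop := IsCoideal (toeplitz d) (comul d) J.carrier

/-- The coinvariant subspace `𝒩_J = (J ξ_∅)^⊥`. -/
def coinv : Submodule ℂ (Fock d) :=
  (J.carrier.map (ContinuousLinearMap.apply ℂ (Fock d)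
    (basisVec (1 : Words d) : Fock d)).toLinearMap)ᗮ

instance : CompleteSpace J.coinv := Submodule.instOrthogonalCompleteSpace _

/-- The compression `π_J : A ↦ P_𝒩 A|_𝒩`. -/
def compress : (Fock d →L[ℂ] Fock d) →ₗ[ℂ] (J.coinv →L[ℂ] J.coinv) where
  toFun A := J.coinv.orthogonalProjectionOnto ∘L A ∘L J.coinv.subtypeL
  map_add' A B := by ext; simp
  map_smul' c A := by ext; simp

/-- The map `π_J ⊗ π_J`, compression from `ℓ²(𝔽_d^*) ⊗ ℓ²(𝔽_d^*)` to `𝒩_J ⊗ 𝒩_J`: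
`T ↦ (P_𝒩 ⊗ P_𝒩) T|_{𝒩 ⊗ 𝒩}`. -/
def compress₂ (T : HTensor (Fock d) (Fock d) →L[ℂ] HTensor (Fock d) (Fock d)) :
    HTensor J.coinv J.coinv →L[ℂ] HTensor J.coinv J.coinv :=
  otmul J.coinv.orthogonalProjectionOnto J.coinv.orthogonalProjectionOnto ∘L T ∘L
    otmul J.coinv.subtypeL J.coinv.subtypeL

theorem compress_mul {A : Fock d →L[ℂ] Fock d} (hA : A ∈ toeplitz d)
    (B : Fock d →L[ℂ] Fock d) : J.compress (A * B) = J.compress A * J.compress B := by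
  set K := J.carrier.map (ContinuousLinearMap.apply ℂ (Fock d)
    (basisVec (1 : Words d) : Fock d)).toLinearMap with hK
  have hinv : ∀ z ∈ J.coinvᗮ, A z ∈ J.coinvᗮ := by
    intro z hz
    rw [coinv, ← hK, Submodule.orthogonal_orthogonal_eq_closure] at hz ⊢
    have hle : K.topologicalClosure ≤ K.topologicalClosure.comap A.toLinearMap := by
      refine Submodule.topologicalClosure_minimal _ ?_
        ((Submodule.isClosed_topologicalClosure K).preimage A.continuous)
      rintro _ ⟨B, hB, rfl⟩
      exact Submodule.le_topologicalClosure _ ⟨A * B, J.mul_mem_left A hA B hB, rfl⟩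
    exact hle hz
  ext1 x
  set y : Fock d := B x with hy
  have h := hinv (y - J.coinv.orthogonalProjectionOnto y)
    (J.coinv.sub_starProjection_mem_orthogonal y)
  have h0 := Submodule.orthogonalProjectionOnto_apply_of_mem_orthogonal h
  rw [map_sub, map_sub, sub_eq_zero] at h0
  exact h0

/-- The compression algebra `𝓛_J = P_𝒩 𝓛_d|_𝒩`. -/
def compressionAlgebra : Subalgebra ℂ (J.coinv →L[ℂ] J.coinv) where
  carrier := {T | ∃ A ∈ toeplitz d, J.compress A = T}
  mul_mem' := by
    rintro _ _ ⟨A, hA, rfl⟩ ⟨B, hB, rfl⟩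
    exact ⟨A * B, mul_mem hA hB, J.compress_mul hA B⟩
  add_mem' := by
    rintro _ _ ⟨A, hA, rfl⟩ ⟨B, hB, rfl⟩
    exact ⟨A + B, add_mem hA hB, map_add _ _ _⟩
  algebraMap_mem' c := by
    refine ⟨algebraMap ℂ _ c, Subalgebra.algebraMap_mem _ c, ?_⟩
    rw [Algebra.algebraMap_eq_smul_one, map_smul, Algebra.algebraMap_eq_smul_one]
    congr 1
    ext x
    simp [compress]

/-- The canonical map `π_J : 𝓛_d → 𝓛_J`. -/
def proj (A : toeplitz d) : J.compressionAlgebra := ⟨J.compress A, A, A.2, rfl⟩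

/-- The image `S_w = π_J(L_w)` of `L_w` in `𝓛_J`. -/
def gen (w : Words d) : J.compressionAlgebra := J.proj ⟨leftShift w, leftShift_mem d w⟩

end ClosedIdeal

end

end HopfDual

/-! Normal functionals on `B(H)` are vector functionals of amplifications `T ⊗ 1`. On `𝓛_d` they
become tractable through a Wold decomposition: a closed subspace of a multiple of the Fock space
that is invariant under the left shifts is spanned orthogonally by the translates of its wandering
vectors, hence is the range of an isometric intertwiner (`exists_intertwiner`). For the cyclic
subspace of one nonzero vector the wandering space is a line, so every normal functional on the
commutant of the right shifts has the form `A ↦ ⟪η, A ζ⟫` with `ζ` cyclic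
(`exists_vector_functional`). It follows that `𝓛_d` is this commutant, that the polynomials are
weak* dense in it, that its weak* closed subspaces are WOT-closed, and that `π_J` has kernel `J` on
`𝓛_d` (`mem_of_compress_eq_zero`).

Part (i). The comultiplication is `A ↦ V† (A ⊗ 1) V` with an isometry `V`. Restrict `V` to `𝒩 ⊗ 𝒩`
and identify the invariant subspace generated by its range with a multiple of the Fock space. The
coideal condition makes the compression of `Δ(B)` vanish for `B ∈ J`, and this forces all components
of the transported `V` into `𝒩`. So the compression of `Δ(A)` equals `Z† (π_J(A) ⊗ 1) Z` with a
contraction `Z` (`exists_kraus`). This formula depends on `π_J(A)` alone, and it yields a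
well-defined, weak* continuous and completely contractive map; the algebraic identities are checked
on the left shifts and extended by density. That `𝓛_J` is weak* closed holds because it is the
commutant of the compressed right shifts, by a lifting theorem (`CommutesBackShift.exists_lift`)
proved with Hahn-Banach and Zorn.

Part (ii). If a polynomial `A = ∑ c_w L_w` is in `J`, then `∑ c_w S_w ⊗ S_w = Δ_J(0) = 0`. The
algebraic tensor product embeds in `B(𝒩 ⊗ 𝒩)`, so this is an algebraic identity, and it lifts
through `π_J` to `Δ(A) ∈ J ⊗ 𝓛_d + 𝓛_d ⊗ J` (`comulAux_mem_coidealSpan`). The operators whose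
comultiplication lies in the weak* closure form a WOT-closed ideal (`comulPreimage`), which
therefore contains `J` once it contains polynomial generators. -/

namespace HopfDual

noncomputable section

/-! ### Amplifications and normal functionals -/

section L2Sum

variable {ι κ H : Type*} [NormedAddCommGroup H]

/-- The `ℓ²`-direct sum of copies of `H`. -/
abbrev L2Sum (κ H : Type*) [NormedAddCommGroup H] : Type _ := lp (fun _ : κ => H) 2

theorem memℓp_two_iff {a : κ → H} : Memℓp a 2 ↔ Summable fun k => ‖a k‖ ^ 2 := by
  rw [memℓp_gen_iff (by norm_num)]
  norm_num

theorem L2Sum.summable_norm_sq (x : L2Sum κ H) : Summable fun k => ‖x k‖ ^ 2 :=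
  memℓp_two_iff.1 (lp.memℓp x)

theorem L2Sum.norm_sq_eq_tsum (x : L2Sum κ H) : ‖x‖ ^ 2 = ∑' k, ‖x k‖ ^ 2 := by
  have := lp.norm_rpow_eq_tsum (p := 2) (by norm_num) x
  simpa using this

theorem exists_flatten (x : L2Sum ι (L2Sum κ H)) :
    ∃ z : L2Sum (ι × κ) H, ∀ i k, z (i, k) = x i k := by
  refine ⟨⟨fun p => x p.1 p.2, memℓp_two_iff.2 ?_⟩, fun _ _ => rfl⟩
  rw [summable_prod_of_nonneg fun _ => by positivity]
  refine ⟨fun i => L2Sum.summable_norm_sq (x i), ?_⟩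
  simpa only [← L2Sum.norm_sq_eq_tsum] using L2Sum.summable_norm_sq x

end L2Sum

section Ampl

variable {ι κ H K E : Type*}
  [NormedAddCommGroup H] [InnerProductSpace ℂ H]
  [NormedAddCommGroup K] [InnerProductSpace ℂ K]
  [NormedAddCommGroup E] [InnerProductSpace ℂ E]

/-- The amplification `T ⊗ 1`, acting diagonally on the `ℓ²`-direct sum. -/
def ampl (κ : Type*) (T : H →L[ℂ] K) : L2Sum κ H →L[ℂ] L2Sum κ K :=
  lp.mapCLM 2 (fun _ => T) (norm_nonneg T) (fun _ => le_rfl)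

@[simp]
theorem ampl_apply (T : H →L[ℂ] K) (x : L2Sum κ H) (k : κ) : ampl κ T x k = T (x k) := rfl

theorem ampl_comp (S : K →L[ℂ] E) (T : H →L[ℂ] K) : ampl κ (S ∘L T) = ampl κ S ∘L ampl κ T := by
  ext; rfl

theorem ampl_add (S T : H →L[ℂ] K) : ampl κ (S + T) = ampl κ S + ampl κ T := by
  ext; rfl

theorem ampl_smul (c : ℂ) (T : H →L[ℂ] K) : ampl κ (c • T) = c • ampl κ T := by
  ext; rfl

theorem norm_ampl_le (T : H →L[ℂ] K) : ‖ampl κ T‖ ≤ ‖T‖ :=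
  lp.norm_mapCLM_le _ _ _ _

theorem inner_ampl_eq_tsum (T : H →L[ℂ] K) (x : L2Sum κ H) (y : L2Sum κ K) :
    inner ℂ y (ampl κ T x) = ∑' k, inner ℂ (y k) (T (x k)) :=
  lp.inner_eq_tsum _ _

theorem inner_ampl_adjoint [CompleteSpace H] [CompleteSpace K] (T : H →L[ℂ] K)
    (x : L2Sum κ H) (y : L2Sum κ K) :
    inner ℂ y (ampl κ T x) = inner ℂ (ampl κ (ContinuousLinearMap.adjoint T) y) x := by
  simp only [lp.inner_eq_tsum, ampl_apply, ContinuousLinearMap.adjoint_inner_left]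

theorem ultraweakPairing_apply (T : H →L[ℂ] H) (p : L2Sum ℕ H × L2Sum ℕ H) :
    ultraweakPairing H T p = inner ℂ p.2 (ampl ℕ T p.1) :=
  (inner_ampl_eq_tsum _ _ _).symm

/-- A vector functional of an amplification over an arbitrary index set is one of the
functionals that define the weak* topology. -/
theorem exists_pairing_eq (a b : L2Sum ι H) : ∃ p : L2Sum ℕ H × L2Sum ℕ H,
    ∀ T : H →L[ℂ] H, ultraweakPairing H T p = inner ℂ b (ampl ι T a) := by
  classical
  -- Only the countably many indices with `a i ≠ 0` contribute; they are injected into `ℕ` and both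
  -- vectors are extended by zero.
  have hs : (Function.support fun i => ‖a i‖ ^ 2).Countable :=
    (L2Sum.summable_norm_sq a).countable_support
  set s := Function.support fun i => ‖a i‖ ^ 2 with hsdef
  have : Countable s := hs
  obtain ⟨e, he⟩ := exists_injective_nat s
  have hmem : ∀ c : L2Sum ι H, Memℓp (Function.extend e (fun i : s => c i) 0) 2 := by
    intro c
    rw [memℓp_two_iff, ← he.summable_iff]
    · simp only [Function.comp_def, he.extend_apply]
      exact (L2Sum.summable_norm_sq c).subtype s
    · intro n hn
      rw [Function.extend_apply' _ _ _ (by simpa using hn)]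
      simp
  refine ⟨(⟨_, hmem a⟩, ⟨_, hmem b⟩), fun T => ?_⟩
  rw [inner_ampl_eq_tsum]
  change ∑' n, inner ℂ (Function.extend e (fun i : s => b i) 0 n)
    (T (Function.extend e (fun i : s => a i) 0 n)) = _
  rw [← he.tsum_eq]
  · simp only [he.extend_apply]
    refine tsum_subtype_eq_of_support_subset (f := fun i => inner ℂ (b i) (T (a i))) ?_
    intro i hi
    rw [hsdef, Function.mem_support]
    intro h0
    have : a i = 0 := by simpa using h0
    exact hi (by simp [this])
  · intro n hn
    by_contra hcon
    refine hn ?_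
    dsimp only
    rw [Function.extend_apply' (fun i : s => a i) _ _ (by simpa using hcon)]
    simp

/-- An amplification of an amplification is an amplification over the product index set. With
`exists_pairing_eq` this shows that sums of normal functionals, and their pullbacks along maps `V†
(T ⊗ 1) V`, are again normal. -/
theorem exists_flatten_inner (x y : L2Sum ι (L2Sum κ H)) :
    ∃ a b : L2Sum (ι × κ) H, ∀ T : H →L[ℂ] H,
      inner ℂ b (ampl _ T a) = inner ℂ y (ampl ι (ampl κ T) x) := by
  obtain ⟨a, ha⟩ := exists_flatten x
  obtain ⟨b, hb⟩ := exists_flatten y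
  refine ⟨a, b, fun T => ?_⟩
  have h := (lp.summable_inner (𝕜 := ℂ) b (ampl _ T a)).tsum_prod
  rw [lp.inner_eq_tsum, h, inner_ampl_eq_tsum]
  refine tsum_congr fun i => ?_
  rw [inner_ampl_eq_tsum]
  exact tsum_congr fun k => by rw [ampl_apply, ha, hb]

/-- The bounded operator into an `ℓ²`-direct sum with given components. -/
def ofComponents (Z : κ → K →L[ℂ] H) (C : ℝ)
    (hZ : ∀ (F : Finset κ) (x : K), ∑ k ∈ F, ‖Z k x‖ ^ 2 ≤ C ^ 2 * ‖x‖ ^ 2) :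
    K →L[ℂ] L2Sum κ H :=
  LinearMap.mkContinuous
    { toFun := fun x => ⟨fun k => Z k x, memℓp_two_iff.2
        (summable_of_sum_le (fun _ => by positivity) fun F => hZ F x)⟩
      map_add' := fun x y => by ext k; exact map_add (Z k) x y
      map_smul' := fun c x => by ext k; exact map_smul (Z k) c x } |C| fun x => by
    refine le_of_sq_le_sq ?_ (by positivity)
    rw [L2Sum.norm_sq_eq_tsum, mul_pow, sq_abs]
    exact Real.tsum_le_of_sum_le (fun _ => by positivity) fun F => hZ F x

@[simp]
theorem ofComponents_apply (Z : κ → K →L[ℂ] H) (C : ℝ)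
    (hZ : ∀ (F : Finset κ) (x : K), ∑ k ∈ F, ‖Z k x‖ ^ 2 ≤ C ^ 2 * ‖x‖ ^ 2) (x : K) (k : κ) :
    ofComponents Z C hZ x k = Z k x := rfl

end Ampl

/-! ### The weak* topology -/

section Ultraweak

variable {ι κ H K E : Type*}
  [NormedAddCommGroup H] [InnerProductSpace ℂ H]
  [NormedAddCommGroup K] [InnerProductSpace ℂ K]
  [NormedAddCommGroup E] [InnerProductSpace ℂ E]

theorem continuous_pairing (p : L2Sum ℕ H × L2Sum ℕ H) :
    Continuous[ultraweak H, inferInstance] fun T => ultraweakPairing H T p :=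
  letI := ultraweak H
  (continuous_apply p).comp continuous_induced_dom

theorem continuous_inner_ampl (a b : L2Sum ι H) :
    Continuous[ultraweak H, inferInstance] fun T => inner ℂ b (ampl ι T a) := by
  obtain ⟨p, hp⟩ := exists_pairing_eq a b
  simpa only [hp] using continuous_pairing p

/-- The functional `T ↦ ⟪y, T x⟫` is weak* continuous. -/
theorem continuous_inner_apply (x y : H) :
    Continuous[ultraweak H, inferInstance] fun T : H →L[ℂ] H => inner ℂ y (T x) := by
  have hm : ∀ z : H, Memℓp (fun _ : Unit => z) 2 := fun z => memℓp_two_iff.2 .of_finite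
  have := continuous_inner_ampl (⟨_, hm x⟩ : L2Sum Unit H) ⟨_, hm y⟩
  simpa [inner_ampl_eq_tsum] using this

/-- A map into `B(K)` is weak* continuous if all its normal functionals are normal. -/
theorem continuous_ultraweak_of_pairing {Φ : (H →L[ℂ] H) → (K →L[ℂ] K)}
    (h : ∀ x y : L2Sum ℕ K, ∃ p : L2Sum ℕ H × L2Sum ℕ H, ∀ T,
      inner ℂ y (ampl ℕ (Φ T) x) = ultraweakPairing H T p) :
    Continuous[ultraweak H, ultraweak K] Φ := by
  let := ultraweak H
  refine continuous_induced_rng.2 (continuous_pi fun q => ?_)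
  obtain ⟨p, hp⟩ := h q.1 q.2
  have : (fun T => ultraweakPairing K (Φ T) q) = fun T => ultraweakPairing H T p := by
    funext T
    rw [ultraweakPairing_apply, hp]
  exact this ▸ continuous_pairing p

theorem ultraweak_t2 : @T2Space (H →L[ℂ] H) (ultraweak H) := by
  let := ultraweak H
  refine T2Space.of_injective_continuous (f := ultraweakPairing H) ?_ continuous_induced_dom
  intro S T hST
  ext x
  refine ext_inner_left ℂ fun y => ?_
  have hm : ∀ z : H, Memℓp (fun _ : Unit => z) 2 := fun z => memℓp_two_iff.2 .of_finite
  obtain ⟨p, hp⟩ := exists_pairing_eq (⟨_, hm x⟩ : L2Sum Unit H) ⟨_, hm y⟩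
  have h := congrFun hST p
  rw [hp, hp] at h
  simpa [inner_ampl_eq_tsum] using h

theorem isWeakStarClosed_ultraweakClosure (S : Submodule ℂ (H →L[ℂ] H)) :
    IsWeakStarClosed (ultraweakClosure S : Set (H →L[ℂ] H)) :=
  @isClosed_closure _ (ultraweak H) _

theorem ultraweakClosure_le {S C : Submodule ℂ (H →L[ℂ] H)} (h : S ≤ C)
    (hC : IsWeakStarClosed (C : Set (H →L[ℂ] H))) : ultraweakClosure S ≤ C :=
  @closure_minimal _ (ultraweak H) _ _ h hC

theorem isWeakStarClosed_comap {C : Submodule ℂ (K →L[ℂ] K)}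
    (hC : IsWeakStarClosed (C : Set (K →L[ℂ] K))) {Φ : (H →L[ℂ] H) →ₗ[ℂ] (K →L[ℂ] K)}
    (hΦ : Continuous[ultraweak H, ultraweak K] Φ) :
    IsWeakStarClosed (C.comap Φ : Set (H →L[ℂ] H)) :=
  let := ultraweak H
  let := ultraweak K
  IsClosed.preimage hΦ hC

theorem isWeakStarClosed_eqLocus {Φ Ψ : (H →L[ℂ] H) →ₗ[ℂ] (K →L[ℂ] K)}
    (hΦ : Continuous[ultraweak H, ultraweak K] Φ) (hΨ : Continuous[ultraweak H, ultraweak K] Ψ) :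
    IsWeakStarClosed (LinearMap.eqLocus Φ Ψ : Set (H →L[ℂ] H)) :=
  let := ultraweak H
  let := ultraweak K
  haveI : T2Space (K →L[ℂ] K) := ultraweak_t2
  isClosed_eq hΦ hΨ

/-- Weak* closed subspaces are separated from points by the defining functionals. -/
theorem exists_pairing_separating {S : Submodule ℂ (H →L[ℂ] H)} {T : H →L[ℂ] H}
    (hT : T ∉ ultraweakClosure S) : ∃ p : L2Sum ℕ H × L2Sum ℕ H,
      (∀ A ∈ S, ultraweakPairing H A p = 0) ∧ ultraweakPairing H T p ≠ 0 := by
  classical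
  have hT' : T ∉ @closure _ (ultraweak H) (S : Set (H →L[ℂ] H)) := hT
  let := ultraweak H
  rw [mem_closure_iff_nhds] at hT'
  push Not at hT'
  obtain ⟨U, hU, hUS⟩ := hT'
  rw [nhds_induced, Filter.mem_comap] at hU
  obtain ⟨W, hW, hWU⟩ := hU
  rw [nhds_pi, Filter.mem_pi'] at hW
  obtain ⟨I, t, ht, hIt⟩ := hW
  -- A basic neighbourhood of `T` that misses `S` involves finitely many functionals only, so the
  -- separation takes place in the finite-dimensional space `I → ℂ`.
  let q : (H →L[ℂ] H) →ₗ[ℂ] (I → ℂ) :=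
    LinearMap.pi fun p => LinearMap.proj (p : L2Sum ℕ H × L2Sum ℕ H) ∘ₗ ultraweakPairing H
  have hq : q T ∉ S.map q := by
    rintro ⟨A, hA, hAT⟩
    have : A ∈ U ∩ S := by
      refine ⟨hWU (hIt fun p hp => ?_), hA⟩
      have h1 : ultraweakPairing H A p = ultraweakPairing H T p := congrFun hAT ⟨p, hp⟩
      change ultraweakPairing H A p ∈ t p
      rw [h1]
      exact mem_of_mem_nhds (ht p)
    rw [hUS] at this
    exact this
  obtain ⟨f, hf, hfS⟩ := Submodule.exists_le_ker_of_notMem hq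
  have hfsum : ∀ v : I → ℂ, f v = ∑ p, v p * f (Pi.single p 1) := by
    intro v
    conv_lhs => rw [← Finset.univ_sum_single v]
    rw [map_sum]
    refine Finset.sum_congr rfl fun p _ => ?_
    rw [← smul_eq_mul, ← map_smul]
    congr 1
    ext i
    by_cases h : i = p <;> simp [h]
  have hx : Memℓp (fun p : I => (p : L2Sum ℕ H × L2Sum ℕ H).1) 2 :=
    memℓp_two_iff.2 .of_finite
  -- The separating functional is a finite combination of pairings. Its coefficients are put into
  -- the second vectors, conjugated because the inner product is conjugate-linear there, and the
  -- combination is flattened to one pairing.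
  have hy : Memℓp (fun p : I => star (f (Pi.single p 1)) • (p : L2Sum ℕ H × L2Sum ℕ H).2) 2 :=
    memℓp_two_iff.2 .of_finite
  obtain ⟨a, b, hab⟩ := exists_flatten_inner (⟨_, hx⟩ : L2Sum I (L2Sum ℕ H)) ⟨_, hy⟩
  obtain ⟨p, hp⟩ := exists_pairing_eq a b
  have key : ∀ A, ultraweakPairing H A p = f (q A) := by
    intro A
    rw [hp, hab, inner_ampl_eq_tsum, tsum_fintype, hfsum]
    refine Finset.sum_congr rfl fun i _ => ?_
    change inner ℂ (star (f (Pi.single i 1)) • (i : L2Sum ℕ H × L2Sum ℕ H).2)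
      (ampl ℕ A (i : L2Sum ℕ H × L2Sum ℕ H).1) = ultraweakPairing H A i * _
    rw [inner_smul_left, ultraweakPairing_apply]
    simp [mul_comm]
  exact ⟨p, fun A hA => by rw [key]; exact hfS ⟨A, hA, rfl⟩, by rw [key]; exact hf⟩

/-- By the Riesz theorem the functionals that define the weak operator topology are of the form `T ↦
⟪y, T x⟫`, and these are weak* continuous. -/
theorem IsWOTClosed.isWeakStarClosed [CompleteSpace H] {S : Set (H →L[ℂ] H)}
    (hS : IsWOTClosed S) : IsWeakStarClosed S := by
  let := ultraweak H
  have hc : Continuous fun T : H →L[ℂ] H => (ContinuousLinearMapWOT.ofCLM T : H →WOT[ℂ] H) := by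
    refine ContinuousLinearMapWOT.continuous_of_dual_apply_continuous fun x f => ?_
    have := continuous_inner_apply x ((InnerProductSpace.toDual ℂ H).symm f)
    simpa using this
  exact hS.preimage hc

theorem opMatrix_apply {n : ℕ} (a : Fin n → Fin n → (H →L[ℂ] H))
    (x : PiLp 2 fun _ : Fin n => H) (i : Fin n) : opMatrix a x i = ∑ j, a i j (x j) := by
  simp [opMatrix]

theorem continuous_mul_right_ultraweak (S : H →L[ℂ] H) :
    Continuous[ultraweak H, ultraweak H] (LinearMap.mulRight ℂ S) := by
  refine continuous_ultraweak_of_pairing fun x y => ⟨(ampl ℕ S x, y), fun T => ?_⟩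
  rw [ultraweakPairing_apply]
  rfl

end Ultraweak

/-! ### Maps of the form `T ↦ V† (T ⊗ 1) V` -/

section Kraus

variable {κ H K E : Type*}
  [NormedAddCommGroup H] [InnerProductSpace ℂ H] [CompleteSpace H]
  [NormedAddCommGroup K] [InnerProductSpace ℂ K] [CompleteSpace K]

/-- The weak* continuous completely bounded map `T ↦ V† (T ⊗ 1) V`. -/
def kraus (V : K →L[ℂ] L2Sum κ H) : (H →L[ℂ] H) →ₗ[ℂ] (K →L[ℂ] K) where
  toFun T := ContinuousLinearMap.adjoint V ∘L ampl κ T ∘L V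
  map_add' S T := by
    rw [ampl_add, ContinuousLinearMap.add_comp, ContinuousLinearMap.comp_add]
  map_smul' c T := by
    rw [ampl_smul, ContinuousLinearMap.smul_comp, ContinuousLinearMap.comp_smul]
    rfl

theorem inner_kraus (V : K →L[ℂ] L2Sum κ H) (T : H →L[ℂ] H) (x y : K) :
    inner ℂ y (kraus V T x) = inner ℂ (V y) (ampl κ T (V x)) := by
  change inner ℂ y (ContinuousLinearMap.adjoint V (ampl κ T (V x))) = _
  rw [ContinuousLinearMap.adjoint_inner_right]

theorem continuous_kraus (V : K →L[ℂ] L2Sum κ H) :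
    Continuous[ultraweak H, ultraweak K] (kraus V) := by
  refine continuous_ultraweak_of_pairing fun x y => ?_
  obtain ⟨a, b, hab⟩ := exists_flatten_inner (ampl ℕ V x) (ampl ℕ V y)
  obtain ⟨p, hp⟩ := exists_pairing_eq a b
  refine ⟨p, fun T => ?_⟩
  rw [hp, hab, inner_ampl_eq_tsum, inner_ampl_eq_tsum]
  exact tsum_congr fun n => inner_kraus _ _ _ _

/-- The matrix on the left is `W† (a ⊗ 1) W`, where `W` is the direct sum of `n` copies of the
contraction `V`, followed by the exchange of the index sets `Fin n` and `κ`. -/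
theorem norm_opMatrix_kraus_le (V : K →L[ℂ] L2Sum κ H) (hV : ‖V‖ ≤ 1) {n : ℕ}
    (a : Fin n → Fin n → (H →L[ℂ] H)) :
    ‖opMatrix fun i j => kraus V (a i j)‖ ≤ ‖opMatrix a‖ := by
  -- These are the components of `W x`, regrouped so that each `k` carries a vector of `Hⁿ`.
  let col : (Fin n → K) → κ → PiLp 2 fun _ : Fin n => H :=
    fun x k => WithLp.toLp 2 fun i => V (x i) k
  have hcol : ∀ x : PiLp 2 fun _ : Fin n => K,
      HasSum (fun k => ‖col x k‖ ^ 2) (∑ i, ‖V (x i)‖ ^ 2) := by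
    intro x
    simp only [PiLp.norm_sq_eq_of_L2, col]
    refine hasSum_sum fun i _ => ?_
    rw [L2Sum.norm_sq_eq_tsum]
    exact (L2Sum.summable_norm_sq _).hasSum
  have hbd : ∀ x : PiLp 2 fun _ : Fin n => K, ∑ i, ‖V (x i)‖ ^ 2 ≤ ‖x‖ ^ 2 := by
    intro x
    rw [PiLp.norm_sq_eq_of_L2]
    refine Finset.sum_le_sum fun i _ => ?_
    gcongr
    exact (V.le_of_opNorm_le hV _).trans (by simp)
  have hmem : ∀ x : PiLp 2 fun _ : Fin n => K, Memℓp (col x) 2 :=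
    fun x => memℓp_two_iff.2 (hcol x).summable
  have hnorm : ∀ x : PiLp 2 fun _ : Fin n => K,
      ‖(⟨col x, hmem x⟩ : L2Sum κ (PiLp 2 fun _ : Fin n => H))‖ ≤ ‖x‖ := by
    intro x
    refine le_of_sq_le_sq ?_ (norm_nonneg _)
    rw [L2Sum.norm_sq_eq_tsum]
    exact (hcol x).tsum_eq.trans_le (hbd x)
  have key : ∀ x y : PiLp 2 fun _ : Fin n => K,
      inner ℂ y (opMatrix (fun i j => kraus V (a i j)) x) =
        inner ℂ (⟨col y, hmem y⟩ : L2Sum κ (PiLp 2 fun _ : Fin n => H))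
          (ampl κ (opMatrix a) ⟨col x, hmem x⟩) := by
    intro x y
    rw [inner_ampl_eq_tsum, PiLp.inner_apply]
    have h1 : ∀ i, HasSum (fun k => inner ℂ (V (y i) k) (∑ j, a i j (V (x j) k)))
        (inner ℂ (y i) (opMatrix (fun i j => kraus V (a i j)) x i)) := by
      intro i
      rw [opMatrix_apply, inner_sum]
      simp only [inner_sum, inner_kraus]
      exact hasSum_sum fun j _ => lp.hasSum_inner (𝕜 := ℂ) (V (y i)) (ampl κ (a i j) (V (x j)))
    have h2 := (hasSum_sum (s := Finset.univ) fun i _ => h1 i).tsum_eq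
    rw [← h2]
    refine tsum_congr fun k => ?_
    rw [PiLp.inner_apply]
    refine Finset.sum_congr rfl fun i _ => ?_
    rw [opMatrix_apply]
  refine ContinuousLinearMap.opNorm_le_bound _ (norm_nonneg _) fun x => ?_
  set z := opMatrix (fun i j => kraus V (a i j)) x with hz
  -- The sesquilinear identity `key` is tested against the image vector `z` itself; one factor `‖z‖`
  -- is then cancelled.
  have h3 : ‖z‖ * ‖z‖ ≤ ‖opMatrix a‖ * ‖x‖ * ‖z‖ := by
    rw [← inner_self_eq_norm_mul_norm (𝕜 := ℂ)]
    refine (RCLike.re_le_norm _).trans ?_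
    conv_lhs => rw [hz, ← hz, key x z]
    refine (norm_inner_le_norm _ _).trans ?_
    calc _ ≤ ‖z‖ * (‖opMatrix a‖ * ‖x‖) := by
          gcongr
          · exact hnorm z
          · refine ((ampl κ (opMatrix a)).le_opNorm _).trans ?_
            gcongr
            · exact norm_ampl_le _
            · exact hnorm x
      _ = _ := by ring
  rcases (norm_nonneg z).eq_or_lt with h0 | h0
  · rw [← h0]; positivity
  · exact le_of_mul_le_mul_right h3 h0

theorem continuous_mul_left_ultraweak (S : H →L[ℂ] H) :
    Continuous[ultraweak H, ultraweak H] (LinearMap.mulLeft ℂ S) := by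
  refine continuous_ultraweak_of_pairing fun x y =>
    ⟨(x, ampl ℕ (ContinuousLinearMap.adjoint S) y), fun T => ?_⟩
  rw [ultraweakPairing_apply, ← inner_ampl_adjoint]
  rfl

end Kraus

/-! ### Operators on Hilbert space tensor products -/

section Tensor

variable {κ H K H' K' H₂ K₂ : Type*}
  [NormedAddCommGroup H] [InnerProductSpace ℂ H]
  [NormedAddCommGroup K] [InnerProductSpace ℂ K]
  [NormedAddCommGroup H'] [InnerProductSpace ℂ H']
  [NormedAddCommGroup K'] [InnerProductSpace ℂ K']
  [NormedAddCommGroup H₂] [InnerProductSpace ℂ H₂]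
  [NormedAddCommGroup K₂] [InnerProductSpace ℂ K₂]

/-- The elementary tensors as a continuous bilinear map. -/
def vtmulL (H K : Type*) [NormedAddCommGroup H] [InnerProductSpace ℂ H]
    [NormedAddCommGroup K] [InnerProductSpace ℂ K] : H →L[ℂ] K →L[ℂ] HTensor H K :=
  (ContinuousLinearMap.compL ℂ K (H ⊗[ℂ] K) (HTensor H K)
    UniformSpace.Completion.toComplL) ∘L TensorProduct.mkL ℂ H K

theorem vtmulL_apply (x : H) (y : K) : vtmulL H K x y = vtmul x y := rfl

@[simp]
theorem add_vtmul (x x' : H) (y : K) : vtmul (x + x') y = vtmul x y + vtmul x' y := by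
  simp [← vtmulL_apply]

@[simp]
theorem vtmul_add (x : H) (y y' : K) : vtmul x (y + y') = vtmul x y + vtmul x y' := by
  simp [← vtmulL_apply]

@[simp]
theorem smul_vtmul (c : ℂ) (x : H) (y : K) : vtmul (c • x) y = c • vtmul x y := by
  simp [← vtmulL_apply]

@[simp]
theorem vtmul_smul (c : ℂ) (x : H) (y : K) : vtmul x (c • y) = c • vtmul x y := by
  simp [← vtmulL_apply]

@[simp]
theorem zero_vtmul (y : K) : vtmul (0 : H) y = 0 := by
  simp [← vtmulL_apply]

@[simp]
theorem vtmul_zero (x : H) : vtmul x (0 : K) = 0 := by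
  simp [← vtmulL_apply]

theorem span_vtmul_dense (H K : Type*) [NormedAddCommGroup H] [InnerProductSpace ℂ H]
    [NormedAddCommGroup K] [InnerProductSpace ℂ K] :
    Dense (Submodule.span ℂ {z : HTensor H K | ∃ x y, z = vtmul x y} : Set (HTensor H K)) := by
  refine UniformSpace.Completion.denseRange_coe.mono ?_
  rintro _ ⟨a, rfl⟩
  induction a using TensorProduct.induction_on with
  | zero => exact Submodule.zero_mem _
  | tmul x y => exact Submodule.subset_span ⟨x, y, rfl⟩
  | add a b ha hb =>
    rw [UniformSpace.Completion.coe_add]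
    exact Submodule.add_mem _ ha hb

/-- Operators on a tensor product agree if they agree on elementary tensors. -/
theorem tensor_hom_ext {E : Type*} [NormedAddCommGroup E] [NormedSpace ℂ E]
    {S T : HTensor H K →L[ℂ] E} (h : ∀ x y, S (vtmul x y) = T (vtmul x y)) : S = T := by
  refine ContinuousLinearMap.ext_on (span_vtmul_dense H K) ?_
  rintro _ ⟨x, y, rfl⟩
  exact h x y

theorem tensor_ext_inner {u v : HTensor H K}
    (h : ∀ x y, inner ℂ (vtmul x y) u = inner ℂ (vtmul x y) v) : u = v := by
  refine ext_inner_left ℂ fun z => ?_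
  have hST : innerSL ℂ (u - v) = 0 := by
    refine tensor_hom_ext fun x y => ?_
    rw [innerSL_apply_apply, ← inner_conj_symm, inner_sub_right, h]
    simp
  have h0 : u - v = 0 := by
    have := DFunLike.congr_fun hST (u - v)
    rwa [innerSL_apply_apply, zero_apply, inner_self_eq_zero] at this
  rw [sub_eq_zero.1 h0]

/-- Operators on a tensor product agree if their matrix coefficients at elementary tensors do. -/
theorem tensor_op_ext {S T : HTensor H K →L[ℂ] HTensor H' K'}
    (h : ∀ x x' y y', inner ℂ (vtmul y y') (S (vtmul x x')) =
      inner ℂ (vtmul y y') (T (vtmul x x'))) : S = T :=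
  tensor_hom_ext fun x x' => tensor_ext_inner fun y y' => h x x' y y'

theorem otmul_comp (A : H' →L[ℂ] H₂) (B : K' →L[ℂ] K₂) (C : H →L[ℂ] H') (D : K →L[ℂ] K') :
    otmul A B ∘L otmul C D = otmul (A ∘L C) (B ∘L D) :=
  tensor_hom_ext fun x y => by simp [otmul_vtmul]

theorem otmul_mul (A C : H →L[ℂ] H) (B D : K →L[ℂ] K) :
    otmul A B * otmul C D = otmul (A * C) (B * D) :=
  otmul_comp A B C D

theorem otmul_one_one : otmul (1 : H →L[ℂ] H) (1 : K →L[ℂ] K) = 1 :=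
  tensor_hom_ext fun x y => by simp [otmul_vtmul]

theorem otmul_zero_left (B : K →L[ℂ] K') : otmul (0 : H →L[ℂ] H') B = 0 :=
  tensor_hom_ext fun x y => by simp [otmul_vtmul]

theorem otmul_zero_right (A : H →L[ℂ] H') : otmul A (0 : K →L[ℂ] K') = 0 :=
  tensor_hom_ext fun x y => by simp [otmul_vtmul]

/-- The map `(A, B) ↦ A ⊗ B` as a bilinear map. -/
def otmulₗ (H K H' K' : Type*) [NormedAddCommGroup H] [InnerProductSpace ℂ H]
    [NormedAddCommGroup K] [InnerProductSpace ℂ K] [NormedAddCommGroup H']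
    [InnerProductSpace ℂ H'] [NormedAddCommGroup K'] [InnerProductSpace ℂ K'] :
    (H →L[ℂ] H') →ₗ[ℂ] (K →L[ℂ] K') →ₗ[ℂ] (HTensor H K →L[ℂ] HTensor H' K') :=
  LinearMap.mk₂ ℂ otmul
    (fun A A' B => tensor_hom_ext fun x y => by simp [otmul_vtmul])
    (fun c A B => tensor_hom_ext fun x y => by simp [otmul_vtmul])
    (fun A B B' => tensor_hom_ext fun x y => by simp [otmul_vtmul])
    (fun c A B => tensor_hom_ext fun x y => by simp [otmul_vtmul])

theorem otmulₗ_apply (A : H →L[ℂ] H') (B : K →L[ℂ] K') : otmulₗ H K H' K' A B = otmul A B := rfl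

theorem norm_otmul_le (A : H →L[ℂ] H') (B : K →L[ℂ] K') : ‖otmul A B‖ ≤ ‖A‖ * ‖B‖ := by
  refine ContinuousLinearMap.opNorm_le_bound _ (by positivity) fun z => ?_
  induction z using UniformSpace.Completion.induction_on with
  | hp => exact isClosed_le (by fun_prop) (by fun_prop)
  | ih a =>
    rw [otmul, ContinuousLinearMap.completion_apply_coe, UniformSpace.Completion.norm_coe,
      UniformSpace.Completion.norm_coe]
    exact (TensorProduct.mapL A B).le_of_opNorm_le (TensorProduct.norm_mapL_le A B) a

section Complete

variable [CompleteSpace H] [CompleteSpace K] [CompleteSpace H'] [CompleteSpace K']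

theorem adjoint_otmul (A : H →L[ℂ] H') (B : K →L[ℂ] K') :
    ContinuousLinearMap.adjoint (otmul A B) =
      otmul (ContinuousLinearMap.adjoint A) (ContinuousLinearMap.adjoint B) :=
  tensor_op_ext fun x x' y y' => by
    rw [ContinuousLinearMap.adjoint_inner_right, otmul_vtmul, otmul_vtmul, inner_vtmul,
      inner_vtmul, ContinuousLinearMap.adjoint_inner_right,
      ContinuousLinearMap.adjoint_inner_right]

/-- This lemma and the next translate between a pointwise column estimate and a norm bound on `∑
Z_k† Z_k`. The norm bound is the form that survives tensoring with the identity. -/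
theorem norm_sum_adjoint_comp_le {Z : κ → K →L[ℂ] H} {C : ℝ} (F : Finset κ)
    (hZ : ∀ (x : K), ∑ k ∈ F, ‖Z k x‖ ^ 2 ≤ C ^ 2 * ‖x‖ ^ 2) :
    ‖∑ k ∈ F, ContinuousLinearMap.adjoint (Z k) ∘L Z k‖ ≤ C ^ 2 := by
  refine ContinuousLinearMap.opNorm_le_of_re_inner_le (by positivity) fun x y hx hy => ?_
  have h1 : ∀ k, RCLike.re (inner ℂ (ContinuousLinearMap.adjoint (Z k) (Z k x)) y) ≤
      (‖Z k x‖ ^ 2 + ‖Z k y‖ ^ 2) / 2 := by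
    intro k
    rw [ContinuousLinearMap.adjoint_inner_left]
    refine (RCLike.re_le_norm _).trans ((norm_inner_le_norm _ _).trans ?_)
    nlinarith [sq_nonneg (‖Z k x‖ - ‖Z k y‖)]
  have hx' := hZ x
  have hy' := hZ y
  rw [hx] at hx'
  rw [hy] at hy'
  have h2 : inner ℂ ((∑ k ∈ F, ContinuousLinearMap.adjoint (Z k) ∘L Z k) x) y =
      ∑ k ∈ F, inner ℂ (ContinuousLinearMap.adjoint (Z k) (Z k x)) y := by
    rw [sum_apply, sum_inner]
    rfl
  rw [h2, map_sum]
  refine (Finset.sum_le_sum fun k _ => h1 k).trans ?_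
  rw [← Finset.sum_div, Finset.sum_add_distrib]
  linarith

theorem sum_norm_sq_le_of_norm_sum_le {Z : κ → K →L[ℂ] H} {C : ℝ} (F : Finset κ)
    (hZ : ‖∑ k ∈ F, ContinuousLinearMap.adjoint (Z k) ∘L Z k‖ ≤ C ^ 2) (x : K) :
    ∑ k ∈ F, ‖Z k x‖ ^ 2 ≤ C ^ 2 * ‖x‖ ^ 2 := by
  have h : ∑ k ∈ F, ‖Z k x‖ ^ 2 =
      RCLike.re (inner ℂ ((∑ k ∈ F, ContinuousLinearMap.adjoint (Z k) ∘L Z k) x) x) := by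
    rw [sum_apply, sum_inner, map_sum]
    refine Finset.sum_congr rfl fun k _ => ?_
    rw [ContinuousLinearMap.comp_apply, ContinuousLinearMap.adjoint_inner_left,
      inner_self_eq_norm_sq]
  rw [h]
  refine (RCLike.re_le_norm _).trans ((norm_inner_le_norm _ _).trans ?_)
  calc _ ≤ C ^ 2 * ‖x‖ * ‖x‖ := by
        gcongr
        exact ContinuousLinearMap.le_of_opNorm_le _ hZ x
    _ = _ := by ring

/-- The estimate is not checked on vectors, since elements of the completed tensor product are not
elementary; it comes from `∑ (1 ⊗ Z_k)† (1 ⊗ Z_k) = 1 ⊗ ∑ Z_k† Z_k`. -/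
theorem sum_norm_sq_one_otmul_le {Z : κ → K →L[ℂ] K'} {C : ℝ} (F : Finset κ)
    (hZ : ∀ x : K, ∑ k ∈ F, ‖Z k x‖ ^ 2 ≤ C ^ 2 * ‖x‖ ^ 2) (u : HTensor H K) :
    ∑ k ∈ F, ‖otmul (1 : H →L[ℂ] H) (Z k) u‖ ^ 2 ≤ C ^ 2 * ‖u‖ ^ 2 := by
  refine sum_norm_sq_le_of_norm_sum_le (Z := fun k => otmul (1 : H →L[ℂ] H) (Z k)) F ?_ u
  have h : ∑ k ∈ F, ContinuousLinearMap.adjoint (otmul (1 : H →L[ℂ] H) (Z k)) ∘L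
      otmul (1 : H →L[ℂ] H) (Z k) =
      otmul 1 (∑ k ∈ F, ContinuousLinearMap.adjoint (Z k) ∘L Z k) := by
    rw [← otmulₗ_apply, map_sum]
    refine Finset.sum_congr rfl fun k _ => ?_
    rw [adjoint_otmul, otmul_comp, otmulₗ_apply, ContinuousLinearMap.one_def,
      ContinuousLinearMap.adjoint_id, ContinuousLinearMap.comp_id]
  rw [h]
  refine (norm_otmul_le _ _).trans ?_
  calc _ ≤ 1 * C ^ 2 := by
        gcongr
        · exact ContinuousLinearMap.norm_id_le
        · exact norm_sum_adjoint_comp_le F hZ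
    _ = _ := one_mul _

theorem sum_norm_sq_otmul_one_le {Z : κ → H →L[ℂ] H'} {C : ℝ} (F : Finset κ)
    (hZ : ∀ x : H, ∑ k ∈ F, ‖Z k x‖ ^ 2 ≤ C ^ 2 * ‖x‖ ^ 2) (u : HTensor H K) :
    ∑ k ∈ F, ‖otmul (Z k) (1 : K →L[ℂ] K) u‖ ^ 2 ≤ C ^ 2 * ‖u‖ ^ 2 := by
  refine sum_norm_sq_le_of_norm_sum_le (Z := fun k => otmul (Z k) (1 : K →L[ℂ] K)) F ?_ u
  have h : ∑ k ∈ F, ContinuousLinearMap.adjoint (otmul (Z k) (1 : K →L[ℂ] K)) ∘L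
      otmul (Z k) (1 : K →L[ℂ] K) =
      otmul (∑ k ∈ F, ContinuousLinearMap.adjoint (Z k) ∘L Z k) 1 := by
    rw [← otmulₗ_apply, map_sum, LinearMap.sum_apply]
    refine Finset.sum_congr rfl fun k _ => ?_
    rw [adjoint_otmul, otmul_comp, otmulₗ_apply, ContinuousLinearMap.one_def,
      ContinuousLinearMap.adjoint_id, ContinuousLinearMap.comp_id]
  rw [h]
  refine (norm_otmul_le _ _).trans ?_
  calc _ ≤ C ^ 2 * 1 := by
        gcongr
        · exact norm_sum_adjoint_comp_le F hZ
        · exact ContinuousLinearMap.norm_id_le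
    _ = _ := mul_one _

end Complete

end Tensor

/-! ### Slicing `H ⊗ ℓ²(κ)` into copies of `H`. -/

section Slices

variable {H : Type*} [NormedAddCommGroup H] [InnerProductSpace ℂ H] [CompleteSpace H]

/-- The isometry `x ↦ x ⊗ δ_k`. -/
def tensorBasisVec (H : Type*) [NormedAddCommGroup H] [InnerProductSpace ℂ H] {κ : Type*} (k : κ) :
    H →ₗᵢ[ℂ] HTensor H (L2 κ) where
  toLinearMap := ((vtmulL H (L2 κ)).flip (basisVec k)).toLinearMap
  norm_map' x := by
    change ‖vtmul x (basisVec k)‖ = ‖x‖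
    rw [vtmul, UniformSpace.Completion.norm_coe, TensorProduct.norm_tmul,
      (orthonormal_basisVec κ).1 k, mul_one]

theorem tensorBasisVec_apply {H κ : Type*} [NormedAddCommGroup H] [InnerProductSpace ℂ H]
    (k : κ) (x : H) : tensorBasisVec H k x = vtmul x (basisVec k) := rfl

theorem isHilbertSum_tensorBasisVec (κ : Type*) :
    IsHilbertSum ℂ (fun _ : κ => H) (fun k => tensorBasisVec H k) := by
  refine IsHilbertSum.mk (fun k l hkl x y => ?_) ?_
  · rw [tensorBasisVec_apply, tensorBasisVec_apply, inner_vtmul,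
      (orthonormal_basisVec κ).2 hkl, mul_zero]
  · set M := (⨆ k : κ, LinearMap.range (tensorBasisVec H k).toLinearMap).topologicalClosure
    have hM : IsClosed (M : Set (HTensor H (L2 κ))) := Submodule.isClosed_topologicalClosure _
    have h1 : ∀ (x : H) (y : L2 κ), vtmul x y ∈ M := by
      intro x y
      have hle : (Submodule.span ℂ (Set.range (basisVec : κ → L2 κ))).topologicalClosure ≤
          M.comap (vtmulL H (L2 κ) x).toLinearMap := by
        refine Submodule.topologicalClosure_minimal _ ?_
          (hM.preimage (vtmulL H (L2 κ) x).continuous)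
        rw [Submodule.span_le]
        rintro _ ⟨k, rfl⟩
        exact Submodule.le_topologicalClosure _ (Submodule.mem_iSup_of_mem k ⟨x, rfl⟩)
      rw [basisVec_total] at hle
      exact hle (Submodule.mem_top (x := y))
    have h2 : Submodule.span ℂ {z : HTensor H (L2 κ) | ∃ x y, z = vtmul x y} ≤ M := by
      rw [Submodule.span_le]
      rintro _ ⟨x, y, rfl⟩
      exact h1 x y
    intro z _
    have hz := closure_minimal (s := (Submodule.span ℂ
      {z : HTensor H (L2 κ) | ∃ x y, z = vtmul x y} : Set (HTensor H (L2 κ)))) h2 hM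
    exact hz (span_vtmul_dense H (L2 κ) z)

/-- The identification of `H ⊗ ℓ²(κ)` with the `ℓ²`-direct sum of copies of `H`. -/
def sliceEquiv (H κ : Type*) [NormedAddCommGroup H] [InnerProductSpace ℂ H] [CompleteSpace H] :
    HTensor H (L2 κ) ≃ₗᵢ[ℂ] L2Sum κ H :=
  (isHilbertSum_tensorBasisVec (H := H) κ).linearIsometryEquiv

/-- Testing the `k`-th slice against `x` is the same as testing against `x ⊗ δ_k`, and there `A ⊗ 1`
can be moved over as `A† ⊗ 1`. This makes the tensor formula for the comultiplication an
amplification. -/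
theorem sliceEquiv_otmul_one {κ : Type*} (A : H →L[ℂ] H) (u : HTensor H (L2 κ)) :
    sliceEquiv H κ (otmul A (ContinuousLinearMap.id ℂ (L2 κ)) u) =
      ampl κ A (sliceEquiv H κ u) := by
  classical
  have hk : ∀ (k : κ) (v : HTensor H (L2 κ)) (x : H),
      inner ℂ (vtmul x (basisVec k)) v = inner ℂ x (sliceEquiv H κ v k) := by
    intro k v x
    have h1 : (sliceEquiv H κ).symm (lp.single 2 k x) = vtmul x (basisVec k) :=
      (isHilbertSum_tensorBasisVec κ).linearIsometryEquiv_symm_apply_single x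
    rw [← h1, ← (sliceEquiv H κ).inner_map_map, LinearIsometryEquiv.apply_symm_apply,
      lp.inner_single_left]
  ext k
  refine ext_inner_left ℂ fun x => ?_
  rw [ampl_apply, ← hk]
  have h2 : ∀ v : HTensor H (L2 κ), inner ℂ (vtmul x (basisVec k))
      (otmul A (ContinuousLinearMap.id ℂ (L2 κ)) v) =
      inner ℂ (vtmul (ContinuousLinearMap.adjoint A x) (basisVec k)) v := by
    intro v
    rw [← ContinuousLinearMap.adjoint_inner_left, adjoint_otmul, otmul_vtmul,
      ContinuousLinearMap.adjoint_id]
    rfl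
  rw [h2, hk, ContinuousLinearMap.adjoint_inner_left]

end Slices

/-! ### Left and right shifts on the Fock space -/

section Shifts

variable {d : ℕ}

theorem inner_basisVec_left {ι : Type*} (i : ι) (x : L2 ι) : inner ℂ (basisVec i) x = x i := by
  classical
  rw [basisVec, lp.inner_single_left]
  simp

theorem L2.ext_inner {ι : Type*} {x y : L2 ι}
    (h : ∀ i, inner ℂ (basisVec i) x = inner ℂ (basisVec i) y) : x = y := by
  ext i
  rw [← inner_basisVec_left, h, inner_basisVec_left]

theorem L2.hom_ext {ι E : Type*} [NormedAddCommGroup E] [NormedSpace ℂ E]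
    {S T : L2 ι →L[ℂ] E} (h : ∀ i, S (basisVec i) = T (basisVec i)) : S = T := by
  refine ContinuousLinearMap.ext_on (s := Set.range (basisVec : ι → L2 ι)) ?_ ?_
  · exact Submodule.dense_iff_topologicalClosure_eq_top.2 (basisVec_total ι)
  · rintro _ ⟨i, rfl⟩
    exact h i

theorem L2.hasSum_basisVec {ι : Type*} (x : L2 ι) :
    HasSum (fun i => inner ℂ (basisVec i) x • basisVec i) x := by
  classical
  convert lp.hasSum_single (p := 2) (by norm_num) x using 2 with i
  rw [inner_basisVec_left, basisVec, ← lp.single_smul]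
  simp

theorem inner_leftShift (u : Words d) (x y : Fock d) :
    inner ℂ (leftShift u x) (leftShift u y) = inner ℂ x y :=
  (ofOrthonormal (orthonormal_shift u)).inner_map_map x y

theorem leftShift_mul (u v : Words d) : leftShift (u * v) = leftShift u ∘L leftShift v :=
  L2.hom_ext fun w => by simp [leftShift_basisVec, mul_assoc]

theorem leftShift_one : leftShift (1 : Words d) = 1 :=
  L2.hom_ext fun w => by simp [leftShift_basisVec]

theorem inner_basisVec_eq_zero {ι : Type*} {i j : ι} (h : i ≠ j) :
    inner ℂ (basisVec i : L2 ι) (basisVec j) = 0 :=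
  (orthonormal_basisVec ι).2 h

theorem of_mul_ne {i j : Fin d} (h : i ≠ j) (u v : Words d) :
    FreeMonoid.of i * u ≠ FreeMonoid.of j * v := by
  intro h'
  have := congrArg FreeMonoid.toList h'
  simp only [FreeMonoid.toList_mul, FreeMonoid.toList_of, List.cons_append, List.nil_append,
    List.cons.injEq] at this
  exact h this.1

theorem mul_of_ne {i j : Fin d} (h : i ≠ j) (u v : Words d) :
    u * FreeMonoid.of i ≠ v * FreeMonoid.of j := by
  intro h'
  have := congrArg FreeMonoid.toList h'
  simp only [FreeMonoid.toList_mul, FreeMonoid.toList_of] at this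
  have h2 := List.append_inj_right' this rfl
  simp only [List.cons.injEq, and_true] at h2
  exact h h2

theorem of_mul_ne_one (i : Fin d) (u : Words d) : FreeMonoid.of i * u ≠ 1 := by
  intro h'
  have := congrArg FreeMonoid.toList h'
  simp at this

theorem mul_of_ne_one (i : Fin d) (u : Words d) : u * FreeMonoid.of i ≠ 1 := by
  intro h'
  have := congrArg FreeMonoid.toList h'
  simp at this

theorem adjoint_leftShift_comp (u : Words d) :
    ContinuousLinearMap.adjoint (leftShift u) ∘L leftShift u = 1 := by
  ext1 x
  refine ext_inner_left ℂ fun y => ?_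
  rw [ContinuousLinearMap.comp_apply, ContinuousLinearMap.adjoint_inner_right, inner_leftShift]
  rfl

theorem adjoint_leftShift_comp_of_ne {i j : Fin d} (h : i ≠ j) :
    ContinuousLinearMap.adjoint (leftShift (FreeMonoid.of i)) ∘L
      leftShift (FreeMonoid.of j) = 0 := by
  refine L2.hom_ext fun w => L2.ext_inner fun v => ?_
  rw [ContinuousLinearMap.comp_apply, ContinuousLinearMap.adjoint_inner_right,
    leftShift_basisVec, leftShift_basisVec, inner_basisVec_eq_zero (of_mul_ne h _ _)]
  simp

theorem orthonormal_rightShift (u : Words d) :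
    Orthonormal ℂ fun w : Words d => (basisVec (w * u) : Fock d) :=
  (orthonormal_basisVec _).comp _ (mul_left_injective u)

/-- The right regular representation: `R_u ξ_w = ξ_{wu}`. -/
def rightShift (u : Words d) : Fock d →L[ℂ] Fock d :=
  (ofOrthonormal (orthonormal_rightShift u)).toContinuousLinearMap

theorem rightShift_basisVec (u w : Words d) :
    rightShift u (basisVec w) = basisVec (w * u) :=
  ofOrthonormal_basisVec (orthonormal_rightShift u) w

theorem rightShift_mul (u v : Words d) : rightShift (u * v) = rightShift v ∘L rightShift u :=
  L2.hom_ext fun w => by simp [rightShift_basisVec, mul_assoc]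

theorem rightShift_one : rightShift (1 : Words d) = 1 :=
  L2.hom_ext fun w => by simp [rightShift_basisVec]

theorem rightShift_leftShift (u v : Words d) (x : Fock d) :
    rightShift u (leftShift v x) = leftShift v (rightShift u x) := by
  have : rightShift u ∘L leftShift v = leftShift v ∘L rightShift u :=
    L2.hom_ext fun w => by simp [leftShift_basisVec, rightShift_basisVec, mul_assoc]
  exact DFunLike.congr_fun this x

/-- The factors are a prefix and a suffix of `t`. Finiteness permits the exchange of the double sums
in `commute_of_commute_shifts`. -/
theorem finite_factorizations (t : Words d) :
    {p : Words d × Words d | p.1 * p.2 = t}.Finite := by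
  refine Set.Finite.subset (Set.Finite.prod
    (s := {u : Words d | u.toList ∈ t.toList.inits})
    (t := {u : Words d | u.toList ∈ t.toList.tails}) ?_ ?_) ?_
  · exact (List.finite_toSet _).preimage FreeMonoid.toList.injective.injOn
  · exact (List.finite_toSet _).preimage FreeMonoid.toList.injective.injOn
  · rintro ⟨u, v⟩ rfl
    simp [List.mem_inits, List.mem_tails]

/-- The commutants of the left and of the right regular representation commute. -/
theorem commute_of_commute_shifts {A B : Fock d →L[ℂ] Fock d}
    (hA : ∀ u x, A (rightShift u x) = rightShift u (A x))
    (hB : ∀ u x, B (leftShift u x) = leftShift u (B x)) (x : Fock d) : A (B x) = B (A x) := by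
  -- It suffices to compare at `ξ_∅`: the general basis vector follows by applying `key` to `A L_w`,
  -- which still commutes with the right shifts.
  have key : ∀ A : Fock d →L[ℂ] Fock d, (∀ u x, A (rightShift u x) = rightShift u (A x)) →
      A (B (basisVec 1)) = B (A (basisVec 1)) := by
    intro A hA
    set a := A (basisVec 1) with ha
    set b := B (basisVec 1) with hb
    refine L2.ext_inner fun t => ?_
    have hAb : ∀ v, A (basisVec v) = rightShift v a := fun v => by
      rw [ha, ← hA, rightShift_basisVec, one_mul]
    have hBa : ∀ u, B (basisVec u) = leftShift u b := fun u => by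
      rw [hb, ← hB, leftShift_basisVec, mul_one]
    -- Both coefficients at `ξ_t` are the convolution of `a` and `b` over the factorizations `t = u
    -- v`, summed in the two possible orders.
    let c : Words d → Words d → ℂ := fun u v => inner ℂ (basisVec u) a * inner ℂ (basisVec v) b *
      inner ℂ (basisVec t : Fock d) (basisVec (u * v))
    have h1 : inner ℂ (basisVec t) (A b) = ∑' v, ∑' u, c u v := by
      have h := ((L2.hasSum_basisVec b).mapL (innerSL ℂ (basisVec t : Fock d) ∘L A)).tsum_eq
      rw [ContinuousLinearMap.comp_apply, innerSL_apply_apply] at h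
      rw [← h]
      refine tsum_congr fun v => ?_
      have h' := ((L2.hasSum_basisVec a).mapL
        (innerSL ℂ (basisVec t : Fock d) ∘L rightShift v)).tsum_eq
      simp only [ContinuousLinearMap.comp_apply, innerSL_apply_apply, map_smul, smul_eq_mul,
        rightShift_basisVec, hAb] at h' ⊢
      rw [← h', ← tsum_mul_left]
      exact tsum_congr fun u => by ring
    have h2 : inner ℂ (basisVec t) (B a) = ∑' u, ∑' v, c u v := by
      have h := ((L2.hasSum_basisVec a).mapL (innerSL ℂ (basisVec t : Fock d) ∘L B)).tsum_eq
      rw [ContinuousLinearMap.comp_apply, innerSL_apply_apply] at h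
      rw [← h]
      refine tsum_congr fun u => ?_
      have h' := ((L2.hasSum_basisVec b).mapL
        (innerSL ℂ (basisVec t : Fock d) ∘L leftShift u)).tsum_eq
      simp only [ContinuousLinearMap.comp_apply, innerSL_apply_apply, map_smul, smul_eq_mul,
        leftShift_basisVec, hBa] at h' ⊢
      rw [← h', ← tsum_mul_left]
      exact tsum_congr fun v => by ring
    rw [h1, h2]
    refine Summable.tsum_comm (f := c) (summable_of_hasFiniteSupport
      ((finite_factorizations t).subset fun p hp => ?_))
    by_contra hne
    refine hp ?_
    change _ * inner ℂ (basisVec t : Fock d) (basisVec (p.1 * p.2)) = 0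
    rw [inner_basisVec_eq_zero (Ne.symm hne), mul_zero]
  have hop : A ∘L B = B ∘L A := by
    refine L2.hom_ext fun w => ?_
    have h := key (A ∘L leftShift w) fun u x => by
      simp only [ContinuousLinearMap.comp_apply]
      rw [← rightShift_leftShift, hA]
    simp only [ContinuousLinearMap.comp_apply] at h ⊢
    rw [← hB, leftShift_basisVec, mul_one] at h
    exact h
  exact DFunLike.congr_fun hop x

end Shifts

/-! ### Invariant subspaces of amplified left shifts -/

section Wold

variable {d : ℕ} {κ ι : Type*}

/-- The closure of the sum of the ranges of the generators on `M`. -/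
def shifted (M : Submodule ℂ (L2Sum κ (Fock d))) : Submodule ℂ (L2Sum κ (Fock d)) :=
  ⨆ i : Fin d, M.map (ampl κ (leftShift (FreeMonoid.of i))).toLinearMap

theorem inner_ampl_leftShift (u : Words d) (x y : L2Sum κ (Fock d)) :
    inner ℂ (ampl κ (leftShift u) x) (ampl κ (leftShift u) y) = inner ℂ x y := by
  rw [inner_ampl_eq_tsum, lp.inner_eq_tsum]
  exact tsum_congr fun k => inner_leftShift u _ _

theorem inner_ampl_leftShift_of_ne {i j : Fin d} (h : i ≠ j) (x y : L2Sum κ (Fock d)) :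
    inner ℂ (ampl κ (leftShift (FreeMonoid.of i)) x)
      (ampl κ (leftShift (FreeMonoid.of j)) y) = 0 := by
  rw [inner_ampl_eq_tsum, ← tsum_zero]
  refine tsum_congr fun k => ?_
  rw [ampl_apply, ← ContinuousLinearMap.adjoint_inner_right, ← ContinuousLinearMap.comp_apply,
    adjoint_leftShift_comp_of_ne h]
  simp

theorem ampl_leftShift_mul (u v : Words d) (x : L2Sum κ (Fock d)) :
    ampl κ (leftShift (u * v)) x = ampl κ (leftShift u) (ampl κ (leftShift v) x) := by
  rw [leftShift_mul, ampl_comp]; rfl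

theorem ampl_leftShift_one (x : L2Sum κ (Fock d)) : ampl κ (leftShift 1) x = x := by
  rw [leftShift_one]; rfl

variable {M : Submodule ℂ (L2Sum κ (Fock d))}

theorem ampl_mem_shifted {i : Fin d} {x : L2Sum κ (Fock d)} (hx : x ∈ M) :
    ampl κ (leftShift (FreeMonoid.of i)) x ∈ shifted M :=
  Submodule.mem_iSup_of_mem i ⟨x, hx, rfl⟩

theorem shifted_le (hM : ∀ w : Words d, ∀ x ∈ M, ampl κ (leftShift w) x ∈ M) : shifted M ≤ M := by
  refine iSup_le fun i => ?_
  rintro _ ⟨x, hx, rfl⟩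
  exact hM _ x hx

/-- Translates of wandering vectors by different words are orthogonal. -/
theorem inner_wandering_eq_zero (hM : ∀ w : Words d, ∀ x ∈ M, ampl κ (leftShift w) x ∈ M)
    {e e' : L2Sum κ (Fock d)} (he : e ∈ M) (he' : e' ∈ M) (heS : e ∈ (shifted M)ᗮ)
    (heS' : e' ∈ (shifted M)ᗮ) {w w' : Words d} (hw : w ≠ w') :
    inner ℂ (ampl κ (leftShift w) e) (ampl κ (leftShift w') e') = 0 := by
  induction w using FreeMonoid.inductionOn' generalizing w' with
  | one =>
    rw [ampl_leftShift_one]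
    induction w' using FreeMonoid.inductionOn' with
    | one => exact absurd rfl hw
    | of_mul j v _ =>
      rw [ampl_leftShift_mul]
      exact (Submodule.mem_orthogonal' _ _).1 heS _ (ampl_mem_shifted (hM v e' he'))
  | of_mul i u ih =>
    induction w' using FreeMonoid.inductionOn' with
    | one =>
      rw [ampl_leftShift_one, ampl_leftShift_mul]
      exact (Submodule.mem_orthogonal _ _).1 heS' _ (ampl_mem_shifted (hM u e he))
    | of_mul j v _ =>
      rw [ampl_leftShift_mul, ampl_leftShift_mul]
      by_cases hij : i = j
      -- A common first letter is cancelled because its shift is isometric; distinct first letters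
      -- give orthogonal ranges.
      · subst hij
        rw [inner_ampl_leftShift]
        exact ih fun h => hw (by rw [h])
      · exact inner_ampl_leftShift_of_ne hij _ _

/-- Split `x` along the closure of `shifted M`. The remaining component is a wandering vector
orthogonal to every `e j`, so it vanishes by totality. -/
theorem mem_closure_shifted (hMc : IsClosed (M : Set (L2Sum κ (Fock d))))
    (hM : ∀ w : Words d, ∀ x ∈ M, ampl κ (leftShift w) x ∈ M) {e : ι → L2Sum κ (Fock d)}
    (heS : ∀ j, e j ∈ (shifted M)ᗮ)
    (htot : ∀ x ∈ M, x ∈ (shifted M)ᗮ → (∀ j, inner ℂ (e j) x = 0) → x = 0)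
    {x : L2Sum κ (Fock d)} (hx : x ∈ M) (hxe : ∀ j, inner ℂ (e j) x = 0) :
    x ∈ (shifted M).topologicalClosure := by
  set S := (shifted M).topologicalClosure with hS
  have hSM : S ≤ M := Submodule.topologicalClosure_minimal _ (shifted_le hM) hMc
  have : CompleteSpace S := (Submodule.isClosed_topologicalClosure _).completeSpace_coe
  have hp : S.starProjection x ∈ S := Submodule.starProjection_apply_mem _ _
  have hz : x - S.starProjection x = 0 := by
    refine htot _ (M.sub_mem hx (hSM hp)) ?_ fun j => ?_
    · rw [← Submodule.orthogonal_closure]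
      exact S.sub_starProjection_mem_orthogonal x
    · have h1 : e j ∈ Sᗮ := by rw [hS, Submodule.orthogonal_closure]; exact heS j
      rw [inner_sub_right, hxe, (Submodule.mem_orthogonal' _ _).1 h1 _ hp, sub_zero]
  rw [sub_eq_zero.1 hz]
  exact hp

/-- The completeness half of the Wold decomposition. Such an `x` lies in the closure of `shifted M`,
so its coefficients at the empty word vanish. Removing a first letter `i` by `L_i†` gives a vector
that satisfies the same hypotheses, and induction over words disposes of all other coefficients. -/
theorem eq_zero_of_orthogonal_wandering (hMc : IsClosed (M : Set (L2Sum κ (Fock d))))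
    (hM : ∀ w : Words d, ∀ x ∈ M, ampl κ (leftShift w) x ∈ M) {e : ι → L2Sum κ (Fock d)}
    (heS : ∀ j, e j ∈ (shifted M)ᗮ)
    (htot : ∀ x ∈ M, x ∈ (shifted M)ᗮ → (∀ j, inner ℂ (e j) x = 0) → x = 0)
    {x : L2Sum κ (Fock d)} (hx : x ∈ M)
    (hxe : ∀ w j, inner ℂ (ampl κ (leftShift w) (e j)) x = 0) : x = 0 := by
  ext1
  funext k
  refine L2.ext_inner fun v => ?_
  change _ = inner ℂ (basisVec v) 0
  rw [inner_zero_right]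
  have hcl : ∀ {y}, y ∈ M → (∀ w j, inner ℂ (ampl κ (leftShift w) (e j)) y = 0) →
      y ∈ (shifted M).topologicalClosure := fun hy hye =>
    mem_closure_shifted hMc hM heS htot hy fun j => by
      have := hye 1 j
      rwa [ampl_leftShift_one] at this
  have hcont : ∀ T : Fock d →L[ℂ] ℂ, IsClosed {y : L2Sum κ (Fock d) | T (y k) = 0} := fun T =>
    isClosed_eq (T.continuous.comp (lp.evalCLM ℂ (fun _ : κ => Fock d) 2 k).continuous)
      continuous_const
  induction v using FreeMonoid.inductionOn' generalizing x with
  | one =>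
    have h1 : shifted M ≤ LinearMap.ker ((innerSL ℂ (basisVec 1 : Fock d)).toLinearMap ∘ₗ
        (lp.evalCLM ℂ (fun _ : κ => Fock d) 2 k).toLinearMap) := by
      refine iSup_le fun i => ?_
      rintro _ ⟨y, _, rfl⟩
      change inner ℂ (basisVec 1) (leftShift (FreeMonoid.of i) (y k)) = 0
      have h2 : innerSL ℂ (basisVec 1 : Fock d) ∘L leftShift (FreeMonoid.of i) = 0 :=
        L2.hom_ext fun w => by
          rw [ContinuousLinearMap.comp_apply, leftShift_basisVec, innerSL_apply_apply,
            inner_basisVec_eq_zero (of_mul_ne_one i w).symm]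
          rfl
      exact DFunLike.congr_fun h2 (y k)
    exact closure_minimal h1 (hcont (innerSL ℂ (basisVec 1))) (hcl hx hxe)
  | of_mul i v ih =>
    set L := leftShift (d := d) (FreeMonoid.of i) with hL
    -- Although `M` need not be invariant under `L_i†`, this adjoint maps the closure of `shifted M`
    -- into `M`, by `L_i† L_j = δ_ij`.
    have h1 : (shifted M).topologicalClosure ≤
        M.comap (ampl κ (ContinuousLinearMap.adjoint L)).toLinearMap := by
      refine Submodule.topologicalClosure_minimal _ ?_
        (hMc.preimage (ampl κ (ContinuousLinearMap.adjoint L)).continuous)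
      refine iSup_le fun j => ?_
      rintro _ ⟨y, hy, rfl⟩
      change ampl κ (ContinuousLinearMap.adjoint L)
        (ampl κ (leftShift (FreeMonoid.of j)) y) ∈ M
      rw [← ContinuousLinearMap.comp_apply, ← ampl_comp]
      by_cases hij : i = j
      · subst hij
        rw [hL, adjoint_leftShift_comp]
        exact hy
      · rw [hL, adjoint_leftShift_comp_of_ne hij]
        exact M.zero_mem
    have h2 := ih (h1 (hcl hx hxe)) fun w j => by
      change inner ℂ _ (ampl κ (ContinuousLinearMap.adjoint L) x) = 0
      rw [inner_ampl_adjoint, ContinuousLinearMap.adjoint_adjoint, ← ampl_leftShift_mul]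
      exact hxe _ j
    change inner ℂ (basisVec v) (ContinuousLinearMap.adjoint L (x k)) = 0 at h2
    rwa [ContinuousLinearMap.adjoint_inner_right, hL, leftShift_basisVec] at h2

/-- An orthonormal basis of the wandering subspace of an invariant subspace `M` yields an
isometry onto `M` that intertwines the amplified left shifts. -/
theorem exists_intertwiner_of_wandering (hMc : IsClosed (M : Set (L2Sum κ (Fock d))))
    (hM : ∀ w : Words d, ∀ x ∈ M, ampl κ (leftShift w) x ∈ M) {e : ι → L2Sum κ (Fock d)}
    (he : Orthonormal ℂ e) (heM : ∀ j, e j ∈ M) (heS : ∀ j, e j ∈ (shifted M)ᗮ)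
    (htot : ∀ x ∈ M, x ∈ (shifted M)ᗮ → (∀ j, inner ℂ (e j) x = 0) → x = 0) :
    ∃ Θ : L2Sum ι (Fock d) →ₗᵢ[ℂ] L2Sum κ (Fock d),
      (∀ w x, Θ (ampl ι (leftShift w) x) = ampl κ (leftShift w) (Θ x)) ∧
      ∀ x, x ∈ M ↔ ∃ z, Θ z = x := by
  classical
  have hV : ∀ j, Orthonormal ℂ fun w : Words d => ampl κ (leftShift w) (e j) := by
    refine fun j => ⟨fun w => ?_, fun w w' h =>
      inner_wandering_eq_zero hM (heM j) (heM j) (heS j) (heS j) h⟩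
    rw [norm_eq_sqrt_re_inner (𝕜 := ℂ), inner_ampl_leftShift, ← norm_eq_sqrt_re_inner, he.1]
  let V : ι → Fock d →ₗᵢ[ℂ] L2Sum κ (Fock d) := fun j => ofOrthonormal (hV j)
  have hVb : ∀ j w, V j (basisVec w) = ampl κ (leftShift w) (e j) := fun j w =>
    ofOrthonormal_basisVec (hV j) w
  have hVM : ∀ j x, V j x ∈ M := by
    intro j x
    have h1 : (Submodule.span ℂ (Set.range (basisVec : Words d → Fock d))).topologicalClosure ≤
        M.comap (V j).toLinearMap := by
      refine Submodule.topologicalClosure_minimal _ ?_ (hMc.preimage (V j).continuous)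
      rw [Submodule.span_le]
      rintro _ ⟨w, rfl⟩
      change V j (basisVec w) ∈ M
      rw [hVb]
      exact hM w _ (heM j)
    rw [basisVec_total] at h1
    exact h1 (Submodule.mem_top (x := x))
  have hVL : ∀ j w x, V j (leftShift w x) = ampl κ (leftShift w) (V j x) := by
    intro j w x
    have h1 : (V j).toContinuousLinearMap ∘L leftShift w =
        ampl κ (leftShift w) ∘L (V j).toContinuousLinearMap := by
      refine L2.hom_ext fun v => ?_
      change V j (leftShift w (basisVec v)) = ampl κ (leftShift w) (V j (basisVec v))
      rw [leftShift_basisVec, hVb, hVb, ampl_leftShift_mul]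
    exact DFunLike.congr_fun h1 x
  have hort : OrthogonalFamily ℂ (fun _ : ι => Fock d) V := by
    intro i j hij x y
    have h1 : ContinuousLinearMap.adjoint (V i).toContinuousLinearMap ∘L
        (V j).toContinuousLinearMap = 0 := by
      refine L2.hom_ext fun w => L2.ext_inner fun v => ?_
      rw [ContinuousLinearMap.comp_apply, ContinuousLinearMap.adjoint_inner_right]
      change inner ℂ (V i (basisVec v)) (V j (basisVec w)) = inner ℂ (basisVec v) 0
      rw [hVb, hVb, inner_zero_right]
      by_cases hvw : v = w
      · rw [hvw, inner_ampl_leftShift, he.2 hij]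
      · exact inner_wandering_eq_zero hM (heM i) (heM j) (heS i) (heS j) hvw
    have h2 := DFunLike.congr_fun h1 y
    change inner ℂ ((V i).toContinuousLinearMap x) ((V j).toContinuousLinearMap y) = 0
    rw [← ContinuousLinearMap.adjoint_inner_right, ← ContinuousLinearMap.comp_apply, h2]
    simp
  have hsum : ∀ z : L2Sum ι (Fock d), HasSum (fun j => V j (z j)) (hort.linearIsometry z) :=
    fun z => hort.hasSum_linearIsometry z
  have hΘM : ∀ z, hort.linearIsometry z ∈ M := fun z =>
    hMc.mem_of_tendsto (hsum z) (Filter.Eventually.of_forall fun s =>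
      M.sum_mem fun j _ => hVM j _)
  refine ⟨hort.linearIsometry, fun w x => ?_, fun x => ⟨fun hx => ?_, ?_⟩⟩
  · refine (hsum _).unique ?_
    simp only [ampl_apply, hVL]
    exact (hsum x).mapL (ampl κ (leftShift w))
  · set Θ := hort.linearIsometry.toContinuousLinearMap with hΘ
    -- The defect of `x` from the range of `Θ` is orthogonal to all translates `L_w e_j`, as these
    -- are in the range.
    have h0 : x - Θ (ContinuousLinearMap.adjoint Θ x) = 0 := by
      refine eq_zero_of_orthogonal_wandering hMc hM heS htot (M.sub_mem hx (hΘM _))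
        fun w j => ?_
      have h1 : Θ (lp.single 2 j (basisVec w)) = ampl κ (leftShift w) (e j) := by
        rw [← hVb]
        exact hort.linearIsometry_apply_single _
      have h2 : ContinuousLinearMap.adjoint Θ ∘L Θ = 1 :=
        (ContinuousLinearMap.isometry_iff_adjoint_comp_self _).1 hort.linearIsometry.isometry
      rw [← h1, ← ContinuousLinearMap.adjoint_inner_right, map_sub,
        ← ContinuousLinearMap.comp_apply _ Θ, h2]
      simp
    exact ⟨_, (sub_eq_zero.1 h0).symm⟩
  · rintro ⟨z, rfl⟩
    exact hΘM z

/-- Every closed invariant subspace is the range of an isometric intertwiner. -/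
theorem exists_intertwiner.{u} {κ : Type u} {M : Submodule ℂ (L2Sum κ (Fock d))}
    (hMc : IsClosed (M : Set (L2Sum κ (Fock d))))
    (hM : ∀ w : Words d, ∀ x ∈ M, ampl κ (leftShift w) x ∈ M) :
    ∃ (ι : Type u) (Θ : L2Sum ι (Fock d) →ₗᵢ[ℂ] L2Sum κ (Fock d)),
      (∀ w x, Θ (ampl ι (leftShift w) x) = ampl κ (leftShift w) (Θ x)) ∧
      ∀ x, x ∈ M ↔ ∃ z, Θ z = x := by
  let W : Submodule ℂ (L2Sum κ (Fock d)) := M ⊓ (shifted M)ᗮ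
  have : CompleteSpace W :=
    (hMc.inter (Submodule.isClosed_orthogonal (shifted M))).completeSpace_coe
  obtain ⟨E, b, -⟩ := exists_hilbertBasis ℂ W
  refine ⟨E, exists_intertwiner_of_wandering hMc hM (e := fun j => (b j : L2Sum κ (Fock d)))
    (b.orthonormal.comp_linearIsometry W.subtypeₗᵢ) (fun j => (b j).2.1) (fun j => (b j).2.2)
    fun x hx hxS hxe => ?_⟩
  have h0 : (⟨x, hx, hxS⟩ : W) = 0 := by
    refine b.repr.injective (lp.ext (funext fun j => ?_))
    rw [b.repr_apply_apply, map_zero]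
    exact hxe j
  exact congrArg Subtype.val h0

end Wold

/-! ### Normal functionals on the commutant of the right shifts -/

section Commutant

variable {d : ℕ} {κ ι : Type*}

/-- The commutant of the right regular representation. -/
def rightCommutant (d : ℕ) : Subalgebra ℂ (Fock d →L[ℂ] Fock d) :=
  Subalgebra.centralizer ℂ (Set.range rightShift)

theorem mem_rightCommutant {A : Fock d →L[ℂ] Fock d} :
    A ∈ rightCommutant d ↔ ∀ u x, A (rightShift u x) = rightShift u (A x) := by
  rw [rightCommutant, Subalgebra.mem_centralizer_iff]
  constructor
  · intro h u x
    exact (DFunLike.congr_fun (h _ ⟨u, rfl⟩) x).symm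
  · rintro h _ ⟨u, rfl⟩
    ext1 x
    exact (h u x).symm

theorem leftShift_mem_rightCommutant (w : Words d) : leftShift w ∈ rightCommutant d :=
  mem_rightCommutant.2 fun u x => (rightShift_leftShift u w x).symm

theorem mem_rightCommutant_of_generators {A : Fock d →L[ℂ] Fock d}
    (h : ∀ i x, A (rightShift (FreeMonoid.of i) x) = rightShift (FreeMonoid.of i) (A x)) :
    A ∈ rightCommutant d := by
  rw [mem_rightCommutant]
  intro u
  induction u using FreeMonoid.inductionOn' with
  | one => intro x; rw [rightShift_one]; rfl
  | of_mul i v ih =>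
    intro x
    rw [rightShift_mul, ContinuousLinearMap.comp_apply, ih, h]
    rfl

theorem isWOTClosed_rightCommutant :
    IsWOTClosed (rightCommutant d : Set (Fock d →L[ℂ] Fock d)) := by
  have : {T : Fock d →WOT[ℂ] Fock d | T.toCLM ∈ (rightCommutant d : Set (Fock d →L[ℂ] Fock d))} =
      ⋂ (u : Words d) (x : Fock d) (f : StrongDual ℂ (Fock d)),
        {T | f (T (rightShift u x)) = (f ∘L rightShift u) (T x)} := by
    ext T
    simp only [Set.mem_ofPred_eq, SetLike.mem_coe, mem_rightCommutant, Set.mem_iInter]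
    refine forall_congr' fun u => forall_congr' fun x => ⟨fun h f => ?_, fun h => ?_⟩
    · exact congrArg f h
    · refine ext_inner_left ℂ fun y => ?_
      exact h (innerSL ℂ y)
  rw [IsWOTClosed, this]
  exact isClosed_iInter fun u => isClosed_iInter fun x => isClosed_iInter fun f =>
    isClosed_eq (ContinuousLinearMapWOT.continuous_dual_apply _ _)
      (ContinuousLinearMapWOT.continuous_dual_apply _ _)

open Classical in
theorem ampl_single {H K : Type*} [NormedAddCommGroup H] [InnerProductSpace ℂ H]
    [NormedAddCommGroup K] [InnerProductSpace ℂ K] (T : H →L[ℂ] K) (j : ι) (y : H) :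
    ampl ι T (lp.single 2 j y) = lp.single 2 j (T y) := by
  ext1
  funext i
  rw [ampl_apply]
  by_cases h : i = j
  · subst h; simp
  · simp [lp.single_apply, h]

open Classical in
theorem hom_ext_single {H E : Type*} [NormedAddCommGroup H] [InnerProductSpace ℂ H]
    [NormedAddCommGroup E] [NormedSpace ℂ E] {S T : L2Sum ι H →L[ℂ] E}
    (h : ∀ j y, S (lp.single 2 j y) = T (lp.single 2 j y)) : S = T := by
  ext1 x
  have hs := lp.hasSum_single (p := 2) (by norm_num) x
  have hS := hs.mapL S
  have hT := hs.mapL T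
  simp only [h] at hS
  exact hS.unique hT

/-- An intertwiner of the amplified left shifts intertwines the amplifications of all operators
in the commutant of the right shifts. -/
theorem intertwines_rightCommutant {Θ : L2Sum ι (Fock d) →L[ℂ] L2Sum κ (Fock d)}
    (hΘ : ∀ w x, Θ (ampl ι (leftShift w) x) = ampl κ (leftShift w) (Θ x))
    {A : Fock d →L[ℂ] Fock d} (hA : A ∈ rightCommutant d) (x : L2Sum ι (Fock d)) :
    Θ (ampl ι A x) = ampl κ A (Θ x) := by
  classical
  have hop : Θ ∘L ampl ι A = ampl κ A ∘L Θ := by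
    refine hom_ext_single fun j y => ?_
    rw [ContinuousLinearMap.comp_apply, ContinuousLinearMap.comp_apply, ampl_single]
    ext1
    funext k
    rw [ampl_apply]
    -- The `(k, j)` matrix entry of `Θ` commutes with the left shifts, hence with `A`.
    let B : Fock d →L[ℂ] Fock d := lp.evalCLM ℂ (fun _ : κ => Fock d) 2 k ∘L Θ ∘L
      lp.singleContinuousLinearMap ℂ (fun _ : ι => Fock d) 2 j
    have hB : ∀ z, B z = Θ (lp.single 2 j z) k := fun z => rfl
    have h := commute_of_commute_shifts (B := B) (mem_rightCommutant.1 hA) (fun u z => ?_) y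
    · rw [hB, hB] at h
      exact h.symm
    · rw [hB, hB, ← ampl_single, hΘ, ampl_apply]
  exact DFunLike.congr_fun hop x

/-- A normal functional on the commutant of the right shifts is a vector functional, and the
vector can be taken cyclic for the left shifts. -/
theorem exists_vector_functional (p : L2Sum ℕ (Fock d) × L2Sum ℕ (Fock d)) :
    ∃ ζ η : Fock d,
      (∀ A ∈ rightCommutant d, ultraweakPairing (Fock d) A p = inner ℂ η (A ζ)) ∧
      ∀ η' : Fock d, (∀ w, inner ℂ η' (leftShift w ζ) = 0) → η' = 0 := by
  classical
  obtain ⟨x, y⟩ := p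
  by_cases hx0 : x = 0
  -- For the zero functional the first vector still has to be cyclic, so `ξ_∅` is taken.
  · refine ⟨basisVec 1, 0, fun A _ => ?_, fun η' h => L2.ext_inner fun w => ?_⟩
    · rw [ultraweakPairing_apply, hx0]
      simp
    · have := h w
      rw [leftShift_basisVec, mul_one] at this
      rw [← inner_conj_symm, this]
      simp
  set M := (Submodule.span ℂ (Set.range fun w : Words d =>
    ampl ℕ (leftShift w) x)).topologicalClosure with hMdef
  have hMc : IsClosed (M : Set (L2Sum ℕ (Fock d))) := Submodule.isClosed_topologicalClosure _
  have hM : ∀ w : Words d, ∀ z ∈ M, ampl ℕ (leftShift w) z ∈ M := by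
    intro w z hz
    have : M ≤ M.comap (ampl ℕ (leftShift w)).toLinearMap := by
      refine Submodule.topologicalClosure_minimal _ ?_
        (hMc.preimage (ampl ℕ (leftShift w)).continuous)
      rw [Submodule.span_le]
      rintro _ ⟨v, rfl⟩
      change ampl ℕ (leftShift w) (ampl ℕ (leftShift v) x) ∈ M
      rw [← ampl_leftShift_mul]
      exact Submodule.le_topologicalClosure _ (Submodule.subset_span ⟨_, rfl⟩)
    exact this hz
  have hLx : ∀ w, ampl ℕ (leftShift w) x ∈ M := fun w =>
    Submodule.le_topologicalClosure _ (Submodule.subset_span ⟨w, rfl⟩)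
  have hxM : x ∈ M := by simpa only [ampl_leftShift_one] using hLx 1
  have hMperp : ∀ z, z ∈ M → (∀ w, inner ℂ (ampl ℕ (leftShift w) x) z = 0) → z = 0 := by
    intro z hz h
    have h1 : z ∈ Mᗮ := by
      rw [hMdef, Submodule.orthogonal_closure, Submodule.mem_orthogonal]
      intro u hu
      induction hu using Submodule.span_induction with
      | mem u hu => obtain ⟨w, rfl⟩ := hu; exact h w
      | zero => simp
      | add a b _ _ ha hb => rw [inner_add_left, ha, hb, add_zero]
      | smul c a _ ha => rw [inner_smul_left, ha, mul_zero]
    exact inner_self_eq_zero.1 ((Submodule.mem_orthogonal _ _).1 h1 z hz)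
  -- A wandering vector is orthogonal to `L_w x` for every `w ≠ ∅`, so it is determined by its inner
  -- product with `x`. Thus the wandering space is at most a line, spanned by the projection `q` of
  -- `x`.
  have hW : ∀ z ∈ M, z ∈ (shifted M)ᗮ → inner ℂ x z = 0 → z = 0 := by
    intro z hz hzS hxz
    refine hMperp z hz fun w => ?_
    induction w using FreeMonoid.inductionOn' with
    | one => rwa [ampl_leftShift_one]
    | of_mul i v _ =>
      rw [ampl_leftShift_mul]
      exact (Submodule.mem_orthogonal _ _).1 hzS _ (ampl_mem_shifted (hLx v))
  let W : Submodule ℂ (L2Sum ℕ (Fock d)) := M ⊓ (shifted M)ᗮ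
  have : CompleteSpace W :=
    (hMc.inter (Submodule.isClosed_orthogonal (shifted M))).completeSpace_coe
  set q := W.starProjection x with hq
  have hqW : q ∈ W := Submodule.starProjection_apply_mem _ _
  have hqx : ∀ z ∈ W, inner ℂ q z = inner ℂ x z := by
    intro z hz
    have := (Submodule.mem_orthogonal' _ _).1 (W.sub_starProjection_mem_orthogonal x) z hz
    rw [inner_sub_left, sub_eq_zero] at this
    exact this.symm
  have hq0 : q ≠ 0 := by
    intro hq0
    -- If `q = 0` there are no wandering vectors, and the Wold decomposition over the empty family
    -- gives `x = 0`.
    refine hx0 (eq_zero_of_orthogonal_wandering (ι := Empty) (e := Empty.elim) hMc hM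
      (fun j => j.elim) (fun z hz hzS _ => hW z hz hzS ?_) hxM fun w j => j.elim)
    rw [← hqx z ⟨hz, hzS⟩, hq0, inner_zero_left]
  let e : Unit → L2Sum ℕ (Fock d) := fun _ => ((‖q‖ : ℂ)⁻¹) • q
  have heW : ∀ j, e j ∈ W := fun j => W.smul_mem _ hqW
  have hqn : (‖q‖ : ℂ) ≠ 0 := by simpa using hq0
  have he : Orthonormal ℂ e := by
    refine ⟨fun j => ?_, fun i j hij => absurd (Subsingleton.elim i j) hij⟩
    simp only [e]
    rw [norm_smul, norm_inv, Complex.norm_real, norm_norm, inv_mul_cancel₀]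
    simpa using hq0
  obtain ⟨Θ, hΘL, hΘM⟩ := exists_intertwiner_of_wandering hMc hM he (fun j => (heW j).1)
    (fun j => (heW j).2) fun z hz hzS hze => hW z hz hzS (by
      have := hze ()
      simp only [e] at this
      rw [inner_smul_left, mul_eq_zero, hqx z ⟨hz, hzS⟩] at this
      refine this.resolve_left ?_
      simpa using hq0)
  obtain ⟨ζ, hζ⟩ := (hΘM x).1 hxM
  -- The functional is transported to a single copy of the Fock space: `x = Θ ζ`, and `y` is
  -- replaced by `Θ† y`. Cyclicity of `ζ` is that of `x` in `M`.
  refine ⟨ζ (), ContinuousLinearMap.adjoint Θ.toContinuousLinearMap y (), fun A hA => ?_,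
    fun η' h => ?_⟩
  · rw [ultraweakPairing_apply, ← hζ]
    have h1 := intertwines_rightCommutant (Θ := Θ.toContinuousLinearMap) hΘL hA ζ
    change inner ℂ y (ampl ℕ A (Θ.toContinuousLinearMap ζ)) = _
    rw [← h1, ← ContinuousLinearMap.adjoint_inner_left, inner_ampl_eq_tsum]
    simp
  · have hm : Memℓp (fun _ : Unit => η') 2 := memℓp_two_iff.2 .of_finite
    let z : L2Sum Unit (Fock d) := ⟨_, hm⟩
    have h0 : Θ z = 0 := by
      refine hMperp _ ((hΘM _).2 ⟨z, rfl⟩) fun w => ?_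
      rw [← hζ, ← hΘL, Θ.inner_map_map, ← inner_conj_symm, inner_ampl_eq_tsum]
      change starRingEnd ℂ (∑' _ : Unit, inner ℂ η' (leftShift w (ζ ()))) = 0
      rw [h w]
      simp
    have h1 : z = 0 := Θ.injective (by rw [h0, map_zero])
    exact congrFun (congrArg Subtype.val h1) ()

theorem isWOTClosed_toeplitz : IsWOTClosed (toeplitz d : Set (Fock d →L[ℂ] Fock d)) := by
  have : {T : Fock d →WOT[ℂ] Fock d | T.toCLM ∈ (toeplitz d : Set (Fock d →L[ℂ] Fock d))} =
      ⋂ A ∈ {A : Subalgebra ℂ (Fock d →L[ℂ] Fock d) |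
        IsWOTClosed (A : Set (Fock d →L[ℂ] Fock d)) ∧ ∀ w : Words d, leftShift w ∈ A},
      {T : Fock d →WOT[ℂ] Fock d | T.toCLM ∈ (A : Set (Fock d →L[ℂ] Fock d))} := by
    ext T
    simp [toeplitz]
  rw [IsWOTClosed, this]
  exact isClosed_biInter fun A hA => hA.1

/-- The linear span of the left shifts. -/
def polynomials (d : ℕ) : Submodule ℂ (Fock d →L[ℂ] Fock d) :=
  Submodule.span ℂ (Set.range leftShift)

/-- A normal functional that vanishes on the polynomials is `⟪η, · ζ⟫` with `η` orthogonal to every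
`L_w ζ`. Since `ζ` is cyclic, `η = 0`, and the functional vanishes on the whole commutant. -/
theorem rightCommutant_le :
    Subalgebra.toSubmodule (rightCommutant d) ≤ ultraweakClosure (polynomials d) := by
  intro A hA
  by_contra hcon
  obtain ⟨p, hp, hpA⟩ := exists_pairing_separating hcon
  obtain ⟨ζ, η, h1, h2⟩ := exists_vector_functional p
  refine hpA ?_
  rw [h1 A hA, h2 η fun w => ?_, inner_zero_left]
  rw [← h1 _ (leftShift_mem_rightCommutant w)]
  exact hp _ (Submodule.subset_span ⟨w, rfl⟩)

theorem toeplitz_le_rightCommutant : toeplitz d ≤ rightCommutant d :=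
  sInf_le ⟨isWOTClosed_rightCommutant, leftShift_mem_rightCommutant⟩

theorem polynomials_le : polynomials d ≤ Subalgebra.toSubmodule (toeplitz d) := by
  rw [polynomials, Submodule.span_le]
  rintro _ ⟨w, rfl⟩
  exact leftShift_mem d w

theorem ultraweakClosure_polynomials :
    ultraweakClosure (polynomials d) = Subalgebra.toSubmodule (toeplitz d) :=
  le_antisymm (ultraweakClosure_le polynomials_le isWOTClosed_toeplitz.isWeakStarClosed)
    (le_trans toeplitz_le_rightCommutant rightCommutant_le)

/-- The noncommutative analytic Toeplitz algebra is the commutant of the right shifts. -/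
theorem toeplitz_eq_rightCommutant : toeplitz d = rightCommutant d := by
  refine le_antisymm toeplitz_le_rightCommutant fun A hA => ?_
  have := rightCommutant_le hA
  rwa [ultraweakClosure_polynomials] at this

/-- A weak* closed subspace that contains the left shifts contains the Toeplitz algebra. -/
theorem toeplitz_le_of_leftShift_mem {C : Submodule ℂ (Fock d →L[ℂ] Fock d)}
    (hC : IsWeakStarClosed (C : Set (Fock d →L[ℂ] Fock d))) (h : ∀ w, leftShift w ∈ C) :
    Subalgebra.toSubmodule (toeplitz d) ≤ C := by
  rw [← ultraweakClosure_polynomials]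
  refine ultraweakClosure_le ?_ hC
  rw [polynomials, Submodule.span_le]
  rintro _ ⟨w, rfl⟩
  exact h w

/-- Weak* continuous maps that agree on the left shifts agree on the Toeplitz algebra. -/
theorem eqOn_toeplitz {K : Type*} [NormedAddCommGroup K] [InnerProductSpace ℂ K]
    {Φ Ψ : (Fock d →L[ℂ] Fock d) →ₗ[ℂ] (K →L[ℂ] K)}
    (hΦ : Continuous[ultraweak (Fock d), ultraweak K] Φ)
    (hΨ : Continuous[ultraweak (Fock d), ultraweak K] Ψ)
    (h : ∀ w, Φ (leftShift w) = Ψ (leftShift w)) {A : Fock d →L[ℂ] Fock d}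
    (hA : A ∈ toeplitz d) : Φ A = Ψ A :=
  toeplitz_le_of_leftShift_mem (isWeakStarClosed_eqLocus hΦ hΨ) h hA

/-- Weak* closed subspaces of the Toeplitz algebra are closed in the weak operator topology. -/
theorem isWOTClosed_of_isWeakStarClosed {C : Submodule ℂ (Fock d →L[ℂ] Fock d)}
    (hCL : C ≤ Subalgebra.toSubmodule (toeplitz d))
    (hC : IsWeakStarClosed (C : Set (Fock d →L[ℂ] Fock d))) :
    IsWOTClosed (C : Set (Fock d →L[ℂ] Fock d)) := by
  have hcl : ultraweakClosure C = C := le_antisymm (ultraweakClosure_le le_rfl hC)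
    (le_ultraweakClosure C)
  refine isClosed_of_closure_subset fun T hT => ?_
  -- A WOT limit of elements of `C` stays in `𝓛_d`. There the separating normal functional is a
  -- single vector functional, hence WOT continuous.
  have hTL : T.toCLM ∈ toeplitz d :=
    closure_minimal (t := {S : Fock d →WOT[ℂ] Fock d | S.toCLM ∈ (toeplitz d : Set (Fock d →L[ℂ] Fock d))})
      (fun S hS => hCL hS) isWOTClosed_toeplitz hT
  by_contra hcon
  have hcon' : T.toCLM ∉ ultraweakClosure C := by rw [hcl]; exact hcon
  obtain ⟨p, hp, hpT⟩ := exists_pairing_separating hcon'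
  obtain ⟨ζ, η, h1, -⟩ := exists_vector_functional p
  refine hpT ?_
  rw [h1 _ (toeplitz_le_rightCommutant hTL)]
  have hclosed : IsClosed {S : Fock d →WOT[ℂ] Fock d | innerSL ℂ η (S ζ) = 0} :=
    isClosed_eq (ContinuousLinearMapWOT.continuous_dual_apply _ _) continuous_const
  refine closure_minimal (fun S hS => ?_) hclosed hT
  change inner ℂ η (S.toCLM ζ) = 0
  rw [← h1 _ (toeplitz_le_rightCommutant (hCL hS))]
  exact hp _ hS

end Commutant

/-! ### Lifting of operators that commute with the backward right shifts -/

section Lifting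

variable {d : ℕ}

/-- Hahn-Banach extension of a functional dominated by a positive semidefinite form. -/
theorem exists_extension_of_le_form {E : Type*} [AddCommGroup E] [Module ℂ E]
    (c : PreInnerProductSpace.Core ℂ E) (S : Submodule ℂ E) (f : S →ₗ[ℂ] ℂ)
    (hf : ∀ x : S, ‖f x‖ ^ 2 ≤ (c.inner (x : E) x).re) :
    ∃ g : E →ₗ[ℂ] ℂ, (∀ x : S, g x = f x) ∧ ∀ x, ‖g x‖ ^ 2 ≤ (c.inner x x).re := by
  -- The form may be degenerate, so it supplies only a seminorm; this is all that Hahn-Banach needs.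
  let : SeminormedAddCommGroup E := InnerProductSpace.Core.toSeminormedAddCommGroup (c := c)
  let : NormedSpace ℂ E := InnerProductSpace.Core.toNormedSpace (c := c)
  have hn : ∀ x : E, ‖x‖ = √(c.inner x x).re := fun x => rfl
  have h0 : ∀ x : E, 0 ≤ (c.inner x x).re := c.re_inner_nonneg
  obtain ⟨g, hg, hgn⟩ := Module.Dual.exists_extension_of_le_seminorm S f
    (p := normSeminorm ℂ E) fun x => by
      change ‖f x‖ ≤ ‖(x : E)‖
      rw [hn]
      exact Real.le_sqrt_of_sq_le (hf x)
  refine ⟨g, hg, fun x => ?_⟩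
  have h1 := hgn x
  change ‖g x‖ ≤ ‖x‖ at h1
  rw [hn] at h1
  exact (Real.le_sqrt (norm_nonneg _) (h0 x)).1 h1

/-- The backward right shift `R_i^†`. -/
def backShift (i : Fin d) : Fock d →L[ℂ] Fock d :=
  ContinuousLinearMap.adjoint (rightShift (FreeMonoid.of i))

theorem inner_rightShift (u : Words d) (x y : Fock d) :
    inner ℂ (rightShift u x) (rightShift u y) = inner ℂ x y :=
  (ofOrthonormal (orthonormal_rightShift u)).inner_map_map x y

theorem inner_backShift_left (i : Fin d) (x y : Fock d) :
    inner ℂ (backShift i x) y = inner ℂ x (rightShift (FreeMonoid.of i) y) :=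
  ContinuousLinearMap.adjoint_inner_left _ _ _

theorem inner_backShift_right (i : Fin d) (x y : Fock d) :
    inner ℂ x (backShift i y) = inner ℂ (rightShift (FreeMonoid.of i) x) y :=
  ContinuousLinearMap.adjoint_inner_right _ _ _

theorem backShift_rightShift (i : Fin d) (x : Fock d) :
    backShift i (rightShift (FreeMonoid.of i) x) = x :=
  ext_inner_left ℂ fun y => by rw [inner_backShift_right, inner_rightShift]

theorem backShift_rightShift_of_ne {i j : Fin d} (h : i ≠ j) (x : Fock d) :
    backShift i (rightShift (FreeMonoid.of j) x) = 0 := by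
  have hop : backShift i ∘L rightShift (FreeMonoid.of j) = 0 :=
    L2.hom_ext fun w => L2.ext_inner fun v => by
      rw [ContinuousLinearMap.comp_apply, inner_backShift_right, rightShift_basisVec,
        rightShift_basisVec, inner_basisVec_eq_zero (mul_of_ne h _ _)]
      simp
  exact DFunLike.congr_fun hop x

theorem backShift_basisVec_one (i : Fin d) : backShift i (basisVec 1) = 0 :=
  L2.ext_inner fun v => by
    rw [inner_backShift_right, rightShift_basisVec, inner_basisVec_eq_zero (mul_of_ne_one i v),
      inner_zero_right]

theorem inner_one_rightShift (i : Fin d) (x : Fock d) :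
    inner ℂ (basisVec 1) (rightShift (FreeMonoid.of i) x) = 0 := by
  rw [← inner_backShift_left, backShift_basisVec_one, inner_zero_left]

/-- Induction on words by appending letters on the right. -/
theorem words_induction_right {P : Words d → Prop} (one : P 1)
    (mul_of : ∀ w i, P w → P (w * FreeMonoid.of i)) (w : Words d) : P w := by
  have h : ∀ l : List (Fin d), P (FreeMonoid.ofList l) := by
    intro l
    induction l using List.reverseRecOn with
    | nil => exact one
    | append_singleton l i ih => exact mul_of _ i ih
  exact h w.toList

/-- A word is either empty or has exactly one last letter, so the identity is the projection onto
`ξ_∅` plus `∑ R_i R_i†`. -/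
theorem fock_decomposition (x : Fock d) :
    x = inner ℂ (basisVec 1) x • basisVec 1 +
      ∑ i, rightShift (FreeMonoid.of i) (backShift i x) := by
  have hop : ContinuousLinearMap.id ℂ (Fock d) =
      (innerSL ℂ (basisVec 1 : Fock d)).smulRight (basisVec 1) +
        ∑ i, rightShift (FreeMonoid.of i) ∘L backShift i := by
    refine L2.hom_ext fun w => ?_
    simp only [ContinuousLinearMap.id_apply, add_apply, sum_apply,
      ContinuousLinearMap.smulRight_apply, innerSL_apply_apply, ContinuousLinearMap.comp_apply]
    induction w using words_induction_right with
    | one =>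
      simp only [backShift_basisVec_one, map_zero, Finset.sum_const_zero, add_zero]
      rw [inner_self_eq_norm_sq_to_K, (orthonormal_basisVec _).1]
      simp
    | mul_of w i _ =>
      rw [← rightShift_basisVec, inner_one_rightShift, zero_smul, zero_add,
        Finset.sum_eq_single i, backShift_rightShift]
      · intro j _ hj
        rw [backShift_rightShift_of_ne hj, map_zero]
      · simp
  have := DFunLike.congr_fun hop x
  simpa only [ContinuousLinearMap.id_apply, add_apply, sum_apply,
      ContinuousLinearMap.smulRight_apply, innerSL_apply_apply,
      ContinuousLinearMap.comp_apply] using this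

theorem norm_sq_decomposition (x : Fock d) :
    ‖x‖ ^ 2 = ‖inner ℂ (basisVec 1) x‖ ^ 2 + ∑ i, ‖backShift i x‖ ^ 2 := by
  have h : inner ℂ x x = inner ℂ x (inner ℂ (basisVec 1) x • basisVec 1 +
      ∑ i, rightShift (FreeMonoid.of i) (backShift i x)) := by rw [← fock_decomposition]
  rw [inner_add_right, inner_sum, inner_smul_right, ← inner_conj_symm x (basisVec 1),
    RCLike.mul_conj] at h
  simp only [← inner_backShift_left, inner_self_eq_norm_sq_to_K] at h
  exact_mod_cast h

/-- A partially defined operator of norm at most `C` that commutes with the backward right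
shifts. -/
structure CommutesBackShift (C : ℝ) (g : Fock d →ₗ.[ℂ] Fock d) : Prop where
  mem : ∀ (i : Fin d) (x : Fock d), x ∈ g.domain → backShift i x ∈ g.domain
  map : ∀ (i : Fin d) (x : g.domain), g ⟨backShift i x, mem i x x.2⟩ = backShift i (g x)
  bound : ∀ x : g.domain, ‖g x‖ ^ 2 ≤ C ^ 2 * ‖(x : Fock d)‖ ^ 2

/-- The extension step of the lifting theorem. -/
theorem CommutesBackShift.exists_extension {C : ℝ} {g : Fock d →ₗ.[ℂ] Fock d}
    (hg : CommutesBackShift C g) : ∃ g' : Fock d →ₗ.[ℂ] Fock d, g ≤ g' ∧ CommutesBackShift C g' ∧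
      ∀ x, (∀ i, backShift i x ∈ g.domain) → x ∈ g'.domain := by
  -- The new domain consists of all vectors for which the required values `R_i† g'(x) = g(R_i† x)`
  -- are already defined.
  obtain ⟨D, hD⟩ : ∃ D : Submodule ℂ (Fock d), ∀ {x}, x ∈ D ↔ ∀ i, backShift i x ∈ g.domain :=
    ⟨⨅ i, g.domain.comap (backShift i).toLinearMap, fun {x} => by simp [Submodule.mem_iInf]⟩
  have hle : g.domain ≤ D := fun x hx => hD.2 fun i => hg.mem i x hx
  obtain ⟨c, hc⟩ : ∃ c : Fin d → D →ₗ[ℂ] Fock d,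
      ∀ i (x : D), c i x = g ⟨backShift i x, hD.1 x.2 i⟩ :=
    ⟨fun i => g.toFun ∘ₗ ((backShift i).toLinearMap ∘ₗ D.subtype).codRestrict g.domain
      fun x => hD.1 x.2 i, fun i x => rfl⟩
  have hcb : ∀ x : D, ∑ i, ‖c i x‖ ^ 2 ≤ C ^ 2 * ‖(x : Fock d)‖ ^ 2 := by
    intro x
    calc _ ≤ ∑ i, C ^ 2 * ‖backShift i (x : Fock d)‖ ^ 2 :=
          Finset.sum_le_sum fun i _ => by rw [hc]; exact hg.bound ⟨_, hD.1 x.2 i⟩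
      _ ≤ _ := by
          rw [← Finset.mul_sum, norm_sq_decomposition (x : Fock d)]
          gcongr
          exact le_add_of_nonneg_left (by positivity)
  -- `q x x` is what the norm bound leaves for the squared coefficient of `g'(x)` at `ξ_∅`; it is
  -- nonnegative by `hcb`.
  let q : D → D → ℂ := fun x y => (C : ℂ) ^ 2 * inner ℂ (x : Fock d) (y : Fock d) -
    ∑ i, inner ℂ (c i x) (c i y)
  have hq : ∀ x, (q x x).re = C ^ 2 * ‖(x : Fock d)‖ ^ 2 - ∑ i, ‖c i x‖ ^ 2 := by
    intro x
    have h : q x x = ((C ^ 2 * ‖(x : Fock d)‖ ^ 2 - ∑ i, ‖c i x‖ ^ 2 : ℝ) : ℂ) := by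
      simp only [q, inner_self_eq_norm_sq_to_K]
      push_cast
      rfl
    rw [h, Complex.ofReal_re]
  let core : PreInnerProductSpace.Core ℂ D :=
    { inner := q
      conj_inner_symm := fun x y => by simp [q, inner_conj_symm]
      re_inner_nonneg := fun x => by
        change 0 ≤ (q x x).re
        rw [hq]
        linarith [hcb x]
      add_left := fun x y z => by
        simp only [q, Submodule.coe_add, inner_add_left, map_add, Finset.sum_add_distrib]
        ring
      smul_left := fun x y r => by
        simp only [q, Submodule.coe_smul, inner_smul_left, map_smul, ← Finset.mul_sum]
        ring }
  have hcomm : ∀ i (x : D) (hx : (x : Fock d) ∈ g.domain),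
      c i x = backShift i (g ⟨x, hx⟩) := fun i x hx => by
    rw [hc]; exact hg.map i ⟨x, hx⟩
  let S : Submodule ℂ D := g.domain.comap D.subtype
  obtain ⟨f, hf⟩ : ∃ f : S →ₗ[ℂ] ℂ, ∀ x : S, f x = inner ℂ (basisVec 1) (g ⟨x, x.2⟩) :=
    ⟨(innerSL ℂ (basisVec 1 : Fock d)).toLinearMap ∘ₗ g.toFun ∘ₗ
      (D.subtype ∘ₗ S.subtype).codRestrict g.domain fun x => x.2, fun x => rfl⟩
  -- On the old domain the coefficient at `ξ_∅` obeys this bound, because the bound on `g` splits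
  -- along the decomposition of the Fock space.
  obtain ⟨f', hf', hfb⟩ := exists_extension_of_le_form core S f fun x => by
    change _ ≤ (q x x).re
    have h1 := hg.bound ⟨x, x.2⟩
    rw [norm_sq_decomposition] at h1
    rw [hq, hf]
    simp only [hcomm _ _ x.2]
    linarith
  -- The prescribed backward shifts `c i x` fix `G x` up to its coefficient at `ξ_∅`, which is
  -- supplied by `f'`.
  obtain ⟨G, hG⟩ : ∃ G : D →ₗ[ℂ] Fock d,
      ∀ x, G x = f' x • basisVec 1 + ∑ i, rightShift (FreeMonoid.of i) (c i x) :=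
    ⟨f'.smulRight (basisVec 1) + ∑ i, (rightShift (FreeMonoid.of i)).toLinearMap ∘ₗ c i,
      fun x => by simp⟩
  have hG1 : ∀ x, inner ℂ (basisVec 1) (G x) = f' x := by
    intro x
    rw [hG, inner_add_right, inner_smul_right, inner_sum, inner_self_eq_norm_sq_to_K,
      (orthonormal_basisVec _).1]
    simp [inner_one_rightShift]
  have hGi : ∀ i x, backShift i (G x) = c i x := by
    intro i x
    rw [hG, map_add, map_smul, backShift_basisVec_one, smul_zero, zero_add, map_sum,
      Finset.sum_eq_single i, backShift_rightShift]
    · intro j _ hj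
      exact backShift_rightShift_of_ne hj.symm _
    · simp
  have hGg : ∀ (x : D) (hx : (x : Fock d) ∈ g.domain), G x = g ⟨x, hx⟩ := by
    intro x hx
    rw [fock_decomposition (g ⟨x, hx⟩), hG]
    congr 1
    · rw [← hf ⟨x, hx⟩, ← hf' ⟨x, hx⟩]
    · exact Finset.sum_congr rfl fun i _ => by rw [hcomm i x hx]
  refine ⟨⟨D, G⟩, ⟨hle, fun x y hxy => ?_⟩, ⟨fun i x hx => hle (hD.1 hx i), fun i x => ?_,
    fun x => ?_⟩, fun x hx => hD.2 hx⟩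
  · have := hGg y (hxy ▸ x.2)
    change g x = G y
    rw [this]
    congr 1
    exact Subtype.ext hxy
  · change G _ = backShift i (G x)
    rw [hGi, hc]
    exact hGg _ (hD.1 x.2 i)
  · change ‖G x‖ ^ 2 ≤ _
    rw [norm_sq_decomposition, hG1]
    simp only [hGi]
    have := hfb x
    change _ ≤ (q x x).re at this
    rw [hq] at this
    linarith

/-- A bounded operator that commutes with the backward right shifts, defined on a subspace, has
a bounded extension to the Fock space that commutes with them. -/
theorem CommutesBackShift.exists_lift {C : ℝ} {g : Fock d →ₗ.[ℂ] Fock d}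
    (hg : CommutesBackShift C g) : ∃ Z : Fock d →L[ℂ] Fock d, (∀ x : g.domain, Z x = g x) ∧
      ∀ i x, Z (backShift i x) = backShift i (Z x) := by
  obtain ⟨m, hgm, hm⟩ := zorn_le_nonempty₀ {g : Fock d →ₗ.[ℂ] Fock d | CommutesBackShift C g}
    (fun c hcs hc y hy => by
      have hdir := hc.directedOn
      have hdom : ∀ {x}, x ∈ (LinearPMap.sSup c hdir).domain → ∃ f ∈ c, x ∈ f.domain :=
        fun {x} hx => (LinearPMap.mem_domain_sSup_iff ⟨y, hy⟩ hdir).1 hx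
      have hval : ∀ f ∈ c, ∀ (x : Fock d) (hx : x ∈ f.domain)
          (hx' : x ∈ (LinearPMap.sSup c hdir).domain),
          LinearPMap.sSup c hdir ⟨x, hx'⟩ = f ⟨x, hx⟩ := fun f hf x hx hx' =>
        ((LinearPMap.le_sSup hdir hf).2 rfl).symm
      refine ⟨LinearPMap.sSup c hdir, ⟨fun i x hx => ?_, fun i x => ?_, fun x => ?_⟩,
        fun z hz => LinearPMap.le_sSup hdir hz⟩
      · obtain ⟨f, hf, hxf⟩ := hdom hx
        exact (LinearPMap.le_sSup hdir hf).1 ((hcs hf).mem i x hxf)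
      · obtain ⟨f, hf, hxf⟩ := hdom x.2
        rw [hval f hf _ ((hcs hf).mem i x hxf), hval f hf x hxf]
        exact (hcs hf).map i ⟨x, hxf⟩
      · obtain ⟨f, hf, hxf⟩ := hdom x.2
        rw [hval f hf x hxf]
        exact (hcs hf).bound ⟨x, hxf⟩) g hg
  have hmC : CommutesBackShift C m := hm.1
  obtain ⟨m', hmm', hm', hdom⟩ := hmC.exists_extension
  have hmdom : ∀ x, (∀ i, backShift i x ∈ m.domain) → x ∈ m.domain := fun x hx =>
    (hm.2 hm' hmm').1 (hdom x hx)
  -- By maximality the domain contains every vector whose backward shifts it contains. It thus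
  -- contains `ξ_∅`, and then every `ξ_w` by appending letters, so it is dense.
  have hbasis : ∀ w, (basisVec w : Fock d) ∈ m.domain := by
    intro w
    induction w using words_induction_right with
    | one => exact hmdom _ fun i => by rw [backShift_basisVec_one]; exact m.domain.zero_mem
    | mul_of w i ih =>
      refine hmdom _ fun j => ?_
      rw [← rightShift_basisVec]
      by_cases hij : j = i
      · rw [hij, backShift_rightShift]; exact ih
      · rw [backShift_rightShift_of_ne hij]; exact m.domain.zero_mem
  have hdense : DenseRange m.domain.subtypeL := by
    have h1 : Dense (m.domain : Set (Fock d)) := by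
      rw [Submodule.dense_iff_topologicalClosure_eq_top, eq_top_iff, ← basisVec_total]
      refine Submodule.topologicalClosure_mono ?_
      rw [Submodule.span_le]
      rintro _ ⟨w, rfl⟩
      exact hbasis w
    simpa [DenseRange] using h1
  have hind : IsUniformInducing m.domain.subtypeL := isUniformEmbedding_subtype_val.isUniformInducing
  let m₁ : m.domain →L[ℂ] Fock d := m.toFun.mkContinuous |C| fun x => by
    refine le_of_sq_le_sq ?_ (by positivity)
    rw [mul_pow, sq_abs]
    exact hmC.bound x
  have hm₁ : ∀ x, m₁ x = m x := fun x => rfl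
  let Z := m₁.extend m.domain.subtypeL
  have hZ : ∀ x : m.domain, Z x = m x := fun x => m₁.extend_eq hdense hind x
  refine ⟨Z, fun x => ?_, fun i x => ?_⟩
  · rw [hZ ⟨x, hgm.1 x.2⟩]
    exact (hgm.2 rfl).symm
  · have h := hdense.equalizer (g := fun x => Z (backShift i x)) (h := fun x => backShift i (Z x))
      (Z.continuous.comp (backShift i).continuous) ((backShift i).continuous.comp Z.continuous)
      (funext fun y => ?_)
    · exact congrFun h x
    · change Z (backShift i y) = backShift i (Z y)
      rw [hZ ⟨_, hmC.mem i y y.2⟩, hZ, hmC.map]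

end Lifting

/-! ### Compressions to the coinvariant subspace of an ideal -/

namespace ClosedIdeal

variable {d : ℕ} (J : ClosedIdeal d)

theorem mem_coinv {x : Fock d} :
    x ∈ J.coinv ↔ ∀ B ∈ J.carrier, inner ℂ (B (basisVec 1)) x = 0 := by
  rw [coinv, Submodule.mem_orthogonal]
  constructor
  · intro h B hB
    exact h _ ⟨B, hB, rfl⟩
  · rintro h _ ⟨B, hB, rfl⟩
    exact h B hB

/-- Since `J` is a right ideal, `B ξ_w = (B L_w) ξ_∅` is in `J ξ_∅`; so `𝒩_J` is orthogonal to the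
full ranges of the elements of `J`. -/
theorem inner_apply_eq_zero {η : Fock d} (hη : η ∈ J.coinv) {B : Fock d →L[ℂ] Fock d}
    (hB : B ∈ J.carrier) (x : Fock d) : inner ℂ (B x) η = 0 := by
  have h : innerSL ℂ η ∘L B = 0 := by
    refine L2.hom_ext fun w => ?_
    have h1 := J.mem_coinv.1 hη _ (J.mul_mem_right _ (leftShift_mem d w) B hB)
    rw [mul_apply_eq_comp, leftShift_basisVec, mul_one] at h1
    rw [ContinuousLinearMap.comp_apply, innerSL_apply_apply, ← inner_conj_symm, h1]
    simp
  have h2 := DFunLike.congr_fun h x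
  rw [ContinuousLinearMap.comp_apply, innerSL_apply_apply] at h2
  rw [← inner_conj_symm, h2]
  simp

theorem adjoint_apply_mem_coinv {A : Fock d →L[ℂ] Fock d} (hA : A ∈ toeplitz d) {η : Fock d}
    (hη : η ∈ J.coinv) : ContinuousLinearMap.adjoint A η ∈ J.coinv := by
  rw [mem_coinv]
  intro B hB
  rw [ContinuousLinearMap.adjoint_inner_right]
  exact J.mem_coinv.1 hη _ (J.mul_mem_left A hA B hB)

/-- The elements of `J` commute with `R_i`, so `R_i B ξ_∅ = B R_i ξ_∅` is in the range of `B`. -/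
theorem backShift_mem_coinv (i : Fin d) {η : Fock d} (hη : η ∈ J.coinv) :
    backShift i η ∈ J.coinv := by
  rw [mem_coinv]
  intro B hB
  rw [inner_backShift_right,
    ← mem_rightCommutant.1 (toeplitz_le_rightCommutant (J.le hB))]
  exact J.inner_apply_eq_zero hη hB _

theorem inner_compress (A : Fock d →L[ℂ] Fock d) (x y : J.coinv) :
    inner ℂ y (J.compress A x) = inner ℂ (y : Fock d) (A x) :=
  Submodule.inner_orthogonalProjectionOnto_eq_of_mem_left y (A x)

theorem adjoint_subtypeL : ContinuousLinearMap.adjoint J.coinv.subtypeL =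
    J.coinv.orthogonalProjectionOnto := by
  ext1 x
  refine ext_inner_left ℂ fun y => ?_
  rw [ContinuousLinearMap.adjoint_inner_right]
  exact (Submodule.inner_orthogonalProjectionOnto_eq_of_mem_left y x).symm

/-- Vectors of the coinvariant subspace see only the compression of an operator in `𝓛_d`. -/
theorem inner_apply_eq_inner_compress {A : Fock d →L[ℂ] Fock d} (hA : A ∈ toeplitz d)
    (η : J.coinv) (ζ : Fock d) : inner ℂ (η : Fock d) (A ζ) =
      inner ℂ η (J.compress A (J.coinv.orthogonalProjectionOnto ζ)) := by
  rw [inner_compress, ← ContinuousLinearMap.adjoint_inner_left,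
    ← ContinuousLinearMap.adjoint_inner_left (A := A)]
  exact (Submodule.inner_orthogonalProjectionOnto_eq_of_mem_left
    ⟨_, J.adjoint_apply_mem_coinv hA η.2⟩ ζ).symm

theorem compress_eq_zero {B : Fock d →L[ℂ] Fock d} (hB : B ∈ J.carrier) : J.compress B = 0 := by
  ext1 x
  refine ext_inner_left ℂ fun y => ?_
  rw [inner_compress, ← inner_conj_symm, J.inner_apply_eq_zero y.2 hB]
  simp

/-- The kernel of the compression on `𝓛_d` is the ideal. -/
theorem mem_of_compress_eq_zero {A : Fock d →L[ℂ] Fock d} (hA : A ∈ toeplitz d)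
    (h : J.compress A = 0) : A ∈ J.carrier := by
  by_contra hcon
  have hcl : ultraweakClosure J.carrier = J.carrier :=
    le_antisymm (ultraweakClosure_le le_rfl J.isWOTClosed.isWeakStarClosed)
      (le_ultraweakClosure _)
  rw [← hcl] at hcon
  obtain ⟨p, hp, hpA⟩ := exists_pairing_separating hcon
  obtain ⟨ζ, η, h1, h2⟩ := exists_vector_functional p
  refine hpA ?_
  -- For `B ∈ J` the functional kills `B L_w`, so `B† η` is orthogonal to all `L_w ζ`, and cyclicity
  -- gives `B† η = 0`. The functional then sees `A` only through `π_J(A) = 0`.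
  have hη : η ∈ J.coinv := by
    rw [mem_coinv]
    intro B hB
    have h0 : ContinuousLinearMap.adjoint B η = 0 := by
      refine h2 _ fun w => ?_
      rw [ContinuousLinearMap.adjoint_inner_left]
      have hBw := J.mul_mem_right _ (leftShift_mem d w) B hB
      have h3 := h1 _ (toeplitz_le_rightCommutant (J.le hBw))
      rw [hp _ hBw] at h3
      exact h3.symm
    rw [← ContinuousLinearMap.adjoint_inner_right, h0, inner_zero_right]
  rw [h1 _ (toeplitz_le_rightCommutant hA)]
  refine (J.inner_apply_eq_inner_compress hA ⟨η, hη⟩ ζ).trans ?_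
  rw [h]
  simp

/-- The compression algebra is the commutant of the compressed right shifts. -/
theorem mem_compressionAlgebra_of_commute {T : J.coinv →L[ℂ] J.coinv}
    (hT : ∀ i (x y : J.coinv), inner ℂ y (T (J.compress (rightShift (FreeMonoid.of i)) x)) =
      inner ℂ (backShift i y) (T x : Fock d)) : T ∈ J.compressionAlgebra := by
  -- The commutation is turned into one with backward shifts, which leave `𝒩_J` invariant; the
  -- adjoint of a lift of `Y` is then an element of `𝓛_d` that compresses to `T`.
  set Y := ContinuousLinearMap.adjoint T with hY
  have hYb : ∀ i (y : J.coinv), (Y ⟨backShift i y, J.backShift_mem_coinv i y.2⟩ : Fock d) =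
      backShift i (Y y) := by
    intro i y
    have h : Y ⟨backShift i y, J.backShift_mem_coinv i y.2⟩ =
        ⟨backShift i (Y y), J.backShift_mem_coinv i (Y y).2⟩ := by
      refine ext_inner_right ℂ fun x => ?_
      rw [hY, ContinuousLinearMap.adjoint_inner_left]
      change inner ℂ (backShift i (y : Fock d)) (T x : Fock d) =
        inner ℂ (backShift i (Y y : Fock d)) (x : Fock d)
      rw [← hT, inner_backShift_left, ← J.inner_compress, hY,
        ContinuousLinearMap.adjoint_inner_left]
    exact congrArg Subtype.val h
  let g : Fock d →ₗ.[ℂ] Fock d := ⟨J.coinv, J.coinv.subtype ∘ₗ Y.toLinearMap⟩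
  have hg : CommutesBackShift ‖Y‖ g := by
    refine ⟨fun i x hx => J.backShift_mem_coinv i hx, fun i x => hYb i x, fun x => ?_⟩
    rw [← mul_pow]
    exact pow_le_pow_left₀ (norm_nonneg _) (Y.le_opNorm x) 2
  obtain ⟨Z, hZ, hZb⟩ := hg.exists_lift
  refine ⟨ContinuousLinearMap.adjoint Z, ?_, ?_⟩
  · rw [toeplitz_eq_rightCommutant]
    refine mem_rightCommutant_of_generators fun i x => ext_inner_left ℂ fun y => ?_
    rw [ContinuousLinearMap.adjoint_inner_right, ← inner_backShift_left, ← inner_backShift_left,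
      ← hZb, ContinuousLinearMap.adjoint_inner_right]
  · ext1 x
    refine ext_inner_left ℂ fun y => ?_
    rw [inner_compress, ContinuousLinearMap.adjoint_inner_right,
      ← ContinuousLinearMap.adjoint_inner_left]
    exact congrArg (fun z => inner ℂ z (x : Fock d)) (hZ y)

/-- As a commutant, the compression algebra is cut out by equations between functionals `T ↦ ⟪y, T
x⟫`, each of them weak* continuous. -/
theorem isWeakStarClosed_compressionAlgebra :
    IsWeakStarClosed (J.compressionAlgebra : Set (J.coinv →L[ℂ] J.coinv)) := by
  have h : (J.compressionAlgebra : Set (J.coinv →L[ℂ] J.coinv)) =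
      ⋂ (i : Fin d) (x : J.coinv) (y : J.coinv), {T | inner ℂ y
        (T (J.compress (rightShift (FreeMonoid.of i)) x)) =
          inner ℂ (⟨backShift i y, J.backShift_mem_coinv i y.2⟩ : J.coinv) (T x)} := by
    ext T
    simp only [SetLike.mem_coe, Set.mem_iInter, Set.mem_ofPred_eq]
    refine ⟨?_, J.mem_compressionAlgebra_of_commute⟩
    rintro ⟨A, hA, rfl⟩ i x y
    rw [J.inner_compress A x]
    change _ = inner ℂ (backShift i (y : Fock d)) (A x)
    rw [inner_backShift_left, ← mem_rightCommutant.1 (toeplitz_le_rightCommutant hA)]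
    exact (J.inner_apply_eq_inner_compress hA y _).symm
  rw [h]
  let := ultraweak J.coinv
  exact isClosed_iInter fun i => isClosed_iInter fun x => isClosed_iInter fun y =>
    isClosed_eq (continuous_inner_apply _ _) (continuous_inner_apply _ _)

theorem compress₂_otmul (A B : Fock d →L[ℂ] Fock d) :
    J.compress₂ (otmul A B) = otmul (J.compress A) (J.compress B) := by
  rw [compress₂, otmul_comp, otmul_comp]
  rfl

/-- The inclusion of `𝒩_J ⊗ 𝒩_J` in the tensor square of the Fock space. -/
def incl₂ : HTensor J.coinv J.coinv →L[ℂ] HTensor (Fock d) (Fock d) :=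
  otmul J.coinv.subtypeL J.coinv.subtypeL

theorem inner_compress₂ (T : HTensor (Fock d) (Fock d) →L[ℂ] HTensor (Fock d) (Fock d))
    (x y : HTensor J.coinv J.coinv) :
    inner ℂ y (J.compress₂ T x) = inner ℂ (J.incl₂ y) (T (J.incl₂ x)) := by
  have h : ContinuousLinearMap.adjoint J.incl₂ =
      otmul J.coinv.orthogonalProjectionOnto J.coinv.orthogonalProjectionOnto := by
    rw [incl₂, adjoint_otmul, adjoint_subtypeL]
  have h' := ContinuousLinearMap.adjoint_inner_right (𝕜 := ℂ) J.incl₂ y (T (J.incl₂ x))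
  rw [h] at h'
  exact h'

end ClosedIdeal

/-- Compression `T ↦ V† T V` is weak* continuous. -/
theorem continuous_ultraweak_of_inner {H K : Type*}
    [NormedAddCommGroup H] [InnerProductSpace ℂ H]
    [NormedAddCommGroup K] [InnerProductSpace ℂ K] (V : K →L[ℂ] H)
    {Φ : (H →L[ℂ] H) → (K →L[ℂ] K)}
    (hΦ : ∀ T x y, inner ℂ y (Φ T x) = inner ℂ (V y) (T (V x))) :
    Continuous[ultraweak H, ultraweak K] Φ := by
  refine continuous_ultraweak_of_pairing fun x y => ⟨(ampl ℕ V x, ampl ℕ V y), fun T => ?_⟩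
  rw [ultraweakPairing_apply, inner_ampl_eq_tsum, inner_ampl_eq_tsum]
  exact tsum_congr fun n => hΦ _ _ _

namespace ClosedIdeal

variable {d : ℕ} (J : ClosedIdeal d)

theorem continuous_compress : Continuous[ultraweak (Fock d), ultraweak J.coinv] J.compress :=
  continuous_ultraweak_of_inner J.coinv.subtypeL J.inner_compress

end ClosedIdeal

/-! ### The comultiplication of the Toeplitz algebra -/

section Comul

variable (d : ℕ)

/-- The isometry that implements the comultiplication, as an operator into an `ℓ²`-direct sum
of copies of the Fock space. -/
def twistSum : HTensor (Fock d) (Fock d) →L[ℂ] L2Sum (FreeGroup (Fin d)) (Fock d) :=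
  (sliceEquiv (Fock d) (FreeGroup (Fin d))).toContinuousLinearEquiv.toContinuousLinearMap ∘L
    twist d

theorem norm_twistSum (x : HTensor (Fock d) (Fock d)) : ‖twistSum d x‖ = ‖x‖ := by
  change ‖sliceEquiv (Fock d) (FreeGroup (Fin d)) (twist d x)‖ = ‖x‖
  rw [LinearIsometryEquiv.norm_map]
  exact ((AddMonoidHomClass.isometry_iff_norm _).1 (twist_isometry d)) x

theorem inner_comulAux (A : Fock d →L[ℂ] Fock d) (x y : HTensor (Fock d) (Fock d)) :
    inner ℂ y (comulAux d A x) = inner ℂ (twistSum d y) (ampl _ A (twistSum d x)) := by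
  change inner ℂ y (ContinuousLinearMap.adjoint (twist d) (otmul A
    (ContinuousLinearMap.id ℂ (L2 (FreeGroup (Fin d)))) (twist d x))) = _
  rw [ContinuousLinearMap.adjoint_inner_right,
    ← (sliceEquiv (Fock d) (FreeGroup (Fin d))).inner_map_map, sliceEquiv_otmul_one]
  rfl

/-- Under the slicing of `ℓ²(𝔽_d^*) ⊗ ℓ²(G)`, the operator `A ⊗ I` becomes the amplification of `A`
over the free group `G`. -/
theorem comulAux_eq_kraus : comulAux d = kraus (twistSum d) := by
  ext1 A
  ext1 x
  exact ext_inner_left ℂ fun y => by rw [inner_comulAux, inner_kraus]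

theorem continuous_comulAux : Continuous[ultraweak (Fock d),
    ultraweak (HTensor (Fock d) (Fock d))] (comulAux d) := by
  rw [comulAux_eq_kraus]
  exact continuous_kraus _

theorem comulAux_leftShift (w : Words d) :
    comulAux d (leftShift w) = otmul (leftShift w) (leftShift w) :=
  comul_leftShift d w

variable {d}

/-- A weak* continuous linear map that is multiplicative on the left shifts is multiplicative
on the Toeplitz algebra. -/
theorem map_mul_of_leftShift {K : Type*} [NormedAddCommGroup K] [InnerProductSpace ℂ K]
    [CompleteSpace K] {Φ : (Fock d →L[ℂ] Fock d) →ₗ[ℂ] (K →L[ℂ] K)}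
    (hΦ : Continuous[ultraweak (Fock d), ultraweak K] Φ)
    (h : ∀ u v, Φ (leftShift (u * v)) = Φ (leftShift u) * Φ (leftShift v))
    {A B : Fock d →L[ℂ] Fock d} (hA : A ∈ toeplitz d) (hB : B ∈ toeplitz d) :
    Φ (A * B) = Φ A * Φ B := by
  let := ultraweak (Fock d)
  let := ultraweak K
  -- Multiplication is only separately weak* continuous, so the two factors are extended from left
  -- shifts one at a time.
  have h1 : ∀ v, Φ (A * leftShift v) = Φ A * Φ (leftShift v) := by
    intro v
    refine eqOn_toeplitz (Φ := Φ ∘ₗ LinearMap.mulRight ℂ (leftShift v))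
      (Ψ := LinearMap.mulRight ℂ (Φ (leftShift v)) ∘ₗ Φ)
      (hΦ.comp (continuous_mul_right_ultraweak _)) ((continuous_mul_right_ultraweak _).comp hΦ)
      (fun u => ?_) hA
    change Φ (leftShift u * leftShift v) = Φ (leftShift u) * Φ (leftShift v)
    rw [← h, leftShift_mul]
    rfl
  exact eqOn_toeplitz (Φ := Φ ∘ₗ LinearMap.mulLeft ℂ A) (Ψ := LinearMap.mulLeft ℂ (Φ A) ∘ₗ Φ)
    (hΦ.comp (continuous_mul_left_ultraweak _)) ((continuous_mul_left_ultraweak _).comp hΦ)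
    h1 hB

theorem comulAux_mul {A B : Fock d →L[ℂ] Fock d} (hA : A ∈ toeplitz d) (hB : B ∈ toeplitz d) :
    comulAux d (A * B) = comulAux d A * comulAux d B :=
  map_mul_of_leftShift (continuous_comulAux d) (fun u v => by
    rw [comulAux_leftShift, comulAux_leftShift, comulAux_leftShift, otmul_mul, leftShift_mul]
    rfl) hA hB

end Comul

/-! ### Tensoring with the identity -/

section TensorKraus

variable {κ H K E : Type*} [NormedAddCommGroup H] [InnerProductSpace ℂ H]
  [NormedAddCommGroup K] [InnerProductSpace ℂ K] [NormedAddCommGroup E] [InnerProductSpace ℂ E]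

/-- The components of an operator into an `ℓ²`-direct sum. -/
def component (V : K →L[ℂ] L2Sum κ H) (k : κ) : K →L[ℂ] H :=
  lp.evalCLM ℂ (fun _ : κ => H) 2 k ∘L V

theorem sum_norm_sq_component_le (V : K →L[ℂ] L2Sum κ H) (F : Finset κ) (x : K) :
    ∑ k ∈ F, ‖component V k x‖ ^ 2 ≤ ‖V‖ ^ 2 * ‖x‖ ^ 2 := by
  calc _ ≤ ∑' k, ‖V x k‖ ^ 2 :=
        (L2Sum.summable_norm_sq (V x)).sum_le_tsum F fun _ _ => by positivity
    _ = ‖V x‖ ^ 2 := (L2Sum.norm_sq_eq_tsum _).symm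
    _ ≤ (‖V‖ * ‖x‖) ^ 2 := by gcongr; exact V.le_opNorm x
    _ = _ := mul_pow _ _ _

variable [CompleteSpace H] [CompleteSpace K] [CompleteSpace E]

/-- The operator `1 ⊗ V`. -/
def oneTensor (E : Type*) [NormedAddCommGroup E] [InnerProductSpace ℂ E] [CompleteSpace E]
    (V : K →L[ℂ] L2Sum κ H) : HTensor E K →L[ℂ] L2Sum κ (HTensor E H) :=
  ofComponents (fun k => otmul (1 : E →L[ℂ] E) (component V k)) ‖V‖
    fun F => sum_norm_sq_one_otmul_le F (sum_norm_sq_component_le V F)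

/-- The operator `V ⊗ 1`. -/
def tensorOne (E : Type*) [NormedAddCommGroup E] [InnerProductSpace ℂ E] [CompleteSpace E]
    (V : K →L[ℂ] L2Sum κ H) : HTensor K E →L[ℂ] L2Sum κ (HTensor H E) :=
  ofComponents (fun k => otmul (component V k) (1 : E →L[ℂ] E)) ‖V‖
    fun F => sum_norm_sq_otmul_one_le F (sum_norm_sq_component_le V F)

theorem oneTensor_vtmul (V : K →L[ℂ] L2Sum κ H) (x : E) (y : K) (k : κ) :
    oneTensor E V (vtmul x y) k = vtmul x (V y k) := by
  rw [oneTensor, ofComponents_apply, otmul_vtmul]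
  rfl

theorem tensorOne_vtmul (V : K →L[ℂ] L2Sum κ H) (x : E) (y : K) (k : κ) :
    tensorOne E V (vtmul y x) k = vtmul (V y k) x := by
  rw [tensorOne, ofComponents_apply, otmul_vtmul]
  rfl

/-- Tensoring `b ↦ V† (b ⊗ 1) V` with the identity gives a map of the same form, implemented by `1 ⊗
V`. It is therefore defined and weak* continuous on all of `B(E ⊗ H)`, and supplies the extension
`id ⊗ Δ` needed for coassociativity. -/
theorem kraus_oneTensor_otmul (V : K →L[ℂ] L2Sum κ H) (a : E →L[ℂ] E) (b : H →L[ℂ] H) :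
    kraus (oneTensor E V) (otmul a b) = otmul a (kraus V b) :=
  tensor_op_ext fun x x' y y' => by
    rw [inner_kraus, otmul_vtmul, inner_vtmul, inner_kraus, inner_ampl_eq_tsum,
      inner_ampl_eq_tsum, ← tsum_mul_left]
    refine tsum_congr fun k => ?_
    rw [oneTensor_vtmul, oneTensor_vtmul, otmul_vtmul, inner_vtmul]

theorem kraus_tensorOne_otmul (V : K →L[ℂ] L2Sum κ H) (a : E →L[ℂ] E) (b : H →L[ℂ] H) :
    kraus (tensorOne E V) (otmul b a) = otmul (kraus V b) a :=
  tensor_op_ext fun x x' y y' => by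
    rw [inner_kraus, otmul_vtmul, inner_vtmul, inner_kraus, inner_ampl_eq_tsum,
      inner_ampl_eq_tsum, ← tsum_mul_right]
    refine tsum_congr fun k => ?_
    rw [tensorOne_vtmul, tensorOne_vtmul, otmul_vtmul, inner_vtmul]

end TensorKraus

/-! ### Comultiplications on quotients of the Toeplitz algebra -/

section Quotient

variable {d : ℕ} {N : Type*} [NormedAddCommGroup N] [InnerProductSpace ℂ N] [CompleteSpace N]
  {p : (Fock d →L[ℂ] Fock d) →ₗ[ℂ] (N →L[ℂ] N)} {ι : Type*}
  {Z : HTensor N N →L[ℂ] L2Sum ι N}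

theorem continuous_kraus_comp (hp : Continuous[ultraweak (Fock d), ultraweak N] p) :
    Continuous[ultraweak (Fock d), ultraweak (HTensor N N)] (kraus Z ∘ₗ p) := by
  let := ultraweak (Fock d)
  let := ultraweak N
  let := ultraweak (HTensor N N)
  exact (continuous_kraus Z).comp hp

/-- Both sides are weak* continuous in `A`, and at `A = L_w` both are the matrix coefficient of `S_w
⊗ S_w ⊗ S_w`, a product of three inner products. -/
theorem coassoc_kraus (hp : Continuous[ultraweak (Fock d), ultraweak N] p)
    (hZ : ∀ w, kraus Z (p (leftShift w)) = otmul (p (leftShift w)) (p (leftShift w)))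
    {A : Fock d →L[ℂ] Fock d} (hA : A ∈ toeplitz d) (x₁ x₂ x₃ y₁ y₂ y₃ : N) :
    inner ℂ (vtmul y₁ (vtmul y₂ y₃))
        (kraus (oneTensor N Z) (kraus Z (p A)) (vtmul x₁ (vtmul x₂ x₃))) =
      inner ℂ (vtmul (vtmul y₁ y₂) y₃)
        (kraus (tensorOne N Z) (kraus Z (p A)) (vtmul (vtmul x₁ x₂) x₃)) := by
  let f : (Fock d →L[ℂ] Fock d) →ₗ[ℂ] ℂ :=
    (innerSL ℂ (vtmul y₁ (vtmul y₂ y₃))).toLinearMap ∘ₗ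
      (ContinuousLinearMap.apply ℂ _ (vtmul x₁ (vtmul x₂ x₃))).toLinearMap ∘ₗ
        kraus (oneTensor N Z) ∘ₗ kraus Z ∘ₗ p
  let g : (Fock d →L[ℂ] Fock d) →ₗ[ℂ] ℂ :=
    (innerSL ℂ (vtmul (vtmul y₁ y₂) y₃)).toLinearMap ∘ₗ
      (ContinuousLinearMap.apply ℂ _ (vtmul (vtmul x₁ x₂) x₃)).toLinearMap ∘ₗ
        kraus (tensorOne N Z) ∘ₗ kraus Z ∘ₗ p
  have hc : IsWeakStarClosed (LinearMap.eqLocus f g : Set (Fock d →L[ℂ] Fock d)) := by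
    let := ultraweak (Fock d)
    let := ultraweak (HTensor N N)
    refine isClosed_eq ?_ ?_
    · let := ultraweak (HTensor N (HTensor N N))
      exact (continuous_inner_apply _ _).comp ((continuous_kraus (oneTensor N Z)).comp
        (continuous_kraus_comp hp))
    · let := ultraweak (HTensor (HTensor N N) N)
      exact (continuous_inner_apply _ _).comp ((continuous_kraus (tensorOne N Z)).comp
        (continuous_kraus_comp hp))
  refine toeplitz_le_of_leftShift_mem hc (fun w => ?_) hA
  change inner ℂ (vtmul y₁ (vtmul y₂ y₃)) (kraus (oneTensor N Z)
      (kraus Z (p (leftShift w))) (vtmul x₁ (vtmul x₂ x₃))) =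
    inner ℂ (vtmul (vtmul y₁ y₂) y₃) (kraus (tensorOne N Z)
      (kraus Z (p (leftShift w))) (vtmul (vtmul x₁ x₂) x₃))
  rw [hZ, kraus_oneTensor_otmul, kraus_tensorOne_otmul, hZ]
  simp only [otmul_vtmul, inner_vtmul, mul_assoc]

theorem isWeakStarContinuous_kraus_domRestrict {κ H K : Type*}
    [NormedAddCommGroup H] [InnerProductSpace ℂ H] [CompleteSpace H]
    [NormedAddCommGroup K] [InnerProductSpace ℂ K] [CompleteSpace K]
    (V : K →L[ℂ] L2Sum κ H) (S : Submodule ℂ (H →L[ℂ] H)) :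
    IsWeakStarContinuous ((kraus V).domRestrict S) := by
  let := ultraweak H
  let := ultraweak K
  exact (continuous_kraus V).comp continuous_induced_dom

theorem isCoassociative_of_eq_kraus (hp : Continuous[ultraweak (Fock d), ultraweak N] p)
    (hZ : ∀ w, kraus Z (p (leftShift w)) = otmul (p (leftShift w)) (p (leftShift w)))
    {𝒜 : Subalgebra ℂ (N →L[ℂ] N)} (h𝒜 : ∀ a, a ∈ 𝒜 ↔ ∃ A ∈ toeplitz d, p A = a)
    {Δ : 𝒜 →ₐ[ℂ] (HTensor N N →L[ℂ] HTensor N N)}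
    (hmem : ∀ a, Δ a ∈ normalTensor (Subalgebra.toSubmodule 𝒜) (Subalgebra.toSubmodule 𝒜))
    (hΔ : ∀ a, Δ a = kraus Z (a : N →L[ℂ] N)) : IsCoassociative 𝒜 Δ hmem := by
  refine ⟨(kraus (oneTensor N Z)).domRestrict _, (kraus (tensorOne N Z)).domRestrict _,
    isWeakStarContinuous_kraus_domRestrict _ _, isWeakStarContinuous_kraus_domRestrict _ _,
    fun a b => ?_, fun a b => ?_, ?_⟩
  · rw [LinearMap.domRestrict_apply, kraus_oneTensor_otmul, hΔ]
  · rw [LinearMap.domRestrict_apply, kraus_tensorOne_otmul, hΔ]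
  · rintro ⟨a, ha⟩ x₁ x₂ x₃ y₁ y₂ y₃
    obtain ⟨A, hA, rfl⟩ := (h𝒜 a).1 ha
    simp only [LinearMap.domRestrict_apply, hΔ]
    exact coassoc_kraus hp hZ hA x₁ x₂ x₃ y₁ y₂ y₃

/-- A weak* closed homomorphic image of the Toeplitz algebra is a Hopf dual algebra if
`S_w ↦ S_w ⊗ S_w` is implemented by a contraction `Z`, as `a ↦ Z† (a ⊗ 1) Z`. -/
theorem exists_isHopfDualAlgebra (hp : Continuous[ultraweak (Fock d), ultraweak N] p)
    (hp1 : p 1 = 1) (hpm : ∀ A ∈ toeplitz d, ∀ B, p (A * B) = p A * p B)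
    (hZ1 : ‖Z‖ ≤ 1)
    (hZ : ∀ w, kraus Z (p (leftShift w)) = otmul (p (leftShift w)) (p (leftShift w)))
    {𝒜 : Subalgebra ℂ (N →L[ℂ] N)} (h𝒜 : ∀ a, a ∈ 𝒜 ↔ ∃ A ∈ toeplitz d, p A = a)
    (hcl : IsWeakStarClosed (𝒜 : Set (N →L[ℂ] N))) :
    ∃ Δ : 𝒜 →ₐ[ℂ] (HTensor N N →L[ℂ] HTensor N N), IsHopfDualAlgebra 𝒜 Δ ∧
      ∀ a, Δ a = kraus Z (a : N →L[ℂ] N) := by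
  obtain ⟨Δ, hΔ⟩ : ∃ Δ : 𝒜 →ₐ[ℂ] (HTensor N N →L[ℂ] HTensor N N),
      ∀ a, Δ a = kraus Z (a : N →L[ℂ] N) := ⟨
    AlgHom.ofLinearMap (kraus Z ∘ₗ 𝒜.val.toLinearMap)
    (by
      change kraus Z 1 = 1
      -- The empty word encodes unitality: `L_∅ = 1`.
      have h := hZ 1
      rwa [leftShift_one, hp1, otmul_one_one] at h)
    (by
      rintro ⟨a, ha⟩ ⟨b, hb⟩
      obtain ⟨A, hA, rfl⟩ := (h𝒜 a).1 ha
      obtain ⟨B, hB, rfl⟩ := (h𝒜 b).1 hb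
      change kraus Z (p A * p B) = kraus Z (p A) * kraus Z (p B)
      rw [← hpm A hA]
      refine map_mul_of_leftShift (Φ := kraus Z ∘ₗ p) (continuous_kraus_comp hp)
        (fun u v => ?_) hA hB
      simp only [LinearMap.comp_apply]
      rw [hZ, hZ, hZ, otmul_mul, ← hpm _ (leftShift_mem d u), leftShift_mul]
      rfl), fun _ => rfl⟩
  have hmem : ∀ a, Δ a ∈ normalTensor (Subalgebra.toSubmodule 𝒜)
      (Subalgebra.toSubmodule 𝒜) := by
    rintro ⟨a, ha⟩
    obtain ⟨A, hA, rfl⟩ := (h𝒜 a).1 ha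
    rw [hΔ]
    refine toeplitz_le_of_leftShift_mem (isWeakStarClosed_comap
      (isWeakStarClosed_ultraweakClosure _) (continuous_kraus_comp (Z := Z) hp)) (fun w => ?_) hA
    rw [Submodule.mem_comap, LinearMap.comp_apply, hZ]
    have hw : p (leftShift w) ∈ 𝒜 := (h𝒜 _).2 ⟨_, leftShift_mem d w, rfl⟩
    exact otmul_mem_normalTensor hw hw
  refine ⟨Δ, ⟨hcl, hmem, ?_, ?_, ?_⟩, hΔ⟩
  · have h : (Δ : 𝒜 → _) = fun a : 𝒜 => kraus Z (a : N →L[ℂ] N) := funext hΔ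
    let := ultraweak N
    let := ultraweak (HTensor N N)
    rw [h]
    exact (continuous_kraus Z).comp continuous_induced_dom
  · intro n a
    simp only [hΔ]
    exact norm_opMatrix_kraus_le Z hZ1 _
  · exact isCoassociative_of_eq_kraus hp hZ h𝒜 hmem hΔ

/-- Let `p` be the compression to a subspace `N` of the Fock space that is coinvariant for the
Toeplitz algebra, and contains the vectors orthogonal to `J ξ_∅`. If the compression of `Δ(J)`
to `N ⊗ N` vanishes, then that of `Δ(A)` is `Z† (p(A) ⊗ 1) Z` for a contraction `Z`. -/
theorem exists_kraus (J : ClosedIdeal d) (j : N →L[ℂ] Fock d) (P : Fock d →L[ℂ] N)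
    (hj : ‖j‖ ≤ 1) (hP : ‖P‖ ≤ 1)
    (hjP : ∀ y, (∀ B ∈ J.carrier, inner ℂ (B (basisVec 1)) y = 0) → j (P y) = y)
    (hpA : ∀ A ∈ toeplitz d, ∀ η ζ, inner ℂ (j η) (A ζ) = inner ℂ η (p A (P ζ)))
    (hJ : ∀ B ∈ J.carrier, ∀ x y : HTensor N N,
      inner ℂ (otmul j j y) (comulAux d B (otmul j j x)) = 0) :
    ∃ (ι : Type) (Z : HTensor N N →L[ℂ] L2Sum ι N), ‖Z‖ ≤ 1 ∧
      ∀ A ∈ toeplitz d, ∀ x y, inner ℂ y (kraus Z (p A) x) =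
        inner ℂ (otmul j j y) (comulAux d A (otmul j j x)) := by
  classical
  set V := twistSum d ∘L otmul j j with hV
  have hVin : ∀ (A : Fock d →L[ℂ] Fock d) x y, inner ℂ (V y) (ampl _ A (V x)) =
      inner ℂ (otmul j j y) (comulAux d A (otmul j j x)) := by
    intro A x y
    rw [inner_comulAux]
    rfl
  -- `M` is the invariant subspace generated by the range of `V`. As `J` is a right ideal, vanishing
  -- of the compressions of `Δ(B)` extends to `(B ⊗ 1) M ⟂ V y` for `B ∈ J`.
  set M := (Submodule.span ℂ {z | ∃ (w : Words d) (x : HTensor N N),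
    z = ampl (FreeGroup (Fin d)) (leftShift w) (V x)}).topologicalClosure with hMdef
  have hMc : IsClosed (M : Set (L2Sum (FreeGroup (Fin d)) (Fock d))) :=
    Submodule.isClosed_topologicalClosure _
  have hM : ∀ w : Words d, ∀ z ∈ M, ampl _ (leftShift w) z ∈ M := by
    intro w z hz
    have : M ≤ M.comap (ampl (FreeGroup (Fin d)) (leftShift w)).toLinearMap := by
      refine Submodule.topologicalClosure_minimal _ ?_
        (hMc.preimage (ampl (FreeGroup (Fin d)) (leftShift w)).continuous)
      rw [Submodule.span_le]
      rintro _ ⟨v, x, rfl⟩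
      change ampl _ (leftShift w) (ampl _ (leftShift v) (V x)) ∈ M
      rw [← ampl_leftShift_mul]
      exact Submodule.le_topologicalClosure _ (Submodule.subset_span ⟨_, x, rfl⟩)
    exact this hz
  have hVM : ∀ x, V x ∈ M := fun x => Submodule.le_topologicalClosure _
    (Submodule.subset_span ⟨1, x, (ampl_leftShift_one _).symm⟩)
  have hMJ : ∀ B ∈ J.carrier, ∀ y, ∀ m ∈ M, inner ℂ (V y) (ampl _ B m) = 0 := by
    intro B hB y m hm
    have h1 : M ≤ LinearMap.ker (innerSL ℂ (V y) ∘L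
        ampl (FreeGroup (Fin d)) B).toLinearMap := by
      refine Submodule.topologicalClosure_minimal _ ?_
        (ContinuousLinearMap.isClosed_ker (innerSL ℂ (V y) ∘L ampl (FreeGroup (Fin d)) B))
      rw [Submodule.span_le]
      rintro _ ⟨w, x, rfl⟩
      change inner ℂ (V y) (ampl _ B (ampl _ (leftShift w) (V x))) = 0
      exact (hVin (B * leftShift w) x y).trans
        (hJ _ (J.mul_mem_right _ (leftShift_mem d w) B hB) x y)
    exact h1 hm
  obtain ⟨ι, Θ, hΘL, hΘM⟩ := exists_intertwiner hMc hM
  set Θ' := Θ.toContinuousLinearMap with hΘ'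
  have hΘA : ∀ A ∈ toeplitz d, ∀ x, Θ' (ampl ι A x) = ampl _ A (Θ' x) := fun A hA x =>
    intertwines_rightCommutant hΘL (toeplitz_le_rightCommutant hA) x
  have hΘΘ : ∀ x, ContinuousLinearMap.adjoint Θ' (Θ' x) = x := fun x =>
    DFunLike.congr_fun ((ContinuousLinearMap.isometry_iff_adjoint_comp_self Θ').1 Θ.isometry) x
  set Z₀ := ContinuousLinearMap.adjoint Θ' ∘L V with hZ₀
  have hΘZ : ∀ x, Θ' (Z₀ x) = V x := by
    intro x
    obtain ⟨z, hz⟩ := (hΘM _).1 (hVM x)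
    change Θ' (ContinuousLinearMap.adjoint Θ' (V x)) = V x
    rw [← hz]
    exact congrArg Θ' (hΘΘ z)
  have hZin : ∀ (y : HTensor N N) u, inner ℂ (Z₀ y) u = inner ℂ (V y) (Θ' u) :=
    fun y u => ContinuousLinearMap.adjoint_inner_left Θ' u (V y)
  -- The central point: after transport by `Θ†`, each component of `V y` is orthogonal to `J ξ_∅`,
  -- so it lies in the coinvariant subspace and the projection loses nothing.
  have hZN : ∀ y i, j (P (Z₀ y i)) = Z₀ y i := by
    intro y i
    refine hjP _ fun B hB => ?_
    have h1 : inner ℂ (Z₀ y) (lp.single 2 i (B (basisVec 1))) = 0 := by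
      rw [← ampl_single, hZin, hΘA B (J.le hB)]
      exact hMJ B hB y _ ((hΘM _).2 ⟨_, rfl⟩)
    rw [lp.inner_single_right] at h1
    rw [← inner_conj_symm, h1, map_zero]
  have hjj : ‖otmul j j‖ ≤ 1 := (norm_otmul_le j j).trans
    (mul_le_one₀ hj (norm_nonneg j) hj)
  have hZ₀n : ∀ x, ‖Z₀ x‖ ≤ ‖x‖ := by
    intro x
    calc ‖Z₀ x‖ = ‖Θ (Z₀ x)‖ := (Θ.norm_map _).symm
      _ = ‖V x‖ := congrArg norm (hΘZ x)
      _ = ‖otmul j j x‖ := norm_twistSum d _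
      _ ≤ 1 * ‖x‖ := (otmul j j).le_of_opNorm_le hjj x
      _ = ‖x‖ := one_mul _
  refine ⟨ι, ampl ι P ∘L Z₀, ?_, fun A hA x y => ?_⟩
  · refine ContinuousLinearMap.opNorm_le_bound _ zero_le_one fun x => ?_
    calc _ ≤ 1 * ‖Z₀ x‖ := ContinuousLinearMap.le_of_opNorm_le _
          ((norm_ampl_le _).trans hP) _
      _ ≤ _ := by gcongr; exact hZ₀n x
  -- `V x = Θ Z₀ x`, and `Θ` intertwines the amplifications of `A`; what remains is a sum over
  -- components, where `hpA` replaces `A` by `p A`.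
  · rw [inner_kraus, ← hVin, ← hΘZ x, ← hΘA A hA, ← hZin, inner_ampl_eq_tsum,
      inner_ampl_eq_tsum]
    refine tsum_congr fun i => ?_
    change inner ℂ (P (Z₀ y i)) (p A (P (Z₀ x i))) = _
    rw [← hpA A hA, hZN]

end Quotient

/-! ### The comultiplication of the compression algebra of a Hopf ideal -/

section Inner

variable {H K : Type*} [NormedAddCommGroup H] [InnerProductSpace ℂ H]
  [NormedAddCommGroup K] [InnerProductSpace ℂ K]

theorem op_ext_inner {S T : H →L[ℂ] H} (h : ∀ x y, inner ℂ y (S x) = inner ℂ y (T x)) : S = T :=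
  ContinuousLinearMap.ext fun x => ext_inner_left ℂ fun y => h x y

theorem isWeakStarClosed_ker_inner (x y : H) :
    IsWeakStarClosed (LinearMap.ker ((innerSL ℂ y).toLinearMap ∘ₗ
      (ContinuousLinearMap.apply ℂ H x).toLinearMap) : Set (H →L[ℂ] H)) := by
  let := ultraweak H
  exact isClosed_eq (continuous_inner_apply x y) continuous_const

theorem inner_otmul_zero_left (c : K →L[ℂ] K) (x y : HTensor H K) :
    inner ℂ y (otmul (0 : H →L[ℂ] H) c x) = 0 := by
  rw [otmul_zero_left, zero_apply, inner_zero_right]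

theorem inner_otmul_zero_right (b : H →L[ℂ] H) (x y : HTensor H K) :
    inner ℂ y (otmul b (0 : K →L[ℂ] K) x) = 0 := by
  rw [otmul_zero_right, zero_apply, inner_zero_right]

end Inner

namespace ClosedIdeal

variable {d : ℕ} {J : ClosedIdeal d}

/-- An elementary tensor with a factor in `J` compresses to zero on `𝒩_J ⊗ 𝒩_J`. Matrix coefficients
are weak* continuous, so they vanish on the closed span, where the coideal condition places `Δ(B)`.
-/
theorem IsHopfIdeal.inner_comulAux_eq_zero (hJ : J.IsHopfIdeal) {B : Fock d →L[ℂ] Fock d}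
    (hB : B ∈ J.carrier) (x y : HTensor J.coinv J.coinv) :
    inner ℂ (J.incl₂ y) (comulAux d B (J.incl₂ x)) = 0 := by
  have h1 := hJ.map_mem ⟨B, J.le hB⟩ hB
  have h2 := ultraweakClosure_le ?_ (isWeakStarClosed_ker_inner (J.incl₂ x) (J.incl₂ y)) h1
  · exact h2
  refine sup_le ?_ ?_ <;> rw [Submodule.span_le]
  · rintro _ ⟨b, hb, c, -, rfl⟩
    change inner ℂ (J.incl₂ y) (otmul b c (J.incl₂ x)) = 0
    rw [← inner_compress₂, compress₂_otmul, J.compress_eq_zero hb]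
    exact inner_otmul_zero_left (H := J.coinv) (K := J.coinv) _ _ _
  · rintro _ ⟨c, -, b, hb, rfl⟩
    change inner ℂ (J.incl₂ y) (otmul c b (J.incl₂ x)) = 0
    rw [← inner_compress₂, compress₂_otmul, J.compress_eq_zero hb]
    exact inner_otmul_zero_right (H := J.coinv) (K := J.coinv) _ _ _

theorem compress_one : J.compress 1 = 1 := by
  ext x
  simp [compress]

/-- For a Hopf ideal, `(π_J ⊗ π_J) ∘ Δ` factors through the compression, as
`π_J(A) ↦ Z† (π_J(A) ⊗ 1) Z` for a contraction `Z`. -/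
theorem IsHopfIdeal.exists_kraus_compress (hJ : J.IsHopfIdeal) :
    ∃ (ι : Type) (Z : HTensor J.coinv J.coinv →L[ℂ] L2Sum ι J.coinv), ‖Z‖ ≤ 1 ∧
      ∀ A ∈ toeplitz d, kraus (K := HTensor J.coinv J.coinv) Z (J.compress A) =
        J.compress₂ (comulAux d A) := by
  obtain ⟨ι, Z, hZ1, hZ⟩ := exists_kraus (N := J.coinv) (p := J.compress) J J.coinv.subtypeL
    J.coinv.orthogonalProjectionOnto (Submodule.norm_subtypeL_le _)
    (Submodule.orthogonalProjectionOnto_norm_le _)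
    (fun y hy => congrArg Subtype.val (Submodule.orthogonalProjectionOnto_mem_subspace_eq_self
      (⟨y, J.mem_coinv.2 hy⟩ : J.coinv)))
    (fun A hA => J.inner_apply_eq_inner_compress hA) (fun B hB => hJ.inner_comulAux_eq_zero hB)
  exact ⟨ι, Z, hZ1, fun A hA => op_ext_inner (H := HTensor J.coinv J.coinv) fun x y =>
    (hZ A hA x y).trans (J.inner_compress₂ _ x y).symm⟩

theorem exists_isHopfDualAlgebra_compress {ι : Type}
    {Z : HTensor J.coinv J.coinv →L[ℂ] L2Sum ι J.coinv} (hZ1 : ‖Z‖ ≤ 1)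
    (hZ : ∀ w : Words d, kraus (K := HTensor J.coinv J.coinv) Z (J.compress (leftShift w)) =
      otmul (J.compress (leftShift w)) (J.compress (leftShift w))) :
    ∃ Δ : J.compressionAlgebra →ₐ[ℂ]
        (HTensor J.coinv J.coinv →L[ℂ] HTensor J.coinv J.coinv),
      IsHopfDualAlgebra J.compressionAlgebra Δ ∧
      ∀ A : toeplitz d, Δ (J.proj A) = kraus (K := HTensor J.coinv J.coinv) Z (J.compress A) := by
  obtain ⟨Δ, hΔ, hΔZ⟩ := exists_isHopfDualAlgebra (N := J.coinv) (p := J.compress)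
    J.continuous_compress compress_one (fun A hA => J.compress_mul hA) hZ1 hZ
    (𝒜 := J.compressionAlgebra) (fun _ => Iff.rfl) J.isWeakStarClosed_compressionAlgebra
  exact ⟨Δ, hΔ, fun A => hΔZ (J.proj A)⟩

theorem kraus_compress_leftShift {ι : Type}
    {Z : HTensor J.coinv J.coinv →L[ℂ] L2Sum ι J.coinv}
    (hZ : ∀ A ∈ toeplitz d, kraus (K := HTensor J.coinv J.coinv) Z (J.compress A) =
        J.compress₂ (comulAux d A)) (w : Words d) :
    kraus (K := HTensor J.coinv J.coinv) Z (J.compress (leftShift w)) =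
      otmul (J.compress (leftShift w)) (J.compress (leftShift w)) := by
  rw [hZ _ (leftShift_mem d w), comulAux_leftShift, compress₂_otmul]

theorem IsHopfIdeal.exists_comultiplication (hJ : J.IsHopfIdeal) :
    ∃ Δ : J.compressionAlgebra →ₐ[ℂ]
        (HTensor J.coinv J.coinv →L[ℂ] HTensor J.coinv J.coinv),
      IsHopfDualAlgebra J.compressionAlgebra Δ ∧
      (∀ w : Words d, Δ (J.gen w) =
        otmul (J.gen w : J.coinv →L[ℂ] J.coinv) (J.gen w : J.coinv →L[ℂ] J.coinv)) ∧
      ∀ A : toeplitz d, Δ (J.proj A) = J.compress₂ (comul d A) := by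
  obtain ⟨ι, Z, hZ1, hZA⟩ := hJ.exists_kraus_compress
  have hZw := kraus_compress_leftShift hZA
  obtain ⟨Δ, hΔ, hΔZ⟩ := exists_isHopfDualAlgebra_compress hZ1 hZw
  exact ⟨Δ, hΔ, fun w => (hΔZ ⟨leftShift w, leftShift_mem d w⟩).trans (hZw w),
    fun A => (hΔZ A).trans (hZA A A.2)⟩

end ClosedIdeal

/-! ### Algebraic tensor products of operators -/

section AlgebraicTensor

variable {H K : Type*} [NormedAddCommGroup H] [InnerProductSpace ℂ H]
  [NormedAddCommGroup K] [InnerProductSpace ℂ K]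

/-- The canonical map from the algebraic tensor product `B(H) ⊗ B(K)` to `B(H ⊗ K)` is
injective. -/
theorem eq_zero_of_lift_otmul_eq_zero {t : (H →L[ℂ] H) ⊗[ℂ] (K →L[ℂ] K)}
    (ht : TensorProduct.lift (otmulₗ H K H K) t = 0) : t = 0 := by
  obtain ⟨c, rfl⟩ := TensorProduct.eq_repr_basis_right (Module.Basis.ofVectorSpace ℂ (K →L[ℂ] K)) t
  set b := Module.Basis.ofVectorSpace ℂ (K →L[ℂ] K) with hb
  suffices hc : c = 0 by simp [hc]
  ext1 i
  refine op_ext_inner fun x x' => ?_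
  -- Slicing the first factor by the functional `⟪x', · x⟫` leaves a linear relation among basis
  -- elements of `B(K)`.
  have h1 : ∑ i ∈ c.support, (inner ℂ x' (c i x)) • b i = 0 := by
    refine op_ext_inner fun y y' => ?_
    have h2 := congrArg (fun T : HTensor H K →L[ℂ] HTensor H K =>
      inner ℂ (vtmul x' y') (T (vtmul x y))) ht
    simp only [Finsupp.sum, map_sum, TensorProduct.lift.tmul, otmulₗ_apply, sum_apply,
      inner_sum, otmul_vtmul, inner_vtmul, zero_apply, inner_zero_right] at h2
    simpa only [sum_apply, inner_sum, smul_apply, inner_smul_right, zero_apply,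
      inner_zero_right] using h2
  by_cases hi : i ∈ c.support
  · rw [linearIndependent_iff'.1 b.linearIndependent _ _ h1 i hi]
    simp
  · rw [Finsupp.notMem_support_iff.1 hi]
    simp

theorem otmul_sub_otmul (A B : H →L[ℂ] H) (C D : K →L[ℂ] K) :
    otmul A C - otmul B D = otmul (A - B) C + otmul B (C - D) := by
  simp only [← otmulₗ_apply, map_sub, LinearMap.sub_apply]
  abel

end AlgebraicTensor

/-- A linear map on a submodule of a vector space has a generalized inverse. -/
theorem exists_generalized_inverse {E F : Type*} [AddCommGroup E] [Module ℂ E]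
    [AddCommGroup F] [Module ℂ F] (p : E →ₗ[ℂ] F) (S : Submodule ℂ E) :
    ∃ s : F →ₗ[ℂ] E, (∀ z, s z ∈ S) ∧ ∀ x ∈ S, p (s (p x)) = p x := by
  -- A purely algebraic section; no continuity is needed because it is applied to algebraic tensors
  -- only.
  obtain ⟨r, hr⟩ := (p.domRestrict S).rangeRestrict.exists_rightInverse_of_surjective
    (LinearMap.range_rangeRestrict _)
  obtain ⟨g, hg⟩ := LinearMap.exists_extend r
  refine ⟨S.subtype ∘ₗ g, fun z => (g z).2, fun x hx => ?_⟩
  have h1 := DFunLike.congr_fun hr ((p.domRestrict S).rangeRestrict ⟨x, hx⟩)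
  have h2 := DFunLike.congr_fun hg ((p.domRestrict S).rangeRestrict ⟨x, hx⟩)
  have h3 := congrArg Subtype.val h1
  simp only [LinearMap.comp_apply] at h2 h3
  rw [← h2] at h3
  exact h3

/-- All three relations are linear in the triple formed by the vector, `a` and `t`, so they pass
from the generators to their span. In the application `a` represents `π_J(A)` and `t` is the
algebraic tensor `∑ c_w S_w ⊗ S_w` for `A = ∑ c_w L_w`. -/
theorem exists_of_mem_span {ι V W X Y B C : Type*} [AddCommGroup V] [Module ℂ V]
    [AddCommGroup W] [Module ℂ W] [AddCommGroup X] [Module ℂ X] [AddCommGroup Y] [Module ℂ Y]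
    [AddCommGroup B] [Module ℂ B] [AddCommGroup C] [Module ℂ C] {i : C →ₗ[ℂ] B} {p : V →ₗ[ℂ] B}
    {Δ : C →ₗ[ℂ] Y} {F : X →ₗ[ℂ] Y} {P : V →ₗ[ℂ] W} {G : X →ₗ[ℂ] W} {Q : Submodule ℂ W}
    {v : ι → V} (h : ∀ w, ∃ a t, i a = p (v w) ∧ Δ a = F t ∧ P (v w) - G t ∈ Q) {A : V}
    (hA : A ∈ Submodule.span ℂ (Set.range v)) :
    ∃ a t, i a = p A ∧ Δ a = F t ∧ P A - G t ∈ Q := by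
  induction hA using Submodule.span_induction with
  | mem A hA =>
    obtain ⟨w, rfl⟩ := hA
    exact h w
  | zero => exact ⟨0, 0, by simp, by simp, by simp⟩
  | add A B _ _ ihA ihB =>
    obtain ⟨a, t, ha, h1, h2⟩ := ihA
    obtain ⟨b, u, hb, h3, h4⟩ := ihB
    refine ⟨a + b, t + u, by rw [map_add, map_add, ha, hb], by rw [map_add, map_add, h1, h3], ?_⟩
    rw [map_add, map_add, add_sub_add_comm]
    exact add_mem h2 h4
  | smul c A _ ihA =>
    obtain ⟨a, t, ha, h1, h2⟩ := ihA
    refine ⟨c • a, c • t, by rw [map_smul, map_smul, ha], by rw [map_smul, map_smul, h1], ?_⟩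
    rw [map_smul, map_smul, ← smul_sub]
    exact Q.smul_mem c h2

/-! ### Comultiplication of polynomials in the kernel of a quotient map. -/

section Polynomials

variable {d : ℕ} {N : Type*} [NormedAddCommGroup N] [InnerProductSpace ℂ N]
  {p : (Fock d →L[ℂ] Fock d) →ₗ[ℂ] (N →L[ℂ] N)} {𝒜 : Subalgebra ℂ (N →L[ℂ] N)}

/-- The operator space `J ⊗ 𝓛_d + 𝓛_d ⊗ J` (algebraic tensor products). -/
def coidealSpan (J : Submodule ℂ (Fock d →L[ℂ] Fock d)) :
    Submodule ℂ (HTensor (Fock d) (Fock d) →L[ℂ] HTensor (Fock d) (Fock d)) :=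
  Submodule.span ℂ {T | ∃ b ∈ J, ∃ c ∈ toeplitz d, T = otmul b c} ⊔
    Submodule.span ℂ {T | ∃ c ∈ toeplitz d, ∃ b ∈ J, T = otmul c b}

theorem otmul_mem_coidealSpan_left {J : Submodule ℂ (Fock d →L[ℂ] Fock d)}
    {b c : Fock d →L[ℂ] Fock d} (hb : b ∈ J) (hc : c ∈ toeplitz d) :
    otmul b c ∈ coidealSpan J :=
  Submodule.mem_sup_left (Submodule.subset_span ⟨b, hb, c, hc, rfl⟩)

theorem otmul_mem_coidealSpan_right {J : Submodule ℂ (Fock d →L[ℂ] Fock d)}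
    {b c : Fock d →L[ℂ] Fock d} (hc : c ∈ toeplitz d) (hb : b ∈ J) :
    otmul c b ∈ coidealSpan J :=
  Submodule.mem_sup_right (Submodule.subset_span ⟨c, hc, b, hb, rfl⟩)

theorem coidealSpan_le {J : Submodule ℂ (Fock d →L[ℂ] Fock d)}
    {C : Submodule ℂ (HTensor (Fock d) (Fock d) →L[ℂ] HTensor (Fock d) (Fock d))}
    (h₁ : ∀ b ∈ J, ∀ c ∈ toeplitz d, otmul b c ∈ C)
    (h₂ : ∀ b ∈ J, ∀ c ∈ toeplitz d, otmul c b ∈ C) : coidealSpan J ≤ C := by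
  refine sup_le ?_ ?_ <;> rw [Submodule.span_le]
  · rintro _ ⟨b, hb, c, hc, rfl⟩
    exact h₁ b hb c hc
  · rintro _ ⟨c, hc, b, hb, rfl⟩
    exact h₂ b hb c hc

/-- Let `Δ` be a linear map on a quotient of the Toeplitz algebra with `Δ(S_w) = S_w ⊗ S_w`.
For a polynomial `A` in the kernel `J` of the quotient map, `Δ(A)` is in `J ⊗ 𝓛_d + 𝓛_d ⊗ J`. -/
theorem comulAux_mem_coidealSpan (J : Submodule ℂ (Fock d →L[ℂ] Fock d))
    (hJ : ∀ A ∈ toeplitz d, p A = 0 → A ∈ J)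
    (Δ : 𝒜 →ₗ[ℂ] (HTensor N N →L[ℂ] HTensor N N))
    (hΔ : ∀ w : Words d, ∃ a : 𝒜, (a : N →L[ℂ] N) = p (leftShift w) ∧
      Δ a = otmul (p (leftShift w)) (p (leftShift w)))
    {A : Fock d →L[ℂ] Fock d} (hA : A ∈ polynomials d) (hpA : p A = 0) :
    comulAux d A ∈ coidealSpan J := by
  obtain ⟨s, hsL, hs⟩ := exists_generalized_inverse p (Subalgebra.toSubmodule (toeplitz d))
  obtain ⟨F, hF⟩ : ∃ F : (N →L[ℂ] N) ⊗[ℂ] (N →L[ℂ] N) →ₗ[ℂ] (HTensor N N →L[ℂ] HTensor N N),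
    F = TensorProduct.lift (otmulₗ N N N N) := ⟨_, rfl⟩
  obtain ⟨G, hG⟩ : ∃ G : (N →L[ℂ] N) ⊗[ℂ] (N →L[ℂ] N) →ₗ[ℂ]
      (HTensor (Fock d) (Fock d) →L[ℂ] HTensor (Fock d) (Fock d)),
      ∀ a b, G (a ⊗ₜ b) = otmul (s a) (s b) :=
    ⟨TensorProduct.lift ((otmulₗ (Fock d) (Fock d) (Fock d) (Fock d)).compl₁₂ s s),
      fun _ _ => rfl⟩
  obtain ⟨a, t, ha, h1, h2⟩ := exists_of_mem_span (i := 𝒜.val.toLinearMap) (p := p) (Δ := Δ)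
    (F := F) (P := comulAux d) (G := G) (Q := coidealSpan J) (v := leftShift) (fun w => by
      obtain ⟨a, ha, hΔa⟩ := hΔ w
      refine ⟨a, p (leftShift w) ⊗ₜ p (leftShift w), ha, ?_, ?_⟩
      · rw [hΔa, hF, TensorProduct.lift.tmul, otmulₗ_apply]
      · rw [hG, comulAux_leftShift]
        have hL := leftShift_mem d w
        have hq : s (p (leftShift w)) ∈ toeplitz d := hsL _
        -- `L_w` and the chosen lift of `S_w` have the same image, so they differ by an element of
        -- `J`; telescoping then puts the difference of their tensor squares in `J ⊗ 𝓛_d + 𝓛_d ⊗ J`.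
        have hsub : leftShift w - s (p (leftShift w)) ∈ J :=
          hJ _ (sub_mem hL hq) (by rw [map_sub, hs _ hL, sub_self])
        rw [otmul_sub_otmul]
        exact add_mem (otmul_mem_coidealSpan_left hsub hL)
          (otmul_mem_coidealSpan_right hq hsub)) hA
  -- As `p A = 0`, the image of `t` in `B(N ⊗ N)` is `Δ 0 = 0`. Injectivity gives `t = 0`, so the
  -- lifted term `G t` disappears.
  have h0 : a = 0 := Subtype.ext (ha.trans hpA)
  rw [h0, map_zero, hF] at h1
  rwa [eq_zero_of_lift_otmul_eq_zero h1.symm, map_zero, sub_zero] at h2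

end Polynomials

/-! ### The ideal of operators with comultiplication in the closure of `J ⊗ 𝓛_d + 𝓛_d ⊗ J` -/

namespace ClosedIdeal

variable {d : ℕ} (J : ClosedIdeal d)

theorem leftShift_mul_mem_closure (w : Words d)
    {T : HTensor (Fock d) (Fock d) →L[ℂ] HTensor (Fock d) (Fock d)}
    (hT : T ∈ ultraweakClosure (coidealSpan J.carrier)) :
    otmul (leftShift w) (leftShift w) * T ∈ ultraweakClosure (coidealSpan J.carrier) := by
  have hw := leftShift_mem d w
  have hle : coidealSpan J.carrier ≤ (ultraweakClosure (coidealSpan J.carrier)).comap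
      (LinearMap.mulLeft ℂ (otmul (leftShift w) (leftShift w))) := by
    refine coidealSpan_le (fun b hb c hc => ?_) fun b hb c hc => ?_ <;>
      rw [Submodule.mem_comap, LinearMap.mulLeft_apply, otmul_mul] <;>
      refine le_ultraweakClosure _ ?_
    · exact otmul_mem_coidealSpan_left (J.mul_mem_left _ hw b hb) (mul_mem hw hc)
    · exact otmul_mem_coidealSpan_right (mul_mem hw hc) (J.mul_mem_left _ hw b hb)
  have h := ultraweakClosure_le hle (isWeakStarClosed_comap
    (isWeakStarClosed_ultraweakClosure _) (continuous_mul_left_ultraweak _)) hT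
  rwa [Submodule.mem_comap, LinearMap.mulLeft_apply] at h

theorem mul_leftShift_mem_closure (w : Words d)
    {T : HTensor (Fock d) (Fock d) →L[ℂ] HTensor (Fock d) (Fock d)}
    (hT : T ∈ ultraweakClosure (coidealSpan J.carrier)) :
    T * otmul (leftShift w) (leftShift w) ∈ ultraweakClosure (coidealSpan J.carrier) := by
  have hw := leftShift_mem d w
  have hle : coidealSpan J.carrier ≤ (ultraweakClosure (coidealSpan J.carrier)).comap
      (LinearMap.mulRight ℂ (otmul (leftShift w) (leftShift w))) := by
    refine coidealSpan_le (fun b hb c hc => ?_) fun b hb c hc => ?_ <;>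
      rw [Submodule.mem_comap, LinearMap.mulRight_apply, otmul_mul] <;>
      refine le_ultraweakClosure _ ?_
    · exact otmul_mem_coidealSpan_left (J.mul_mem_right _ hw b hb) (mul_mem hc hw)
    · exact otmul_mem_coidealSpan_right (mul_mem hc hw) (J.mul_mem_right _ hw b hb)
  have h := ultraweakClosure_le hle (isWeakStarClosed_comap
    (isWeakStarClosed_ultraweakClosure _) (continuous_mul_right_ultraweak _)) hT
  rwa [Submodule.mem_comap, LinearMap.mulRight_apply] at h

/-- For fixed `T` the map `A ↦ Δ(A) T` is weak* continuous, so it is enough to multiply by `L_w ⊗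
L_w`, which preserves `J ⊗ 𝓛_d + 𝓛_d ⊗ J` because `J` is an ideal. -/
theorem comulAux_mul_mem_closure {A : Fock d →L[ℂ] Fock d} (hA : A ∈ toeplitz d)
    {T : HTensor (Fock d) (Fock d) →L[ℂ] HTensor (Fock d) (Fock d)}
    (hT : T ∈ ultraweakClosure (coidealSpan J.carrier)) :
    comulAux d A * T ∈ ultraweakClosure (coidealSpan J.carrier) := by
  let := ultraweak (Fock d)
  let := ultraweak (HTensor (Fock d) (Fock d))
  have hc := isWeakStarClosed_comap (isWeakStarClosed_ultraweakClosure (coidealSpan J.carrier))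
    (Φ := LinearMap.mulRight ℂ T ∘ₗ comulAux d)
    ((continuous_mul_right_ultraweak T).comp (continuous_comulAux d))
  refine toeplitz_le_of_leftShift_mem hc (fun w => ?_) hA
  rw [Submodule.mem_comap, LinearMap.comp_apply, LinearMap.mulRight_apply, comulAux_leftShift]
  exact J.leftShift_mul_mem_closure w hT

theorem mul_comulAux_mem_closure {A : Fock d →L[ℂ] Fock d} (hA : A ∈ toeplitz d)
    {T : HTensor (Fock d) (Fock d) →L[ℂ] HTensor (Fock d) (Fock d)}
    (hT : T ∈ ultraweakClosure (coidealSpan J.carrier)) :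
    T * comulAux d A ∈ ultraweakClosure (coidealSpan J.carrier) := by
  let := ultraweak (Fock d)
  let := ultraweak (HTensor (Fock d) (Fock d))
  have hc := isWeakStarClosed_comap (isWeakStarClosed_ultraweakClosure (coidealSpan J.carrier))
    (Φ := LinearMap.mulLeft ℂ T ∘ₗ comulAux d)
    ((continuous_mul_left_ultraweak T).comp (continuous_comulAux d))
  refine toeplitz_le_of_leftShift_mem hc (fun w => ?_) hA
  rw [Submodule.mem_comap, LinearMap.comp_apply, LinearMap.mulLeft_apply, comulAux_leftShift]
  exact J.mul_leftShift_mem_closure w hT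

/-- The operators in `𝓛_d` with comultiplication in the weak* closure of
`J ⊗ 𝓛_d + 𝓛_d ⊗ J`. -/
def comulPreimage : ClosedIdeal d where
  carrier := Subalgebra.toSubmodule (toeplitz d) ⊓
    (ultraweakClosure (coidealSpan J.carrier)).comap (comulAux d)
  le := inf_le_left
  mul_mem_left A hA B hB := by
    have hB' : B ∈ toeplitz d := hB.1
    refine ⟨mul_mem (S := Subalgebra ℂ (Fock d →L[ℂ] Fock d)) hA hB', ?_⟩
    rw [SetLike.mem_coe, Submodule.mem_comap, comulAux_mul hA hB']
    exact J.comulAux_mul_mem_closure hA hB.2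
  mul_mem_right A hA B hB := by
    have hB' : B ∈ toeplitz d := hB.1
    refine ⟨mul_mem (S := Subalgebra ℂ (Fock d →L[ℂ] Fock d)) hB' hA, ?_⟩
    rw [SetLike.mem_coe, Submodule.mem_comap, comulAux_mul hB' hA]
    exact J.mul_comulAux_mem_closure hA hB.2
  isWOTClosed := by
    -- `Δ` is controlled in the weak* topology only; the passage to WOT-closedness uses that normal
    -- functionals on `𝓛_d` are vector functionals.
    refine isWOTClosed_of_isWeakStarClosed inf_le_left ?_
    let := ultraweak (Fock d)
    exact IsClosed.inter isWOTClosed_toeplitz.isWeakStarClosed (isWeakStarClosed_comap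
      (isWeakStarClosed_ultraweakClosure _) (continuous_comulAux d))

variable {J}

/-- The generators are polynomials in `J`, so they belong to `comulPreimage` by the algebraic
argument; minimality of the generated ideal carries this over to all of `J`. -/
theorem IsHomogeneous.isHopfIdeal (hJ : J.IsHomogeneous)
    {Δ : J.compressionAlgebra →ₐ[ℂ] (HTensor J.coinv J.coinv →L[ℂ] HTensor J.coinv J.coinv)}
    (hΔ : ∀ w : Words d, Δ (J.gen w) =
      otmul (J.gen w : J.coinv →L[ℂ] J.coinv) (J.gen w : J.coinv →L[ℂ] J.coinv)) :
    J.IsHopfIdeal := by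
  obtain ⟨S, hSh, hSJ, hmin⟩ := hJ
  have hle : J.carrier ≤ J.comulPreimage.carrier := by
    refine hmin _ fun A hA => ⟨J.le (hSJ hA), le_ultraweakClosure _ ?_⟩
    obtain ⟨n, hn⟩ := hSh A hA
    have hpoly : A ∈ polynomials d := by
      refine Submodule.span_mono ?_ hn
      rintro _ ⟨w, -, rfl⟩
      exact ⟨w, rfl⟩
    exact comulAux_mem_coidealSpan (N := J.coinv) (p := J.compress) (𝒜 := J.compressionAlgebra)
      J.carrier (fun A hA => J.mem_of_compress_eq_zero hA) Δ.toLinearMap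
      (fun w => ⟨J.gen w, rfl, hΔ w⟩) hpoly (J.compress_eq_zero (hSJ hA))
  exact ⟨J.le, J.isWOTClosed.isWeakStarClosed, fun a ha => (hle ha).2⟩

end ClosedIdeal

end

end HopfDual

theorem theorem4p2 (d : ℕ) (J : HopfDual.ClosedIdeal d) :
    (J.IsHopfIdeal →
      ∃ Δ : J.compressionAlgebra →ₐ[ℂ]
          (HopfDual.HTensor J.coinv J.coinv →L[ℂ] HopfDual.HTensor J.coinv J.coinv),
        HopfDual.IsHopfDualAlgebra J.compressionAlgebra Δ ∧
        (∀ w : HopfDual.Words d, Δ (J.gen w) =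
          HopfDual.otmul (J.gen w : J.coinv →L[ℂ] J.coinv) (J.gen w : J.coinv →L[ℂ] J.coinv)) ∧
        ∀ A : HopfDual.toeplitz d, Δ (J.proj A) = J.compress₂ (HopfDual.comul d A)) ∧
    (J.IsHomogeneous →
      (∃ Δ : J.compressionAlgebra →ₐ[ℂ]
          (HopfDual.HTensor J.coinv J.coinv →L[ℂ] HopfDual.HTensor J.coinv J.coinv),
        HopfDual.IsHopfDualAlgebra J.compressionAlgebra Δ ∧
        ∀ w : HopfDual.Words d, Δ (J.gen w) =
          HopfDual.otmul (J.gen w : J.coinv →L[ℂ] J.coinv) (J.gen w : J.coinv →L[ℂ] J.coinv)) →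
      J.IsHopfIdeal) := by
  refine ⟨fun hJ => ?_, fun hJ h => ?_⟩
  · exact hJ.exists_comultiplication
  · obtain ⟨Δ, -, hΔ⟩ := h
    exact hJ.isHopfIdeal hΔ
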